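/- Let $p$ be a prime, $d\ge 1$ an integer, and let $\psi:(\mathbb{Q}_p,+)\to\mathbb{C}_p^\times$ be a non-trivial smooth character (a homomorphism with open kernel). Let $W=\mathbb{Q}_p^d\oplus\mathbb{Q}_p^d$ (row vectors) with the symplectic form $\omega((x_1,y_1),(x_2,y_2))=x_1\cdot y_2-y_1\cdot x_2$, and let $\mathcal{H}=W\times\mathbb{Q}_p$ be the Heisenberg group, with the product topology and the multiplication $$[w_1,t_1]\cdot[w_2,t_2]=[w_1+w_2,\;t_1+t_2+\tfrac12\omega(w_1,w_2)].$$ Let $\mathcal{S}$ be the space of locally constant, compactly supported functions $\mathbb{Q}_p^d\to\mathbb{C}_p$, with the Schrödinger representation $$(\rho_\psi([(a,b),t])f)(x)=\psi\bigl(t+\tfrac12 a\cdot b+b\cdot x\bigr)f(x+a).$$ The group $\mathrm{Sp}_{2d}(\mathbb{Q}_p)$ acts on $\mathcal{H}$ from the right by $[w,t]\cdot g=[wg,t]$. An intertwining operator corresponding to $g\in \mathrm{Sp}_{2d}(\mathbb{Q}_p)$ is an invertible linear operator $T_g$ on $\mathcal{S}$ such that $\rho_\psi(h)\circ T_g=T_g\circ\rho_\psi(h\cdot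 g)$ for all $h\in\mathcal{H}$. Let $P\subset \mathrm{Sp}_{2d}(\mathbb{Q}_p)$ be the subgroup of the matrices whose lower left $d\times d$ block is $0$, and let $\mathrm{Gr}=P\backslash \mathrm{Sp}_{2d}(\mathbb{Q}_p)$ be the Grassmannian of right cosets $Pg$. Norms on $\mathbb{C}_p$-vector spaces are non-archimedean, and a Banach representation of $\mathcal{H}$ is a representation of $\mathcal{H}$ on a $\mathbb{C}_p$-vector space that is complete with respect to a given $\mathcal{H}$-invariant norm. For each $\alpha\in \mathrm{Gr}$ there is exactly one $\mathcal{H}$-invariant norm $\|\cdot\|_\alpha$ on $\mathcal{S}$ with $\|\mathbf{1}_{\mathbb{Z}_p^d}\|_\alpha=1$ that is, for some $g$ with $\alpha=Pg$ and some intertwining operator $T_g$ corresponding to $g$, a positive multiple of the norm $f\mapsto\sup_{x\in\mathbb{Q}_p^d}|T_g(f)(x)|_p$. Let $\widehat{\mathcal{S}}_\alpha$ be the completion of $\mathcal{S}$ with respect to $\|\cdot\|_\alpha$, with the continuous extension of $\rho_\psi$. Then the following hold. 1. $\widehat{\mathcal{S}}_\alpha$ is a strongly irreducible Banach representation of $\mathcal{H}$: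 for every non-zero $v\in\widehat{\mathcal{S}}_\alpha$, every $w\in\widehat{\mathcal{S}}_\alpha$ can be written as a convergent sum $w=\sum_{h\in\mathcal{H}}\lambda_h\cdot h(v)$, where $\lambda_h\in\mathbb{C}_p$ and, for every $\varepsilon>0$, $|\lambda_h|_p\ge\varepsilon$ for at most finitely many $h$. 2. The smooth part of $\widehat{\mathcal{S}}_\alpha$, that is, the set of the vectors whose stabilizer in $\mathcal{H}$ is open, is precisely $\mathcal{S}$. 3. For every $\beta\in \mathrm{Gr}$, the $\mathbb{C}_p$-vector space $\mathrm{Hom}_{\mathcal{H}}(\widehat{\mathcal{S}}_\alpha,\widehat{\mathcal{S}}_\beta)$ of continuous $\mathcal{H}$-equivariant linear maps is isomorphic to $\mathbb{C}_p$ if $\alpha=\beta$, and is $0$ if $\alpha\ne\beta$. -/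

import Mathlib

open scoped Topology Matrix

/-! ### Norms and Banach representations over `ℂ_[p]` -/

section BanachRepresentations

variable {p : ℕ} [Fact p.Prime] {G : Type*} [Group G]

/-- A `G`-invariant (non-archimedean) norm on a representation `ρ` of `G` over `ℂ_[p]`. -/
@[ext]
structure InvariantNorm {V : Type*} [AddCommGroup V] [Module ℂ_[p] V]
    (ρ : Representation ℂ_[p] G V) where
  /-- The value of the norm at a vector. -/
  toFun : V → ℝ
  nonneg : ∀ v, 0 ≤ toFun v
  eq_zero_iff : ∀ v, toFun v = 0 ↔ v = 0
  smul_eq : ∀ (a : ℂ_[p]) (v : V), toFun (a • v) = ‖a‖ * toFun v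
  add_le_max : ∀ v w, toFun (v + w) ≤ max (toFun v) (toFun w)
  invariant : ∀ (g : G) (v : V), toFun (ρ g v) = toFun v

/-- A representation `ρ` of `G` on a normed `ℂ_[p]`-vector space `B` is a Banach representation if
`B` is complete and its norm is non-archimedean and `G`-invariant. -/
structure IsBanachRep {B : Type*} [NormedAddCommGroup B] [NormedSpace ℂ_[p] B]
    (ρ : Representation ℂ_[p] G B) : Prop where
  complete : CompleteSpace B
  ultrametric : ∀ v w : B, ‖v + w‖ ≤ max ‖v‖ ‖w‖
  invariant : ∀ (g : G) (v : B), ‖ρ g v‖ = ‖v‖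

/-- A vector `v` is strongly cyclic if every vector `w` can be written as a convergent sum
`∑ g, c g • ρ g v`, where for every `ε > 0` only finitely many `g` satisfy `ε ≤ ‖c g‖`. -/
def IsStronglyCyclic {B : Type*} [NormedAddCommGroup B] [NormedSpace ℂ_[p] B]
    (ρ : Representation ℂ_[p] G B) (v : B) : Prop :=
  ∀ w : B, ∃ c : G → ℂ_[p],
    (∀ ε : ℝ, 0 < ε → {g : G | ε ≤ ‖c g‖}.Finite) ∧ HasSum (fun g => c g • ρ g v) w

/-- A Banach representation all of whose non-zero vectors are strongly cyclic. -/
def IsStronglyIrreducible {B : Type*} [NormedAddCommGroup B] [NormedSpace ℂ_[p] B]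
    (ρ : Representation ℂ_[p] G B) : Prop :=
  IsBanachRep ρ ∧ ∀ v : B, v ≠ 0 → IsStronglyCyclic ρ v

/-- The smooth part of a representation of a topological group: the set of vectors whose
stabilizer is open. -/
def smoothVectors [TopologicalSpace G] {V : Type*} [AddCommGroup V] [Module ℂ_[p] V]
    (ρ : Representation ℂ_[p] G V) : Set V :=
  {v | IsOpen {g : G | ρ g v = v}}

/-- The space of continuous `G`-equivariant linear maps between two representations. -/
def equivariantMaps {B C : Type*} [NormedAddCommGroup B] [NormedSpace ℂ_[p] B]
    [NormedAddCommGroup C] [NormedSpace ℂ_[p] C]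
    (ρ : Representation ℂ_[p] G B) (σ : Representation ℂ_[p] G C) :
    Submodule ℂ_[p] (B →L[ℂ_[p]] C) where
  carrier := {F | ∀ (g : G) (v : B), F (ρ g v) = σ g (F v)}
  add_mem' := by
    intro F F' hF hF' g v
    simp [hF g v, hF' g v]
  zero_mem' := by
    intro g v
    simp
  smul_mem' := by
    intro a F hF g v
    simp [hF g v]

namespace InvariantNorm

variable {V : Type*} [AddCommGroup V] [Module ℂ_[p] V] {ρ : Representation ℂ_[p] G V}

theorem map_zero (N : InvariantNorm ρ) : N.toFun 0 = 0 := (N.eq_zero_iff 0).2 rfl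

theorem map_neg (N : InvariantNorm ρ) (v : V) : N.toFun (-v) = N.toFun v := by
  have h := N.smul_eq (-1) v
  rwa [neg_one_smul, norm_neg, norm_one, one_mul] at h

theorem add_le (N : InvariantNorm ρ) (v w : V) : N.toFun (v + w) ≤ N.toFun v + N.toFun w :=
  (N.add_le_max v w).trans
    (max_le (le_add_of_nonneg_right (N.nonneg w)) (le_add_of_nonneg_left (N.nonneg v)))

/-- The vector space `V`, equipped with the norm `N`. -/
def Space (_N : InvariantNorm ρ) : Type _ := V

noncomputable instance (N : InvariantNorm ρ) : NormedAddCommGroup N.Space :=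
  AddGroupNorm.toNormedAddCommGroup (E := V)
    { toFun := N.toFun
      map_zero' := N.map_zero
      add_le' := N.add_le
      neg' := N.map_neg
      eq_zero_of_map_eq_zero' := fun v hv => (N.eq_zero_iff v).1 hv }

instance (N : InvariantNorm ρ) : Module ℂ_[p] N.Space := inferInstanceAs (Module ℂ_[p] V)

theorem norm_def (N : InvariantNorm ρ) (v : N.Space) : ‖v‖ = N.toFun v := rfl

noncomputable instance (N : InvariantNorm ρ) : NormedSpace ℂ_[p] N.Space where
  norm_smul_le a v := (N.smul_eq a v).le

/-- The completion of `V` with respect to the norm `N`. -/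
abbrev Completion (N : InvariantNorm ρ) : Type _ := UniformSpace.Completion N.Space

/-- The canonical embedding of `V` in its completion with respect to `N`. -/
noncomputable def toCompletion (N : InvariantNorm ρ) (v : V) : N.Completion :=
  UniformSpace.Completion.coe' (α := N.Space) v

/-- The action of a group element on `V`, as a continuous linear map with respect to `N`. -/
noncomputable def action (N : InvariantNorm ρ) (g : G) : N.Space →L[ℂ_[p]] N.Space :=
  LinearMap.mkContinuous (E := N.Space) (F := N.Space) (ρ g) 1 fun v => by
    rw [one_mul]
    exact (N.invariant g v).le

theorem action_apply (N : InvariantNorm ρ) (g : G) (v : N.Space) : N.action g v = ρ g v := rfl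

/-- The continuous extension of the representation `ρ` to the completion with respect to `N`. -/
noncomputable def completionRep (N : InvariantNorm ρ) :
    Representation ℂ_[p] G N.Completion where
  toFun g := ((N.action g).completion : N.Completion →ₗ[ℂ_[p]] N.Completion)
  map_one' := by
    ext v
    induction v using UniformSpace.Completion.induction_on with
    | hp => exact isClosed_eq (N.action 1).completion.continuous continuous_id
    | ih v =>
      change (N.action 1).completion (v : N.Completion) = v
      rw [ContinuousLinearMap.completion_apply_coe, action_apply, _root_.map_one]
      rfl
  map_mul' g h := by
    ext v
    induction v using UniformSpace.Completion.induction_on with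
    | hp =>
      exact isClosed_eq (N.action (g * h)).completion.continuous
        ((N.action g).completion.continuous.comp (N.action h).completion.continuous)
    | ih v =>
      change (N.action (g * h)).completion (v : N.Completion)
        = (N.action g).completion ((N.action h).completion (v : N.Completion))
      rw [ContinuousLinearMap.completion_apply_coe, ContinuousLinearMap.completion_apply_coe,
        ContinuousLinearMap.completion_apply_coe, action_apply, _root_.map_mul]
      rfl

theorem completionRep_toCompletion (N : InvariantNorm ρ) (g : G) (v : V) :
    N.completionRep g (N.toCompletion v) = N.toCompletion (ρ g v) :=
  ContinuousLinearMap.completion_apply_coe (N.action g) v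

end InvariantNorm

end BanachRepresentations

/-! ### The Heisenberg group -/

/-- The Heisenberg group of dimension `2 * d + 1` over `ℚ_[p]`. Its elements are the pairs `[w, t]`
with `w = (a, b)` in `W = ℚ_[p]^d ⊕ ℚ_[p]^d` and `t` in `ℚ_[p]`. -/
@[ext]
structure Heisenberg (p d : ℕ) [Fact p.Prime] where
  /-- The component in `W`. -/
  w : Fin d ⊕ Fin d → ℚ_[p]
  /-- The central component. -/
  t : ℚ_[p]

namespace Heisenberg

variable {p d : ℕ} [Fact p.Prime]

/-- The component `a` of `[(a, b), t]`. -/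
def a (h : Heisenberg p d) : Fin d → ℚ_[p] := fun i => h.w (Sum.inl i)

/-- The component `b` of `[(a, b), t]`. -/
def b (h : Heisenberg p d) : Fin d → ℚ_[p] := fun i => h.w (Sum.inr i)

/-- The symplectic form `ω((x₁, y₁), (x₂, y₂)) = x₁ ⬝ y₂ - y₁ ⬝ x₂` on `W`. -/
noncomputable def omega (v w : Fin d ⊕ Fin d → ℚ_[p]) : ℚ_[p] :=
  (v ∘ Sum.inl) ⬝ᵥ (w ∘ Sum.inr) - (v ∘ Sum.inr) ⬝ᵥ (w ∘ Sum.inl)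

noncomputable instance : Mul (Heisenberg p d) :=
  ⟨fun g h => ⟨g.w + h.w, g.t + h.t + 1 / 2 * omega g.w h.w⟩⟩

noncomputable instance : One (Heisenberg p d) := ⟨⟨0, 0⟩⟩

noncomputable instance : Inv (Heisenberg p d) := ⟨fun g => ⟨-g.w, -g.t⟩⟩

theorem mul_def (g h : Heisenberg p d) :
    g * h = ⟨g.w + h.w, g.t + h.t + 1 / 2 * omega g.w h.w⟩ := rfl

theorem one_def : (1 : Heisenberg p d) = ⟨0, 0⟩ := rfl

theorem inv_def (g : Heisenberg p d) : g⁻¹ = ⟨-g.w, -g.t⟩ := rfl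

theorem omega_add_left (u v w : Fin d ⊕ Fin d → ℚ_[p]) :
    omega (u + v) w = omega u w + omega v w := by
  simp only [omega, Pi.add_comp, add_dotProduct]
  ring

theorem omega_add_right (u v w : Fin d ⊕ Fin d → ℚ_[p]) :
    omega u (v + w) = omega u v + omega u w := by
  simp only [omega, Pi.add_comp, dotProduct_add]
  ring

theorem omega_neg_self (v : Fin d ⊕ Fin d → ℚ_[p]) : omega (-v) v = 0 := by
  have h1 : (-v) ∘ Sum.inl = -(v ∘ (Sum.inl : Fin d → Fin d ⊕ Fin d)) := rfl
  have h2 : (-v) ∘ Sum.inr = -(v ∘ (Sum.inr : Fin d → Fin d ⊕ Fin d)) := rfl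
  rw [omega, h1, h2, neg_dotProduct, neg_dotProduct, dotProduct_comm (v ∘ Sum.inl)]
  ring

theorem omega_zero_left (v : Fin d ⊕ Fin d → ℚ_[p]) : omega 0 v = 0 := by
  simp [omega, Pi.zero_comp]

theorem omega_zero_right (v : Fin d ⊕ Fin d → ℚ_[p]) : omega v 0 = 0 := by
  simp [omega, Pi.zero_comp]

noncomputable instance : Group (Heisenberg p d) where
  mul_assoc g h k := by
    simp only [mul_def, omega_add_left, omega_add_right, Heisenberg.mk.injEq]
    exact ⟨add_assoc _ _ _, by ring⟩
  one_mul g := by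
    simp [mul_def, one_def, omega_zero_left]
  mul_one g := by
    simp [mul_def, one_def, omega_zero_right]
  inv_mul_cancel g := by
    simp [mul_def, one_def, inv_def, omega_neg_self]

/-- The topology of `W × ℚ_[p]`. -/
noncomputable instance : TopologicalSpace (Heisenberg p d) :=
  TopologicalSpace.induced (fun h => (h.w, h.t)) inferInstance

/-- The right action `[w, t] · g = [w g, t]` of the symplectic group, where the elements of `W` are
row vectors. -/
noncomputable def act (h : Heisenberg p d) (g : Matrix.symplecticGroup (Fin d) ℚ_[p]) : Heisenberg p d :=
  ⟨h.w ᵥ* (g : Matrix (Fin d ⊕ Fin d) (Fin d ⊕ Fin d) ℚ_[p]), h.t⟩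

end Heisenberg

/-! ### Schwartz functions and the Schrödinger representation -/

section Schrodinger

variable {p : ℕ} [Fact p.Prime]

/-- The space of locally constant and compactly supported functions from `ℚ_[p]^d` to `ℂ_[p]`. -/
noncomputable def SchwartzFun (p d : ℕ) [Fact p.Prime] : Submodule ℂ_[p] ((Fin d → ℚ_[p]) → ℂ_[p]) where
  carrier := {f | IsLocallyConstant f ∧ HasCompactSupport f}
  add_mem' := fun hf hg => ⟨hf.1.add hg.1, hf.2.add hg.2⟩
  zero_mem' := ⟨IsLocallyConstant.const 0, HasCompactSupport.zero⟩
  smul_mem' := fun a f hf => by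
    refine ⟨hf.1.comp (fun z => a • z), ?_⟩
    exact hf.2.comp_left (g := fun z => a • z) (smul_zero a)

/-- A character of `(ℚ_[p], +)` with values in the units of `ℂ_[p]` is smooth if its kernel
is open. -/
def IsSmoothChar (ψ : AddChar ℚ_[p] ℂ_[p]) : Prop := IsOpen {x | ψ x = 1}

theorem IsSmoothChar.isLocallyConstant {ψ : AddChar ℚ_[p] ℂ_[p]} (hψ : IsSmoothChar ψ) :
    IsLocallyConstant ψ := by
  rw [IsLocallyConstant.iff_exists_open]
  intro x
  refine ⟨(fun y => y - x) ⁻¹' {z | ψ z = 1}, hψ.preimage (by fun_prop), by simp, ?_⟩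
  intro y hy
  have hy' : ψ (y - x) = 1 := hy
  calc ψ y = ψ (y - x + x) := by rw [sub_add_cancel]
    _ = ψ x := by rw [AddChar.map_add_eq_mul, hy', one_mul]

/-- The function
`x ↦ ψ (t + (1 / 2) * (a ⬝ b) + b ⬝ x) * f (x + a)`. -/
noncomputable def schrodingerFun {d : ℕ} (ψ : AddChar ℚ_[p] ℂ_[p]) (h : Heisenberg p d)
    (f : (Fin d → ℚ_[p]) → ℂ_[p]) : (Fin d → ℚ_[p]) → ℂ_[p] :=
  fun x => ψ (h.t + 1 / 2 * (h.a ⬝ᵥ h.b) + h.b ⬝ᵥ x) * f (x + h.a)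

theorem schrodingerFun_mem {d : ℕ} {ψ : AddChar ℚ_[p] ℂ_[p]} (hψ : IsSmoothChar ψ)
    (h : Heisenberg p d) {f : (Fin d → ℚ_[p]) → ℂ_[p]} (hf : f ∈ SchwartzFun p d) :
    schrodingerFun ψ h f ∈ SchwartzFun p d := by
  constructor
  · refine IsLocallyConstant.mul (f := fun x => ψ (h.t + 1 / 2 * (h.a ⬝ᵥ h.b) + h.b ⬝ᵥ x))
      (g := fun x => f (x + h.a)) ?_ ?_
    · exact hψ.isLocallyConstant.comp_continuous
        (f := fun x : Fin d → ℚ_[p] => h.t + 1 / 2 * (h.a ⬝ᵥ h.b) + h.b ⬝ᵥ x)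
        (by unfold dotProduct; fun_prop)
    · exact hf.1.comp_continuous (f := fun x : Fin d → ℚ_[p] => x + h.a) (by fun_prop)
  · exact (hf.2.comp_homeomorph (Homeomorph.addRight h.a)).mul_left

/-- The Schrödinger representation of the Heisenberg group with central character `ψ`. -/
noncomputable def schrodinger (d : ℕ) (ψ : AddChar ℚ_[p] ℂ_[p]) (hψ : IsSmoothChar ψ) :
    Representation ℂ_[p] (Heisenberg p d) (SchwartzFun p d) where
  toFun h :=
    { toFun := fun f => ⟨schrodingerFun ψ h f, schrodingerFun_mem hψ h f.2⟩
      map_add' := by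
        intro f g
        ext x
        simp [schrodingerFun, mul_add]
      map_smul' := by
        intro c f
        ext x
        simp [schrodingerFun, mul_left_comm] }
  map_one' := by
    ext f x
    have ha : (1 : Heisenberg p d).a = 0 := rfl
    have hb : (1 : Heisenberg p d).b = 0 := rfl
    have ht : (1 : Heisenberg p d).t = 0 := rfl
    simp [schrodingerFun, ha, hb, ht]
  map_mul' g h := by
    ext f x
    have ha : (g * h).a = g.a + h.a := rfl
    have hb : (g * h).b = g.b + h.b := rfl
    have ht : (g * h).t = g.t + h.t + 1 / 2 * (g.a ⬝ᵥ h.b - g.b ⬝ᵥ h.a) := rfl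
    change ψ ((g * h).t + 1 / 2 * ((g * h).a ⬝ᵥ (g * h).b) + (g * h).b ⬝ᵥ x)
        * (f : (Fin d → ℚ_[p]) → ℂ_[p]) (x + (g * h).a)
      = ψ (g.t + 1 / 2 * (g.a ⬝ᵥ g.b) + g.b ⬝ᵥ x)
        * (ψ (h.t + 1 / 2 * (h.a ⬝ᵥ h.b) + h.b ⬝ᵥ (x + g.a))
          * (f : (Fin d → ℚ_[p]) → ℂ_[p]) (x + g.a + h.a))
    rw [← mul_assoc, ← AddChar.map_add_eq_mul, ha, hb, ht, add_assoc x]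
    congr 2
    simp only [add_dotProduct, dotProduct_add]
    rw [dotProduct_comm h.a g.b, dotProduct_comm h.b g.a]
    ring

/-- The sup norm of a function. -/
noncomputable def supNorm {d : ℕ} (f : SchwartzFun p d) : ℝ :=
  ⨆ x : Fin d → ℚ_[p], ‖(f : (Fin d → ℚ_[p]) → ℂ_[p]) x‖

/-- The characteristic function of `ℤ_[p]^d`, the set of vectors with coordinates of norm at most
`1`. -/
noncomputable def indicatorZp (p d : ℕ) [Fact p.Prime] : SchwartzFun p d :=
  ⟨Set.indicator {x | ∀ i, ‖x i‖ ≤ 1} (fun _ => 1), by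
    have hset : {x : Fin d → ℚ_[p] | ∀ i, ‖x i‖ ≤ 1} = Metric.closedBall 0 1 := by
      ext x
      simp [pi_norm_le_iff_of_nonneg]
    rw [hset]
    constructor
    · have hc : IsClopen (Metric.closedBall (0 : Fin d → ℚ_[p]) 1) :=
        IsUltrametricDist.isClopen_closedBall 0 one_ne_zero
      rw [IsLocallyConstant.iff_exists_open]
      intro x
      by_cases hx : x ∈ Metric.closedBall (0 : Fin d → ℚ_[p]) 1
      · exact ⟨_, hc.isOpen, hx, fun y hy => by
          rw [Set.indicator_of_mem hx, Set.indicator_of_mem hy]⟩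
      · exact ⟨_, hc.compl.isOpen, hx, fun y hy => by
          rw [Set.indicator_of_notMem hx, Set.indicator_of_notMem hy]⟩
    · exact HasCompactSupport.intro (isCompact_closedBall 0 1)
        (fun x hx => Set.indicator_of_notMem hx _)⟩

end Schrodinger

/-! ### Intertwining operators and the norms parametrized by the Grassmannian -/

/-- The Siegel parabolic subgroup: the symplectic matrices with lower left block `0`. -/
def siegelParabolic (p d : ℕ) [Fact p.Prime] :
    Subgroup (Matrix.symplecticGroup (Fin d) ℚ_[p]) where
  carrier := {g | (g : Matrix (Fin d ⊕ Fin d) (Fin d ⊕ Fin d) ℚ_[p]).toBlocks₂₁ = 0}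
  mul_mem' {g h} hg hh := by
    have hg' : (g : Matrix (Fin d ⊕ Fin d) (Fin d ⊕ Fin d) ℚ_[p]).toBlocks₂₁ = 0 := hg
    have hh' : (h : Matrix (Fin d ⊕ Fin d) (Fin d ⊕ Fin d) ℚ_[p]).toBlocks₂₁ = 0 := hh
    change ((g : Matrix (Fin d ⊕ Fin d) (Fin d ⊕ Fin d) ℚ_[p]) * h.1).toBlocks₂₁ = 0
    rw [← Matrix.fromBlocks_toBlocks g.1, ← Matrix.fromBlocks_toBlocks h.1,
      Matrix.fromBlocks_multiply, Matrix.toBlocks_fromBlocks₂₁, hg', hh']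
    simp
  one_mem' := by
    change (1 : Matrix (Fin d ⊕ Fin d) (Fin d ⊕ Fin d) ℚ_[p]).toBlocks₂₁ = 0
    rw [← Matrix.fromBlocks_one, Matrix.toBlocks_fromBlocks₂₁]
  inv_mem' {g} hg := by
    have hg' : (g : Matrix (Fin d ⊕ Fin d) (Fin d ⊕ Fin d) ℚ_[p]).toBlocks₂₁ = 0 := hg
    change (g⁻¹ : Matrix.symplecticGroup (Fin d) ℚ_[p]).1.toBlocks₂₁ = 0
    rw [SymplecticGroup.coe_inv, ← Matrix.fromBlocks_toBlocks g.1, Matrix.J,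
      Matrix.fromBlocks_transpose, Matrix.fromBlocks_neg, Matrix.fromBlocks_multiply,
      Matrix.fromBlocks_multiply, Matrix.toBlocks_fromBlocks₂₁, hg']
    simp

/-- The Grassmannian: the space of right cosets `P g` of the Siegel parabolic `P` in the symplectic
group. -/
abbrev Grassmannian (p d : ℕ) [Fact p.Prime] : Type :=
  Quotient (QuotientGroup.rightRel (siegelParabolic p d))

section GrassmannianNorm

variable {p d : ℕ} [Fact p.Prime] (ψ : AddChar ℚ_[p] ℂ_[p]) (hψ : IsSmoothChar ψ)

/-- `T` is an intertwining operator corresponding to `g`, that is, an isomorphism from the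
representation `[w, t] ↦ ρ ([w, t] · g)` to the Schrödinger representation `ρ`. -/
def IsIntertwining (g : Matrix.symplecticGroup (Fin d) ℚ_[p])
    (T : SchwartzFun p d ≃ₗ[ℂ_[p]] SchwartzFun p d) : Prop :=
  ∀ (h : Heisenberg p d) (f : SchwartzFun p d),
    schrodinger d ψ hψ h (T f) = T (schrodinger d ψ hψ (h.act g) f)

/-- `N` is a norm attached to the point `α` of the Grassmannian: for some `g` with `α = P g` and
some intertwining operator `T` corresponding to `g`, `N` is homothetic to the norm
`f ↦ supNorm (T f)`, and `N` is normalized at the characteristic function of `ℤ_[p]^d`. -/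
def IsNormAt (α : Grassmannian p d) (N : InvariantNorm (schrodinger d ψ hψ)) : Prop :=
  (∃ g : Matrix.symplecticGroup (Fin d) ℚ_[p], Quotient.mk _ g = α ∧
    ∃ T : SchwartzFun p d ≃ₗ[ℂ_[p]] SchwartzFun p d, IsIntertwining ψ hψ g T ∧
      ∃ r : ℝ, 0 < r ∧ ∀ f, N.toFun f = r * supNorm (T f)) ∧
  N.toFun (indicatorZp p d) = 1

end GrassmannianNorm

/-!
The argument rests on one analytic fact: on a bounded region, the characteristic function of a
smaller polydisc is a uniform limit of trigonometric polynomials `x ↦ ∑ c i * ψ (b i ⬝ x)` whose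
coefficients have norm at most `K`, for any `K > 1` (`indicator_polydisc_mem_approxRing`).
Consequently every Schwartz function is, on a given polydisc, a uniform limit of trigonometric
polynomials with coefficients essentially bounded by its sup norm
(`SchwartzFun.exists_trigPoly_close`). The source of this is the polynomial `gaussPoly q n` with
roots `1, q, …, q ^ (n - 1)`, for `n = p ^ k` and `q = ψ (r / n)`. It is monic, but its values at
`ψ (r / n * y)`, for `y` in `ℤ_[p]`, tend to zero as `k` grows (`norm_gaussPoly_eval_le`), so that
modulations of Schwartz functions satisfy linear relations up to an arbitrarily small error. The
norms of its coefficients are known exactly (`norm_gaussPoly_coeff`), and this makes it possible to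
improve the bound on the coefficients step by step (`sub_one_mem_approxTrig`).

*The norms.* Intertwining operators exist for every symplectic matrix (`exists_isIntertwining`):
they are explicit for the Siegel parabolic, the Fourier transform is one for `J`, and these
elements generate the group. Schur's lemma for the Schrödinger representation
(`exists_eq_smul_of_commute`) shows that intertwining operators are unique up to scalars, and those
of the Siegel parabolic are multiples of isometries for the sup norm (`exists_supNorm_eq`). Hence
the normalized pullback of the sup norm depends only on the coset. Its completion is a space of
bounded continuous functions, the uniform limits of Schwartz functions
(`IsIntertwining.exists_realization`).

*Strong irreducibility.* Given a non-zero function in the completion, multiplying it with a suitable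
trigonometric polynomial, that is, taking a combination of its modulations, yields an approximate
characteristic function of a small polydisc. Translates of the latter, multiplied again with
trigonometric polynomials, approximate every Schwartz function up to half of its norm, with
coefficients bounded by a multiple of the norm (`exists_approx_of_ne_zero`). Iterating the
approximation on the error gives the convergent expansions (`isStronglyCyclic_of_approx`).

*Smooth vectors.* A function that is invariant under small translations is locally constant, and
one that is invariant under small modulations is compactly supported
(`mem_SchwartzFun_of_stabilizer`).

*Homomorphisms.* Equivariant maps preserve smooth vectors, so by Schur's lemma they are scalars on
the Schwartz functions. For different points of the Grassmannian, a non-zero scalar would make an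
intertwining operator of a matrix outside the Siegel parabolic bounded for the sup norm. Such an
operator turns some modulations into non-trivial translations; applied to the combination of
modulations given by `gaussPoly`, which is small, it produces a combination of disjoint translates
with leading coefficient `1`, which is not (`IsIntertwining.exists_lt_supNorm`).
-/


/-! ### Smooth characters of `ℚ_[p]` -/

section Characters

variable {p : ℕ} [hp : Fact p.Prime]

theorem PadicComplex.norm_natCast_prime : ‖(p : ℂ_[p])‖ = (p : ℝ)⁻¹ := by
  have h := PadicComplex.norm_extends' p (p : ℚ_[p])
  rw [Padic.norm_p] at h
  rw [← h]
  congr 1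
  rw [map_natCast]
  exact (PadicComplex.coe_natCast p p).symm

theorem PadicComplex.norm_sub_le_max (a b : ℂ_[p]) : ‖a - b‖ ≤ max ‖a‖ ‖b‖ := by
  rw [sub_eq_add_neg, ← norm_neg b]
  exact IsUltrametricDist.norm_add_le_max _ _

/-- The binomial expansion of `(1 + t) ^ p`, separating the two terms that can dominate. -/
theorem PadicComplex.exists_one_add_pow_prime (t : ℂ_[p]) (ht : ‖t‖ ≤ 1) :
    ∃ s : ℂ_[p], (1 + t) ^ p = 1 + t ^ p + p * t * s ∧ ‖s‖ ≤ 1 ∧ ‖s - 1‖ ≤ ‖t‖ := by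
  have hp1 : 1 ≤ p := hp.out.one_lt.le
  refine ⟨∑ k ∈ Finset.Ioo 0 p, t ^ (p - k - 1) * ((p.choose k / p : ℕ) : ℂ_[p]), ?_, ?_, ?_⟩
  · rw [add_pow_prime_eq hp.out]
    simp
  · refine IsUltrametricDist.norm_sum_le_of_forall_le_of_nonneg zero_le_one fun k _ => ?_
    rw [norm_mul, norm_pow]
    exact mul_le_one₀ (pow_le_one₀ (norm_nonneg _) ht) (norm_nonneg _)
      (IsUltrametricDist.norm_natCast_le_one _ _)
  · have hmem : p - 1 ∈ Finset.Ioo 0 p := by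
      have := hp.out.two_le
      rw [Finset.mem_Ioo]; omega
    rw [Finset.sum_eq_add_sum_sdiff_singleton_of_mem hmem]
    have h1 : p.choose (p - 1) / p = 1 := by
      have h := Nat.choose_symm (n := p) (k := 1) hp1
      rw [h, Nat.choose_one_right]
      exact Nat.div_self hp.out.pos
    rw [h1]
    have h2 : p - (p - 1) - 1 = 0 := by omega
    rw [h2, pow_zero, Nat.cast_one, one_mul, add_sub_cancel_left]
    refine IsUltrametricDist.norm_sum_le_of_forall_le_of_nonneg (norm_nonneg _) fun k hk => ?_
    simp only [Finset.mem_sdiff, Finset.mem_Ioo, Finset.mem_singleton] at hk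
    rw [norm_mul, norm_pow]
    have h3 : p - k - 1 ≠ 0 := by omega
    calc ‖t‖ ^ (p - k - 1) * ‖((p.choose k / p : ℕ) : ℂ_[p])‖
        ≤ ‖t‖ ^ (p - k - 1) * 1 := by
          gcongr
          exact IsUltrametricDist.norm_natCast_le_one _ _
      _ ≤ ‖t‖ := by
          rw [mul_one]
          exact pow_le_of_le_one (norm_nonneg _) ht h3

namespace IsSmoothChar

variable {ψ : AddChar ℚ_[p] ℂ_[p]}

theorem exists_norm_le_imp_eq_one (hψ : IsSmoothChar ψ) :
    ∃ δ : ℝ, 0 < δ ∧ ∀ r : ℚ_[p], ‖r‖ ≤ δ → ψ r = 1 := by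
  have h0 : (0 : ℚ_[p]) ∈ {x | ψ x = 1} := AddChar.map_zero_eq_one ψ
  obtain ⟨ε, hε, h⟩ := Metric.isOpen_iff.1 hψ 0 h0
  refine ⟨ε / 2, by positivity, fun r hr => h ?_⟩
  rw [mem_ball_zero_iff]
  linarith

theorem exists_prime_pow_mul_eq_one (hψ : IsSmoothChar ψ) (r : ℚ_[p]) :
    ∃ n : ℕ, ψ (p ^ n * r) = 1 := by
  obtain ⟨δ, hδ, h⟩ := hψ.exists_norm_le_imp_eq_one
  have hlim : Filter.Tendsto (fun n : ℕ => ‖(p : ℚ_[p]) ^ n * r‖) Filter.atTop (𝓝 0) := by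
    have := (tendsto_pow_atTop_nhds_zero_of_lt_one (norm_nonneg (p : ℚ_[p]))
      Padic.norm_p_lt_one).mul_const ‖r‖
    simpa using this
  obtain ⟨n, hn⟩ := (hlim.eventually (ge_mem_nhds hδ)).exists
  exact ⟨n, h _ hn⟩

theorem map_natCast_mul (n : ℕ) (r : ℚ_[p]) : ψ (n * r) = ψ r ^ n := by
  rw [← nsmul_eq_mul, AddChar.map_nsmul_eq_pow]

theorem norm_eq_one (hψ : IsSmoothChar ψ) (r : ℚ_[p]) : ‖ψ r‖ = 1 := by
  obtain ⟨n, hn⟩ := hψ.exists_prime_pow_mul_eq_one r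
  have h : ψ r ^ (p ^ n) = 1 := by
    rw [← map_natCast_mul]
    push_cast
    exact hn
  refine (pow_eq_one_iff_of_nonneg (norm_nonneg _) (pow_ne_zero n hp.out.ne_zero)).1 ?_
  rw [← norm_pow, h, norm_one]

theorem map_ne_zero (hψ : IsSmoothChar ψ) (r : ℚ_[p]) : ψ r ≠ 0 :=
  norm_ne_zero_iff.1 (by rw [hψ.norm_eq_one]; exact one_ne_zero)

theorem norm_sub_one_le_one (hψ : IsSmoothChar ψ) (r : ℚ_[p]) : ‖ψ r - 1‖ ≤ 1 := by
  refine (PadicComplex.norm_sub_le_max _ _).trans ?_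
  rw [hψ.norm_eq_one, norm_one, max_self]

theorem norm_map_sub_map (hψ : IsSmoothChar ψ) (r s : ℚ_[p]) :
    ‖ψ r - ψ s‖ = ‖ψ (r - s) - 1‖ := by
  have h : ψ r - ψ s = ψ s * (ψ (r - s) - 1) := by
    rw [mul_sub, ← AddChar.map_add_eq_mul, add_sub_cancel, mul_one]
  rw [h, norm_mul, hψ.norm_eq_one, one_mul]

theorem exists_map_prime_mul_sub_one (hψ : IsSmoothChar ψ) (r : ℚ_[p]) :
    ∃ s : ℂ_[p], ψ (p * r) - 1 = (ψ r - 1) ^ p + p * (ψ r - 1) * s ∧ ‖s‖ ≤ 1 ∧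
      ‖s - 1‖ ≤ ‖ψ r - 1‖ := by
  obtain ⟨s, h1, h2, h3⟩ := PadicComplex.exists_one_add_pow_prime _ (hψ.norm_sub_one_le_one r)
  refine ⟨s, ?_, h2, h3⟩
  rw [add_sub_cancel] at h1
  rw [map_natCast_mul, h1]
  ring

theorem norm_sub_one_lt_one (hψ : IsSmoothChar ψ) (r : ℚ_[p]) : ‖ψ r - 1‖ < 1 := by
  obtain ⟨n, hn⟩ := hψ.exists_prime_pow_mul_eq_one r
  induction n generalizing r with
  | zero =>
    rw [pow_zero, one_mul] at hn
    rw [hn, sub_self, norm_zero]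
    exact one_pos
  | succ n ih =>
    have h := ih (p * r) (by rw [← hn]; ring_nf)
    obtain ⟨s, h1, h2, -⟩ := hψ.exists_map_prime_mul_sub_one r
    have h3 : (ψ r - 1) ^ p = (ψ (p * r) - 1) - p * (ψ r - 1) * s := by rw [h1]; ring
    have hp1 : (p : ℝ)⁻¹ < 1 := inv_lt_one_of_one_lt₀ (by exact_mod_cast hp.out.one_lt)
    have h4 : ‖ψ r - 1‖ ^ p < 1 := by
      rw [← norm_pow, h3]
      refine (PadicComplex.norm_sub_le_max _ _).trans_lt (max_lt h ?_)
      rw [norm_mul, norm_mul, PadicComplex.norm_natCast_prime]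
      have := hψ.norm_sub_one_le_one r
      calc (p : ℝ)⁻¹ * ‖ψ r - 1‖ * ‖s‖ ≤ (p : ℝ)⁻¹ * 1 * 1 := by gcongr
        _ < 1 := by simpa using hp1
    exact lt_of_pow_lt_pow_left₀ p zero_le_one (by rwa [one_pow])

/-- The distance of `ψ r` to `1` is either zero or at least that of a primitive `p`-th root of
unity. -/
theorem inv_prime_le_norm_sub_one_pow (hψ : IsSmoothChar ψ) {r : ℚ_[p]} (hr : ψ r ≠ 1) :
    (p : ℝ)⁻¹ ≤ ‖ψ r - 1‖ ^ (p - 1) := by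
  obtain ⟨n, hn⟩ := hψ.exists_prime_pow_mul_eq_one r
  induction n generalizing r with
  | zero =>
    rw [pow_zero, one_mul] at hn
    exact absurd hn hr
  | succ n ih =>
    have ht0 : ψ r - 1 ≠ 0 := sub_ne_zero.2 hr
    have ht := norm_pos_iff.2 ht0
    obtain ⟨s, h1, h2, h3⟩ := hψ.exists_map_prime_mul_sub_one r
    have hpp : p = (p - 1) + 1 := (Nat.sub_add_cancel hp.out.one_lt.le).symm
    by_cases hpr : ψ (p * r) = 1
    · rw [hpr, sub_self] at h1
      have hs : ‖s‖ = 1 := by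
        have h4 : ‖s - 1‖ < ‖(1 : ℂ_[p])‖ := by
          rw [norm_one]
          exact h3.trans_lt (hψ.norm_sub_one_lt_one r)
        have h5 := IsUltrametricDist.norm_add_eq_max_of_norm_ne_norm h4.ne
        rw [sub_add_cancel, max_eq_right h4.le, norm_one] at h5
        exact h5
      have h6 : (ψ r - 1) ^ (p - 1) = -(p * s) := by
        apply mul_right_cancel₀ ht0
        rw [← pow_succ, ← hpp]
        linear_combination -h1
      rw [← norm_pow, h6, norm_neg, norm_mul, hs, mul_one, PadicComplex.norm_natCast_prime]
    · have h4 := ih hpr (by rw [← hn]; ring_nf)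
      refine h4.trans ?_
      gcongr
      rw [h1]
      have hle := hψ.norm_sub_one_le_one r
      refine (IsUltrametricDist.norm_add_le_max _ _).trans (max_le ?_ ?_)
      · rw [norm_pow]
        exact pow_le_of_le_one (norm_nonneg _) hle hp.out.ne_zero
      · rw [norm_mul, norm_mul]
        calc ‖(p : ℂ_[p])‖ * ‖ψ r - 1‖ * ‖s‖ ≤ 1 * ‖ψ r - 1‖ * 1 := by
              gcongr
              exact IsUltrametricDist.norm_natCast_le_one _ _
          _ = ‖ψ r - 1‖ := by ring

/-- In the binomial expansion of `ψ (p * r) - 1 = (1 + (ψ r - 1)) ^ p - 1`, the term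
`(ψ r - 1) ^ p` dominates unless `ψ r` is a `p`-th root of unity. -/
theorem norm_sub_one_pow (hψ : IsSmoothChar ψ) {r : ℚ_[p]} (hr : ψ (p * r) ≠ 1) :
    ‖ψ r - 1‖ ^ p = ‖ψ (p * r) - 1‖ := by
  have hr' : ψ r ≠ 1 := by
    intro h
    apply hr
    rw [map_natCast_mul, h, one_pow]
  have ht := norm_pos_iff.2 (sub_ne_zero.2 hr')
  obtain ⟨s, h1, h2, -⟩ := hψ.exists_map_prime_mul_sub_one r
  have hpp : p = (p - 1) + 1 := (Nat.sub_add_cancel hp.out.one_lt.le).symm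
  have hA : ‖p * (ψ r - 1) * s‖ ≤ (p : ℝ)⁻¹ * ‖ψ r - 1‖ := by
    rw [norm_mul, norm_mul, PadicComplex.norm_natCast_prime]
    exact mul_le_of_le_one_right (by positivity) h2
  have hB : ‖p * (ψ r - 1) * s‖ < ‖(ψ r - 1) ^ p‖ := by
    by_contra! hcon
    have hp2 : p - 1 ≠ 0 := by have := hp.out.two_le; omega
    have hp1 : (p : ℝ)⁻¹ < 1 := inv_lt_one_of_one_lt₀ (by exact_mod_cast hp.out.one_lt)
    have h5 : ‖ψ (p * r) - 1‖ < ‖ψ r - 1‖ := by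
      rw [h1]
      refine (IsUltrametricDist.norm_add_le_max _ _).trans_lt (max_lt ?_ ?_)
      · exact (hcon.trans hA).trans_lt (mul_lt_of_lt_one_left ht hp1)
      · exact hA.trans_lt (mul_lt_of_lt_one_left ht hp1)
    have h6 := hψ.inv_prime_le_norm_sub_one_pow hr
    have h7 := pow_lt_pow_left₀ h5 (norm_nonneg _) hp2
    have h8 : ‖(ψ r - 1) ^ p‖ = ‖ψ r - 1‖ ^ (p - 1) * ‖ψ r - 1‖ := by
      rw [norm_pow, ← pow_succ, ← hpp]
    rw [h8] at hcon
    have h9 := le_of_mul_le_mul_right (hcon.trans hA) ht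
    linarith
  rw [h1, IsUltrametricDist.norm_add_eq_max_of_norm_ne_norm hB.ne', max_eq_left hB.le, norm_pow]

theorem norm_sub_one_mul_le (hψ : IsSmoothChar ψ) (r : ℚ_[p]) {y : ℚ_[p]} (hy : ‖y‖ ≤ 1) :
    ‖ψ (r * y) - 1‖ ≤ ‖ψ r - 1‖ := by
  have hn : ∀ n : ℕ, ‖ψ (r * n) - 1‖ ≤ ‖ψ r - 1‖ := by
    intro n
    rw [mul_comm, map_natCast_mul, ← mul_geom_sum, norm_mul]
    refine mul_le_of_le_one_right (norm_nonneg _) ?_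
    refine IsUltrametricDist.norm_sum_le_of_forall_le_of_nonneg zero_le_one fun i _ => ?_
    rw [norm_pow, hψ.norm_eq_one, one_pow]
  have hc : Continuous fun z : ℤ_[p] => ‖ψ (r * z) - 1‖ := by
    have := hψ.isLocallyConstant.continuous
    fun_prop
  have h : ∀ z : ℤ_[p], ‖ψ (r * z) - 1‖ ≤ ‖ψ r - 1‖ := by
    refine isClosed_property (PadicInt.denseRange_natCast (p := p))
      (isClosed_le hc continuous_const) fun n => ?_
    have := hn n
    rwa [PadicInt.coe_natCast]
  exact h ⟨y, hy⟩

/-- The distance of `ψ r` to `1` is a monotone function of `‖r‖`. -/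
theorem norm_sub_one_le_of_norm_le (hψ : IsSmoothChar ψ) {r s : ℚ_[p]} (h : ‖r‖ ≤ ‖s‖) :
    ‖ψ r - 1‖ ≤ ‖ψ s - 1‖ := by
  rcases eq_or_ne s 0 with rfl | hs
  · rw [norm_zero] at h
    rw [norm_le_zero_iff.1 h]
  · have h1 := hψ.norm_sub_one_mul_le s (y := r / s) (by
      rw [norm_div]
      exact div_le_one_of_le₀ h (norm_nonneg _))
    rwa [mul_div_cancel₀ _ hs] at h1

theorem map_eq_one_of_norm_le (hψ : IsSmoothChar ψ) {r s : ℚ_[p]} (h : ‖r‖ ≤ ‖s‖)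
    (hs : ψ s = 1) : ψ r = 1 := by
  have := hψ.norm_sub_one_le_of_norm_le h
  rw [hs, sub_self, norm_zero, norm_le_zero_iff, sub_eq_zero] at this
  exact this

/-- The conductor of a non-trivial smooth character: some `r` with `ψ r ≠ 1` and `ψ (p * r) = 1`. -/
theorem exists_conductor (hψ : IsSmoothChar ψ) (h1 : ψ ≠ 1) :
    ∃ r : ℚ_[p], r ≠ 0 ∧ ψ r ≠ 1 ∧ ψ (p * r) = 1 := by
  obtain ⟨r, hr⟩ := DFunLike.ne_iff.1 h1
  rw [AddChar.one_apply] at hr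
  classical
  have hex := hψ.exists_prime_pow_mul_eq_one r
  have hn := Nat.find_spec hex
  have hn0 : Nat.find hex ≠ 0 := by
    intro h0
    rw [h0, pow_zero, one_mul] at hn
    exact hr hn
  obtain ⟨m, hm⟩ := Nat.exists_eq_succ_of_ne_zero hn0
  have hmin := Nat.find_min hex (m := m) (by omega)
  refine ⟨p ^ m * r, ?_, hmin, ?_⟩
  · rintro h
    rw [h, AddChar.map_zero_eq_one] at hmin
    exact hmin rfl
  · rw [hm, pow_succ] at hn
    rw [← hn]
    ring_nf

/-- Dividing the argument by powers of `p` moves the values of the character away from `1`, up to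
the limit distance `1`. -/
theorem exists_lt_norm_sub_one (hψ : IsSmoothChar ψ) {r : ℚ_[p]} (hr : ψ r ≠ 1) {c : ℝ}
    (hc : c < 1) : ∃ n : ℕ, c < ‖ψ (r / p ^ n) - 1‖ := by
  have hp0 : (p : ℚ_[p]) ≠ 0 := by exact_mod_cast hp.out.ne_zero
  have hne : ∀ n : ℕ, ψ (r / p ^ n) ≠ 1 := by
    intro n h
    apply hr
    have : r = (p ^ n : ℕ) * (r / p ^ n) := by
      push_cast
      field_simp
    rw [this, map_natCast_mul, h, one_pow]
  have hpow : ∀ n : ℕ, ‖ψ (r / p ^ n) - 1‖ ^ (p ^ n) = ‖ψ r - 1‖ := by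
    intro n
    induction n with
    | zero => simp
    | succ n ih =>
      have h : (p : ℚ_[p]) * (r / p ^ (n + 1)) = r / p ^ n := by
        field_simp
        ring
      rw [pow_succ' p n, pow_mul, hψ.norm_sub_one_pow (by rw [h]; exact hne n), h, ih]
  by_contra! hcon
  have hpos := norm_pos_iff.2 (sub_ne_zero.2 hr)
  have hc0 : 0 ≤ c := (norm_nonneg _).trans (hcon 0)
  have hlim := tendsto_pow_atTop_nhds_zero_of_lt_one hc0 hc
  have hlim' := hlim.comp (tendsto_pow_atTop_atTop_of_one_lt hp.out.one_lt)
  obtain ⟨n, hn⟩ := (hlim'.eventually (gt_mem_nhds hpos)).exists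
  have h1 := pow_le_pow_left₀ (norm_nonneg _) (hcon n) (p ^ n)
  rw [hpow] at h1
  exact absurd hn (not_lt.2 h1)

theorem ne_one_div (hψ : IsSmoothChar ψ) {r : ℚ_[p]} (hr : ψ r ≠ 1) (n : ℕ) :
    ψ (r / p ^ n) ≠ 1 := by
  intro h
  refine hr (hψ.map_eq_one_of_norm_le ?_ h)
  have h0 : 0 < ‖(p : ℚ_[p]) ^ n‖ := by
    rw [norm_pos_iff]
    exact pow_ne_zero _ (by exact_mod_cast hp.out.ne_zero)
  rw [norm_div, le_div_iff₀ h0]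
  refine mul_le_of_le_one_right (norm_nonneg _) ?_
  rw [norm_pow]
  exact pow_le_one₀ (norm_nonneg _) Padic.norm_p_lt_one.le

end IsSmoothChar

end Characters

/-! ### Bounded trigonometric polynomials and uniform approximation -/

section Trig

variable {p : ℕ} [hp : Fact p.Prime] {d : ℕ} {ψ : AddChar ℚ_[p] ℂ_[p]}

/-- The trigonometric polynomials `x ↦ ∑ c i * ψ (b i ⬝ x)` on `ℚ_[p]^d` whose coefficients have
norm at most `K`. -/
noncomputable def trigPoly (d : ℕ) (ψ : AddChar ℚ_[p] ℂ_[p]) (K : ℝ) :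
    AddSubgroup ((Fin d → ℚ_[p]) → ℂ_[p]) :=
  AddSubgroup.closure {f | ∃ (c : ℂ_[p]) (b : Fin d → ℚ_[p]), ‖c‖ ≤ K ∧
    f = fun x => c * ψ (b ⬝ᵥ x)}

theorem mem_trigPoly {K : ℝ} {c : ℂ_[p]} (hc : ‖c‖ ≤ K) (b : Fin d → ℚ_[p]) :
    (fun x => c * ψ (b ⬝ᵥ x)) ∈ trigPoly d ψ K :=
  AddSubgroup.subset_closure ⟨c, b, hc, rfl⟩

theorem trigPoly_mono {K L : ℝ} (h : K ≤ L) : trigPoly d ψ K ≤ trigPoly d ψ L :=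
  AddSubgroup.closure_mono fun _ ⟨c, b, hc, hf⟩ => ⟨c, b, hc.trans h, hf⟩

theorem const_mem_trigPoly {K : ℝ} {c : ℂ_[p]} (hc : ‖c‖ ≤ K) :
    (fun _ => c) ∈ trigPoly d ψ K := by
  have h := mem_trigPoly (ψ := ψ) (d := d) hc 0
  simpa using h

theorem smul_mem_trigPoly {K : ℝ} (c : ℂ_[p]) {f : (Fin d → ℚ_[p]) → ℂ_[p]}
    (hf : f ∈ trigPoly d ψ K) : c • f ∈ trigPoly d ψ (‖c‖ * K) := by
  induction hf using AddSubgroup.closure_induction with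
  | mem f hf =>
    obtain ⟨c', b, hc', rfl⟩ := hf
    have h : c • (fun x => c' * ψ (b ⬝ᵥ x)) = fun x => (c * c') * ψ (b ⬝ᵥ x) := by
      ext x
      simp [mul_assoc]
    rw [h]
    refine mem_trigPoly ?_ b
    rw [norm_mul]
    gcongr
  | zero => rw [smul_zero]; exact zero_mem _
  | add f g _ _ hf hg => rw [smul_add]; exact add_mem hf hg
  | neg f _ hf => rw [smul_neg]; exact neg_mem hf

theorem mul_mem_trigPoly {K L : ℝ} {f g : (Fin d → ℚ_[p]) → ℂ_[p]}
    (hf : f ∈ trigPoly d ψ K) (hg : g ∈ trigPoly d ψ L) : f * g ∈ trigPoly d ψ (K * L) := by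
  induction hf using AddSubgroup.closure_induction with
  | mem f hf =>
    obtain ⟨c, b, hc, rfl⟩ := hf
    induction hg using AddSubgroup.closure_induction with
    | mem g hg =>
      obtain ⟨c', b', hc', rfl⟩ := hg
      have h : ((fun x => c * ψ (b ⬝ᵥ x)) * fun x => c' * ψ (b' ⬝ᵥ x))
          = fun x => (c * c') * ψ ((b + b') ⬝ᵥ x) := by
        ext x
        simp only [Pi.mul_apply, add_dotProduct, AddChar.map_add_eq_mul]
        ring
      rw [h]
      refine mem_trigPoly ?_ _
      rw [norm_mul]
      have := (norm_nonneg c).trans hc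
      gcongr
    | zero => rw [mul_zero]; exact zero_mem _
    | add f g _ _ hf hg => rw [mul_add]; exact add_mem hf hg
    | neg f _ hf => rw [mul_neg]; exact neg_mem hf
  | zero => rw [zero_mul]; exact zero_mem _
  | add f g _ _ hf hg => rw [add_mul]; exact add_mem hf hg
  | neg f _ hf => rw [neg_mul]; exact neg_mem hf

theorem norm_le_of_mem_trigPoly (hψ : IsSmoothChar ψ) {K : ℝ} (hK : 0 ≤ K)
    {f : (Fin d → ℚ_[p]) → ℂ_[p]} (hf : f ∈ trigPoly d ψ K) (x : Fin d → ℚ_[p]) :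
    ‖f x‖ ≤ K := by
  induction hf using AddSubgroup.closure_induction with
  | mem f hf =>
    obtain ⟨c, b, hc, rfl⟩ := hf
    simpa [hψ.norm_eq_one] using hc
  | zero => simpa using hK
  | add f g _ _ hf hg => exact (IsUltrametricDist.norm_add_le_max _ _).trans (max_le hf hg)
  | neg f _ hf => simpa using hf

/-- The functions that can be approximated uniformly on `D` by trigonometric polynomials with
coefficients bounded by `K`. -/
noncomputable def approxTrig (ψ : AddChar ℚ_[p] ℂ_[p]) (D : Set (Fin d → ℚ_[p])) (K : ℝ) :
    AddSubgroup ((Fin d → ℚ_[p]) → ℂ_[p]) where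
  carrier := {f | ∀ ε : ℝ, 0 < ε → ∃ g ∈ trigPoly d ψ K, ∀ x ∈ D, ‖f x - g x‖ ≤ ε}
  zero_mem' ε hε := ⟨0, zero_mem _, fun x _ => by simpa using hε.le⟩
  add_mem' := by
    intro f f' hf hf' ε hε
    obtain ⟨g, hg, h⟩ := hf ε hε
    obtain ⟨g', hg', h'⟩ := hf' ε hε
    refine ⟨g + g', add_mem hg hg', fun x hx => ?_⟩
    have : (f + f') x - (g + g') x = (f x - g x) + (f' x - g' x) := by
      simp only [Pi.add_apply]; ring
    rw [this]
    exact (IsUltrametricDist.norm_add_le_max _ _).trans (max_le (h x hx) (h' x hx))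
  neg_mem' := by
    intro f hf ε hε
    obtain ⟨g, hg, h⟩ := hf ε hε
    refine ⟨-g, neg_mem hg, fun x hx => ?_⟩
    have : (-f) x - (-g) x = -(f x - g x) := by
      simp only [Pi.neg_apply]; ring
    rw [this, norm_neg]
    exact h x hx

variable {D : Set (Fin d → ℚ_[p])}

theorem approxTrig_mono {K L : ℝ} (h : K ≤ L) : approxTrig ψ D K ≤ approxTrig ψ D L :=
  fun _ hf ε hε =>
    let ⟨g, hg, hfg⟩ := hf ε hε
    ⟨g, trigPoly_mono h hg, hfg⟩

theorem trigPoly_le_approxTrig {K : ℝ} : trigPoly d ψ K ≤ approxTrig ψ D K :=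
  fun f hf ε hε => ⟨f, hf, fun x _ => by rw [sub_self, norm_zero]; exact hε.le⟩

theorem mem_approxTrig_of_close {K : ℝ} {f : (Fin d → ℚ_[p]) → ℂ_[p]}
    (h : ∀ ε : ℝ, 0 < ε → ∃ g ∈ approxTrig ψ D K, ∀ x ∈ D, ‖f x - g x‖ ≤ ε) :
    f ∈ approxTrig ψ D K := by
  intro ε hε
  obtain ⟨g, hg, hfg⟩ := h ε hε
  obtain ⟨g', hg', hgg'⟩ := hg ε hε
  refine ⟨g', hg', fun x hx => ?_⟩
  rw [← sub_add_sub_cancel _ (g x)]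
  exact (IsUltrametricDist.norm_add_le_max _ _).trans (max_le (hfg x hx) (hgg' x hx))

theorem approxTrig_congr {K : ℝ} {f g : (Fin d → ℚ_[p]) → ℂ_[p]} (hg : g ∈ approxTrig ψ D K)
    (h : ∀ x ∈ D, f x = g x) : f ∈ approxTrig ψ D K :=
  mem_approxTrig_of_close fun ε hε =>
    ⟨g, hg, fun x hx => by rw [h x hx, sub_self, norm_zero]; exact hε.le⟩

theorem norm_le_of_mem_approxTrig (hψ : IsSmoothChar ψ) {K : ℝ} (hK : 0 ≤ K)
    {f : (Fin d → ℚ_[p]) → ℂ_[p]} (hf : f ∈ approxTrig ψ D K) {x : Fin d → ℚ_[p]} (hx : x ∈ D) :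
    ‖f x‖ ≤ K := by
  refine le_of_forall_pos_le_add fun ε hε => ?_
  obtain ⟨g, hg, h⟩ := hf ε hε
  rw [← sub_add_cancel (f x) (g x)]
  refine (norm_add_le _ _).trans ?_
  have := h x hx
  have := norm_le_of_mem_trigPoly hψ hK hg x
  linarith

theorem smul_mem_approxTrig {K : ℝ} (c : ℂ_[p]) {f : (Fin d → ℚ_[p]) → ℂ_[p]}
    (hf : f ∈ approxTrig ψ D K) : c • f ∈ approxTrig ψ D (‖c‖ * K) := by
  intro ε hε
  obtain ⟨g, hg, h⟩ := hf (ε / (‖c‖ + 1)) (by positivity)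
  refine ⟨c • g, smul_mem_trigPoly c hg, fun x hx => ?_⟩
  rw [Pi.smul_apply, Pi.smul_apply, ← smul_sub, norm_smul]
  calc ‖c‖ * ‖f x - g x‖ ≤ (‖c‖ + 1) * (ε / (‖c‖ + 1)) := by
        gcongr
        · linarith
        · exact h x hx
    _ = ε := by field_simp

theorem mul_mem_approxTrig (hψ : IsSmoothChar ψ) {K L : ℝ} (hK : 0 ≤ K) (hL : 0 ≤ L)
    {f g : (Fin d → ℚ_[p]) → ℂ_[p]}
    (hf : f ∈ approxTrig ψ D K) (hg : g ∈ approxTrig ψ D L) :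
    f * g ∈ approxTrig ψ D (K * L) := by
  intro ε hε
  obtain ⟨f', hf', h⟩ := hf (ε / (L + 1)) (by positivity)
  obtain ⟨g', hg', h'⟩ := hg (ε / (K + 1)) (by positivity)
  refine ⟨f' * g', mul_mem_trigPoly hf' hg', fun x hx => ?_⟩
  have e : (f * g) x - (f' * g') x = (f x - f' x) * g x + f' x * (g x - g' x) := by
    simp only [Pi.mul_apply]; ring
  have h1 := h x hx
  have h2 := h' x hx
  have h3 := norm_le_of_mem_trigPoly hψ hK hf' x
  have h4 := norm_le_of_mem_approxTrig hψ hL hg hx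
  rw [e]
  refine (IsUltrametricDist.norm_add_le_max _ _).trans (max_le ?_ ?_)
  · rw [norm_mul]
    calc ‖f x - f' x‖ * ‖g x‖ ≤ ε / (L + 1) * (L + 1) := by
          gcongr
          linarith
      _ = ε := by field_simp
  · rw [norm_mul]
    calc ‖f' x‖ * ‖g x - g' x‖ ≤ (K + 1) * (ε / (K + 1)) := by
          gcongr
          linarith
      _ = ε := by field_simp

/-- The functions that, for every `K > 1`, can be approximated uniformly on `D` by trigonometric
polynomials with coefficients bounded by `K`. -/
noncomputable def approxRing (hψ : IsSmoothChar ψ) (D : Set (Fin d → ℚ_[p])) :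
    Subring ((Fin d → ℚ_[p]) → ℂ_[p]) where
  carrier := {f | ∀ K : ℝ, 1 < K → f ∈ approxTrig ψ D K}
  zero_mem' K _ := zero_mem _
  one_mem' K hK := trigPoly_le_approxTrig
    (const_mem_trigPoly (c := (1 : ℂ_[p])) (norm_one.le.trans hK.le))
  add_mem' hf hg K hK := add_mem (hf K hK) (hg K hK)
  neg_mem' hf K hK := neg_mem (hf K hK)
  mul_mem' {f g} hf hg K hK := by
    have h1 : 1 < Real.sqrt K := by
      rw [Real.lt_sqrt zero_le_one]
      simpa using hK
    have h0 : 0 ≤ Real.sqrt K := Real.sqrt_nonneg _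
    have := mul_mem_approxTrig hψ h0 h0 (hf _ h1) (hg _ h1)
    rwa [Real.mul_self_sqrt (by linarith)] at this

theorem approxRing_congr (hψ : IsSmoothChar ψ) {f g : (Fin d → ℚ_[p]) → ℂ_[p]}
    (hg : g ∈ approxRing hψ D) (h : ∀ x ∈ D, f x = g x) : f ∈ approxRing hψ D :=
  fun K hK => approxTrig_congr (hg K hK) h

/-- Approximability of indicator functions is transitive: an approximation of the second indicator
on `D'` stays bounded on `D`, so that it is damped outside `D'` by a good enough approximation of
the first one. -/
theorem indicator_mem_approxRing_trans (hψ : IsSmoothChar ψ) {D' D'' : Set (Fin d → ℚ_[p])}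
    (hD'' : D'' ⊆ D')
    (h1 : Set.indicator D' (fun _ => 1) ∈ approxRing hψ D)
    (h2 : Set.indicator D'' (fun _ => 1) ∈ approxRing hψ D') :
    Set.indicator D'' (fun _ => 1) ∈ approxRing hψ D := by
  intro K hK
  have hs1 : 1 < Real.sqrt K := by
    rw [Real.lt_sqrt zero_le_one]
    simpa using hK
  have hs0 : 0 ≤ Real.sqrt K := Real.sqrt_nonneg _
  intro ε hε
  obtain ⟨g, hg, hgD⟩ := h2 _ hs1 (ε / Real.sqrt K) (by positivity)
  obtain ⟨f, hf, hfD⟩ := h1 _ hs1 (ε / Real.sqrt K) (by positivity)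
  refine ⟨f * g, ?_, fun x hx => ?_⟩
  · have := mul_mem_trigPoly hf hg
    rwa [Real.mul_self_sqrt (by linarith)] at this
  · have hfx := hfD x hx
    have hgx := norm_le_of_mem_trigPoly hψ hs0 hg x
    have hfx' := norm_le_of_mem_trigPoly hψ hs0 hf x
    by_cases hx' : x ∈ D'
    · have h3 := hgD x hx'
      rw [Set.indicator_of_mem hx'] at hfx
      have e : Set.indicator D'' (fun _ => (1 : ℂ_[p])) x - (f * g) x
          = (1 - f x) * g x + (Set.indicator D'' (fun _ => (1 : ℂ_[p])) x - g x) := by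
        simp only [Pi.mul_apply]; ring
      rw [e]
      refine (IsUltrametricDist.norm_add_le_max _ _).trans (max_le ?_ ?_)
      · rw [norm_mul]
        calc _ ≤ ε / Real.sqrt K * Real.sqrt K := by gcongr
          _ = ε := by field_simp
      · refine h3.trans (div_le_self hε.le hs1.le)
    · rw [Set.indicator_of_notMem hx', zero_sub, norm_neg] at hfx
      rw [Set.indicator_of_notMem (fun h => hx' (hD'' h)), zero_sub, norm_neg, Pi.mul_apply,
        norm_mul]
      calc _ ≤ ε / Real.sqrt K * Real.sqrt K := by gcongr
        _ = ε := by field_simp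

end Trig

/-! ### The polynomial with roots `1, q, …, q ^ (n - 1)` -/

section GaussPoly

open Polynomial

variable {p : ℕ} [hp : Fact p.Prime] {ψ : AddChar ℚ_[p] ℂ_[p]}

theorem Finset.prod_range_mul_eq {M : Type*} [CommMonoid M] (f : ℕ → M) (n m : ℕ) :
    ∏ a ∈ Finset.range (n * m), f a
      = ∏ j ∈ Finset.range n, ∏ i ∈ Finset.range m, f (n * i + j) := by
  rw [Finset.prod_comm]
  induction m with
  | zero => simp
  | succ m ih => rw [Nat.mul_succ, Finset.prod_range_add, ih, Finset.prod_range_succ]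

/-- The monic polynomial with roots `1, q, …, q ^ (n - 1)`. -/
noncomputable def gaussPoly {R : Type*} [CommRing R] (q : R) (n : ℕ) : R[X] :=
  ∏ a ∈ Finset.range n, (X - C (q ^ a))

section Ring

variable {R : Type*} [CommRing R] (q : R) (n : ℕ)

theorem gaussPoly_monic : (gaussPoly q n).Monic := monic_prod_X_sub_C _ _

theorem gaussPoly_natDegree [Nontrivial R] : (gaussPoly q n).natDegree = n := by
  rw [gaussPoly, natDegree_prod_of_monic _ _ fun a _ => monic_X_sub_C _]
  simp only [natDegree_X_sub_C, Finset.sum_const, Finset.card_range, smul_eq_mul, mul_one]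

theorem gaussPoly_eval (z : R) :
    (gaussPoly q n).eval z = ∏ a ∈ Finset.range n, (z - q ^ a) := by
  simp [gaussPoly, eval_prod]

/-- The `q`-difference equation of the polynomial with roots `1, q, …, q ^ n`. -/
theorem gaussPoly_comp :
    (gaussPoly q (n + 1)).comp (C q * X) * (X - C (q ^ n))
      = C (q ^ n) * gaussPoly q (n + 1) * (C q * X - 1) := by
  have h1 : (gaussPoly q (n + 1)).comp (C q * X)
      = (C q * X - 1) * (C (q ^ n) * gaussPoly q n) := by
    rw [gaussPoly, Finset.prod_range_succ', mul_comp, prod_comp, gaussPoly, mul_comm]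
    congr 1
    · simp
    · have h : ∀ a ∈ Finset.range n, (X - C (q ^ (a + 1))).comp (C q * X)
          = C q * (X - C (q ^ a)) := by
        intro a _
        rw [sub_comp, X_comp, C_comp, pow_succ', C_mul]
        ring
      rw [Finset.prod_congr rfl h, Finset.prod_mul_distrib]
      simp
  rw [h1, gaussPoly, gaussPoly, Finset.prod_range_succ]
  ring

theorem gaussPoly_coeff_succ (i : ℕ) :
    (gaussPoly q (n + 1)).coeff i * (q ^ i - q ^ (n + 1))
      = (gaussPoly q (n + 1)).coeff (i + 1) * (q ^ n * (q ^ (i + 1) - 1)) := by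
  have h := congrArg (fun P => P.coeff (i + 1)) (gaussPoly_comp q n)
  simp only [mul_sub, coeff_sub, coeff_mul_X, mul_one, coeff_C_mul, coeff_mul_C,
    ← mul_assoc, comp_C_mul_X_coeff] at h
  linear_combination h

end Ring

namespace IsSmoothChar

theorem norm_natCast_prime_pow_sub {k i : ℕ} (h0 : 0 < i) (hi : i < p ^ k) :
    ‖((p ^ k - i : ℕ) : ℚ_[p])‖ = ‖(i : ℚ_[p])‖ := by
  have h1 : ‖(i : ℚ_[p])‖ > ‖(p : ℚ_[p]) ^ k‖ := by
    by_contra! hcon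
    rw [Padic.norm_p_pow] at hcon
    have := (Padic.norm_int_le_pow_iff_dvd (i : ℤ) k).1 (by exact_mod_cast hcon)
    have h2 : p ^ k ∣ i := by exact_mod_cast this
    exact absurd (Nat.le_of_dvd h0 h2) (not_le.2 hi)
  rw [Nat.cast_sub hi.le, sub_eq_add_neg]
  push_cast
  rw [IsUltrametricDist.norm_add_eq_max_of_norm_ne_norm (by rw [norm_neg]; exact h1.ne),
    norm_neg, max_eq_right h1.le]

/-- The norms of the inner coefficients, by descending induction from the leading coefficient along
the recursion `gaussPoly_coeff_succ`. -/
theorem norm_gaussPoly_coeff_aux (hψ : IsSmoothChar ψ) (r : ℚ_[p]) (k i : ℕ) (hi : i + 1 ≤ p ^ k) :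
    ‖(gaussPoly (ψ (r / p ^ k)) (p ^ k)).coeff (p ^ k - (i + 1))‖
      * ‖ψ ((i + 1 : ℕ) * (r / p ^ k)) - 1‖ = ‖ψ r - 1‖ := by
  have hp0 : (p : ℚ_[p]) ≠ 0 := by exact_mod_cast hp.out.ne_zero
  have hpk : p ^ k = (p ^ k - 1) + 1 := by omega
  set q := ψ (r / p ^ k) with hq
  have hq1 : ‖q‖ = 1 := hψ.norm_eq_one _
  have hq' : ∀ j : ℕ, ψ (j * (r / p ^ k)) = q ^ j := fun j => map_natCast_mul j _
  have hrec : ∀ j, j < p ^ k → ‖(gaussPoly q (p ^ k)).coeff j‖ * ‖q ^ (p ^ k - j) - 1‖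
      = ‖(gaussPoly q (p ^ k)).coeff (j + 1)‖ * ‖q ^ (j + 1) - 1‖ := by
    intro j hj
    have h := congrArg norm (gaussPoly_coeff_succ q (p ^ k - 1) j)
    rw [← hpk, norm_mul, norm_mul, norm_mul, norm_pow, hq1, one_pow, one_mul] at h
    rw [← h]
    congr 1
    have : q ^ j - q ^ (p ^ k) = -(q ^ j * (q ^ (p ^ k - j) - 1)) := by
      rw [mul_sub, ← pow_add, Nat.add_sub_cancel' hj.le]
      ring
    rw [this, norm_neg, norm_mul, norm_pow, hq1, one_pow, one_mul]
  have hqn : q ^ (p ^ k) = ψ r := by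
    rw [← hq']
    congr 1
    push_cast
    field_simp
  rw [hq']
  induction i with
  | zero =>
    have h := hrec (p ^ k - 1) (by omega)
    rw [← hpk, hqn] at h
    have h1 : (gaussPoly q (p ^ k)).coeff (p ^ k) = 1 := by
      have := (gaussPoly_monic q (p ^ k)).coeff_natDegree
      rwa [gaussPoly_natDegree] at this
    rw [h1, norm_one, one_mul, show p ^ k - (p ^ k - 1) = 1 by omega] at h
    exact h
  | succ i ih =>
    have h := hrec (p ^ k - (i + 1 + 1)) (by omega)
    rw [show p ^ k - (p ^ k - (i + 1 + 1)) = i + 1 + 1 by omega,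
      show p ^ k - (i + 1 + 1) + 1 = p ^ k - (i + 1) by omega] at h
    rw [h, ← ih (by omega)]
    congr 1
    rw [← hq', ← hq']
    have hn := norm_natCast_prime_pow_sub (p := p) (k := k) (i := i + 1) (by omega) (by omega)
    apply le_antisymm <;> apply hψ.norm_sub_one_le_of_norm_le <;> rw [norm_mul, norm_mul, hn]

/-- The coefficients of the polynomial with roots `1, q, …, q ^ (n - 1)`, where `n = p ^ k` and
`q = ψ (r / n)`, are `q`-binomial coefficients, and the norm of the inner ones is given by their
two extreme factors. -/
theorem norm_gaussPoly_coeff (hψ : IsSmoothChar ψ) (r : ℚ_[p]) {k i : ℕ} (h0 : 0 < i)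
    (hi : i < p ^ k) :
    ‖(gaussPoly (ψ (r / p ^ k)) (p ^ k)).coeff i‖ * ‖ψ (i * (r / p ^ k)) - 1‖
      = ‖ψ r - 1‖ := by
  have h := hψ.norm_gaussPoly_coeff_aux r k (p ^ k - i - 1) (by omega)
  rw [show p ^ k - i - 1 + 1 = p ^ k - i by omega, Nat.sub_sub_self hi.le] at h
  rw [← h]
  congr 1
  have hn := norm_natCast_prime_pow_sub (p := p) h0 hi
  apply le_antisymm <;> apply hψ.norm_sub_one_le_of_norm_le <;> rw [norm_mul, norm_mul, hn]

theorem norm_sub_one_pow_prime_pow (hψ : IsSmoothChar ψ) {r : ℚ_[p]} (hr : ψ r ≠ 1) (k : ℕ) :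
    ‖ψ (r / p ^ k) - 1‖ ^ (p ^ k) = ‖ψ r - 1‖ := by
  have hp0 : (p : ℚ_[p]) ≠ 0 := by exact_mod_cast hp.out.ne_zero
  induction k with
  | zero => simp
  | succ k ih =>
    have h : (p : ℚ_[p]) * (r / p ^ (k + 1)) = r / p ^ k := by
      field_simp
      ring
    rw [pow_succ' p k, pow_mul, hψ.norm_sub_one_pow (by rw [h]; exact hψ.ne_one_div hr k), h, ih]

theorem exists_natCast_lt_norm_sub_lt_one {y : ℚ_[p]} (hy : ‖y‖ ≤ 1) :
    ∃ n < p, ‖(y - n) / p‖ ≤ 1 := by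
  obtain ⟨y', rfl⟩ : ∃ y' : ℤ_[p], (y' : ℚ_[p]) = y := ⟨⟨y, hy⟩, rfl⟩
  obtain ⟨h1, h2⟩ := PadicInt.zmodRepr_spec y'
  rw [PadicInt.maximalIdeal_eq_span_p, Ideal.mem_span_singleton] at h2
  obtain ⟨z, hz⟩ := h2
  refine ⟨_, h1, ?_⟩
  have hp0 : (p : ℚ_[p]) ≠ 0 := by exact_mod_cast hp.out.ne_zero
  have h3 := congrArg (fun z : ℤ_[p] => (z : ℚ_[p])) hz
  simp only [PadicInt.coe_sub, PadicInt.coe_mul, PadicInt.coe_natCast] at h3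
  rw [h3, mul_div_cancel_left₀ _ hp0]
  exact z.2

/-- At the points `ψ (r / n * y)`, for `y` in `ℤ_[p]`, the polynomial with roots
`1, q, …, q ^ (n - 1)`, for `n = p ^ k` and `q = ψ (r / n)`, tends to zero as `k` grows, although it
is monic: each of the `k` base `p` digits contributes the same factor. -/
theorem norm_gaussPoly_eval_le (hψ : IsSmoothChar ψ) {r : ℚ_[p]} (hr : ψ r ≠ 1) (k : ℕ)
    {y : ℚ_[p]} (hy : ‖y‖ ≤ 1) :
    ‖(gaussPoly (ψ (r / p ^ k)) (p ^ k)).eval (ψ (r / p ^ k * y))‖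
      ≤ (‖ψ (r / p) - 1‖ ^ (p - 1)) ^ k := by
  have hp0 : (p : ℚ_[p]) ≠ 0 := by exact_mod_cast hp.out.ne_zero
  have key : ∀ (k : ℕ) (y : ℚ_[p]),
      ‖(gaussPoly (ψ (r / p ^ k)) (p ^ k)).eval (ψ (r / p ^ k * y))‖
        = ∏ a ∈ Finset.range (p ^ k), ‖ψ (r / p ^ k * (y - a)) - 1‖ := by
    intro k y
    rw [gaussPoly_eval, norm_prod]
    refine Finset.prod_congr rfl fun a _ => ?_
    rw [← map_natCast_mul, hψ.norm_map_sub_map]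
    congr 3
    ring
  rw [key]
  induction k generalizing y with
  | zero => simpa using hψ.norm_sub_one_le_one _
  | succ k ih =>
    obtain ⟨n, hn, hny⟩ := exists_natCast_lt_norm_sub_lt_one hy
    rw [pow_succ' p k, Finset.prod_range_mul_eq, ← Finset.mul_prod_erase _ _
      (Finset.mem_range.2 hn), pow_succ' (‖ψ (r / p) - 1‖ ^ (p - 1)) k, mul_comm]
    have h1 : ∏ i ∈ Finset.range (p ^ k),
        ‖ψ (r / p ^ (k + 1) * (y - ((p * i + n : ℕ) : ℚ_[p]))) - 1‖
        = ∏ i ∈ Finset.range (p ^ k), ‖ψ (r / p ^ k * ((y - n) / p - i)) - 1‖ := by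
      refine Finset.prod_congr rfl fun i _ => ?_
      congr 3
      push_cast
      field_simp
      ring
    rw [h1]
    have h2 : ∀ j ∈ (Finset.range p).erase n,
        ∏ i ∈ Finset.range (p ^ k), ‖ψ (r / p ^ (k + 1) * (y - ((p * i + j : ℕ) : ℚ_[p]))) - 1‖
          ≤ ‖ψ (r / p) - 1‖ := by
      intro j _
      have h3 : r / p ^ (k + 1) = r / p / p ^ k := by
        field_simp
        ring
      have h4 : ψ (r / p) ≠ 1 := by simpa using hψ.ne_one_div hr 1
      rw [← hψ.norm_sub_one_pow_prime_pow h4 k, ← h3]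
      calc _ ≤ ∏ i ∈ Finset.range (p ^ k), ‖ψ (r / p ^ (k + 1)) - 1‖ := by
            refine Finset.prod_le_prod (fun _ _ => norm_nonneg _) fun i _ => ?_
            refine hψ.norm_sub_one_mul_le _ ?_
            refine (sub_eq_add_neg y _ ▸ IsUltrametricDist.norm_add_le_max _ _).trans
              (max_le hy ?_)
            rw [norm_neg]
            exact IsUltrametricDist.norm_natCast_le_one _ _
        _ = _ := by rw [Finset.prod_const, Finset.card_range]
    have h5 : ∏ j ∈ (Finset.range p).erase n, ∏ i ∈ Finset.range (p ^ k),
        ‖ψ (r / p ^ (k + 1) * (y - ((p * i + j : ℕ) : ℚ_[p]))) - 1‖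
          ≤ ‖ψ (r / p) - 1‖ ^ (p - 1) := by
      calc _ ≤ ∏ j ∈ (Finset.range p).erase n, ‖ψ (r / p) - 1‖ :=
            Finset.prod_le_prod (fun _ _ => Finset.prod_nonneg fun _ _ => norm_nonneg _) h2
        _ = _ := by
            rw [Finset.prod_const, Finset.card_erase_of_mem (Finset.mem_range.2 hn),
              Finset.card_range]
    exact mul_le_mul h5 (ih hny) (Finset.prod_nonneg fun _ _ => norm_nonneg _) (by positivity)

theorem norm_sub_one_pow_pred_lt_one (hψ : IsSmoothChar ψ) (r : ℚ_[p]) :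
    ‖ψ r - 1‖ ^ (p - 1) < 1 :=
  pow_lt_one₀ (norm_nonneg _) (hψ.norm_sub_one_lt_one r) (by have := hp.out.two_le; omega)

end IsSmoothChar

end GaussPoly

/-! ### Approximation of locally constant functions by bounded trigonometric polynomials -/

section FresnelDeMathan

open Polynomial

variable {p : ℕ} [hp : Fact p.Prime] {d : ℕ} {ψ : AddChar ℚ_[p] ℂ_[p]}
  {D : Set (Fin d → ℚ_[p])} {y : (Fin d → ℚ_[p]) → ℚ_[p]}

/-- On the region `‖y‖ ≤ 1`, the function `ψ (r * y) - 1`, which is bounded by `‖ψ r - 1‖`, is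
approximated by trigonometric polynomials with coefficients bounded by
`‖ψ r - 1‖ / ‖ψ (r / p ^ s) - 1‖`. For the induction on `s`, `ψ (r * y)` is the leading term
of the polynomial with roots `1, q, …, q ^ (p ^ k - 1)`, evaluated at `ψ (r / p ^ k * y)`; as
this value tends to zero, the leading term can be replaced by the lower ones, which have small
coefficients. -/
theorem sub_one_mem_approxTrig (hψ : IsSmoothChar ψ)
    (hy : ∀ r, (fun x => ψ (r * y x)) ∈ trigPoly d ψ 1) (hD : ∀ x ∈ D, ‖y x‖ ≤ 1)
    (hne : D.Nonempty) (s : ℕ) (r : ℚ_[p]) :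
    (fun x => ψ (r * y x) - 1) ∈ approxTrig ψ D (‖ψ r - 1‖ / ‖ψ (r / p ^ s) - 1‖) := by
  have hp0 : (p : ℚ_[p]) ≠ 0 := by exact_mod_cast hp.out.ne_zero
  by_cases hr : ψ r = 1
  · refine approxTrig_congr (zero_mem _) fun x hx => ?_
    rw [hψ.map_eq_one_of_norm_le (s := r) ?_ hr, sub_self, Pi.zero_apply]
    rw [norm_mul]
    exact mul_le_of_le_one_right (norm_nonneg _) (hD x hx)
  induction s generalizing r with
  | zero =>
    have h0 := norm_pos_iff.2 (sub_ne_zero.2 hr)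
    rw [pow_zero, div_one, div_self h0.ne']
    exact trigPoly_le_approxTrig
      (sub_mem (hy r) (const_mem_trigPoly (c := (1 : ℂ_[p])) norm_one.le))
  | succ s ih =>
    set B := ‖ψ r - 1‖ / ‖ψ (r / p ^ (s + 1)) - 1‖ with hB
    have hr0 := norm_pos_iff.2 (sub_ne_zero.2 hr)
    have hr1 := norm_pos_iff.2 (sub_ne_zero.2 (hψ.ne_one_div hr (s + 1)))
    have hB0 : 0 < B := div_pos hr0 hr1
    have hrB : ‖ψ r - 1‖ ≤ B := by
      rw [hB, le_div_iff₀ hr1]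
      exact mul_le_of_le_one_right (norm_nonneg _) (hψ.norm_sub_one_le_one _)
    refine mem_approxTrig_of_close fun ε hε => ?_
    obtain ⟨k, hk⟩ := exists_pow_lt_of_lt_one (lt_min hε hB0)
      (hψ.norm_sub_one_pow_pred_lt_one (r / p))
    set n := p ^ k with hn
    have hn0 : 0 < n := pow_pos hp.out.pos k
    set q := ψ (r / p ^ k) with hq
    set H := gaussPoly q n with hH
    have hz : ∀ (i : ℕ) x, ψ (r / p ^ k * y x) ^ i = ψ (i * (r / p ^ k) * y x) := by
      intro i x
      rw [mul_assoc, IsSmoothChar.map_natCast_mul]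
    -- The inner terms of the polynomial, with the constants split off.
    set G : (Fin d → ℚ_[p]) → ℂ_[p] :=
      -∑ i ∈ Finset.Ioo 0 n, H.coeff i • fun x => ψ (i * (r / p ^ k) * y x) - 1 with hG
    have hGmem : G ∈ approxTrig ψ D B := by
      refine neg_mem (sum_mem fun i hi => ?_)
      rw [Finset.mem_Ioo] at hi
      have hi0 : (i : ℚ_[p]) ≠ 0 := by exact_mod_cast hi.1.ne'
      have hcoef := hψ.norm_gaussPoly_coeff r hi.1 hi.2
      rw [← hq, ← hn, ← hH] at hcoef
      have hne1 : ψ (i * (r / p ^ k)) ≠ 1 := by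
        intro h
        rw [h, sub_self, norm_zero, mul_zero] at hcoef
        exact hr0.ne hcoef
      refine approxTrig_mono ?_ (smul_mem_approxTrig (H.coeff i) (ih _ hne1))
      rw [← mul_div_assoc, hcoef, hB]
      refine div_le_div_of_nonneg_left hr0.le hr1 (hψ.norm_sub_one_le_of_norm_le ?_)
      -- Inner exponents are not divisible by `p ^ k`.
      have hi1 : ‖(p : ℚ_[p]) ^ k‖ ≤ ‖(i : ℚ_[p])‖ * ‖(p : ℚ_[p])‖ := by
        have h1 : ¬ ‖(i : ℚ_[p])‖ ≤ (p : ℝ) ^ (-k : ℤ) := by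
          intro h
          have h2 := (Padic.norm_int_le_pow_iff_dvd (i : ℤ) k).1 (by exact_mod_cast h)
          have h3 : p ^ k ∣ i := by exact_mod_cast h2
          exact absurd (Nat.le_of_dvd hi.1 h3) (not_le.2 hi.2)
        rw [Padic.norm_le_pow_iff_norm_lt_pow_add_one, not_lt] at h1
        have hpR : (p : ℝ) ≠ 0 := by exact_mod_cast hp.out.ne_zero
        rw [Padic.norm_p_pow, Padic.norm_p, ← div_eq_mul_inv, le_div_iff₀
          (by exact_mod_cast hp.out.pos)]
        rwa [zpow_add_one₀ hpR] at h1
      have hppos : 0 < ‖(p : ℚ_[p]) ^ (k + s)‖ := by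
        rw [norm_pos_iff]; exact pow_ne_zero _ hp0
      have e1 : r / (p : ℚ_[p]) ^ (s + 1) = r * (p ^ k / p) / p ^ (k + s) := by
        field_simp
        ring
      have e2 : i * (r / (p : ℚ_[p]) ^ k) / p ^ s = r * i / p ^ (k + s) := by
        field_simp
        ring
      rw [e1, e2, norm_div, norm_div, norm_mul, norm_mul]
      gcongr
      rw [norm_div, div_le_iff₀ (norm_pos_iff.2 hp0)]
      exact hi1
    set c : ℂ_[p] := -(∑ i ∈ Finset.range n, H.coeff i) - 1 with hc
    have hEq : ∀ x, ψ (r * y x) - 1 - (G x + c) = H.eval (ψ (r / p ^ k * y x)) := by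
      intro x
      have hHn : H.coeff n = 1 := by
        have := (gaussPoly_monic q n).coeff_natDegree
        rwa [gaussPoly_natDegree] at this
      have hr' : ψ (r * y x) = ψ (r / p ^ k * y x) ^ n := by
        rw [hz, hn]
        congr 1
        push_cast
        field_simp
      have hrange : Finset.range n = insert 0 (Finset.Ioo 0 n) := by
        ext i
        simp only [Finset.mem_range, Finset.mem_insert, Finset.mem_Ioo]
        omega
      have hGx : G x
          = -∑ i ∈ Finset.Ioo 0 n, (H.coeff i * ψ (r / p ^ k * y x) ^ i - H.coeff i) := by
        simp only [hG, Pi.neg_apply, Finset.sum_apply, Pi.smul_apply, smul_eq_mul, hz, mul_sub,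
          mul_one]
      rw [eval_eq_sum_range, gaussPoly_natDegree, Finset.sum_range_succ, hHn, hr', hGx, hc,
        hrange, Finset.sum_insert (by simp), Finset.sum_insert (by simp), Finset.sum_sub_distrib,
        pow_zero]
      ring
    have hEle : ∀ x ∈ D, ‖ψ (r * y x) - 1 - (G x + c)‖ ≤ min ε B := by
      intro x hx
      rw [hEq]
      exact (hψ.norm_gaussPoly_eval_le hr k (hD x hx)).trans hk.le
    -- The constant is bounded because all other functions are.
    have hcB : ‖c‖ ≤ B := by
      obtain ⟨x, hx⟩ := hne
      have e : c = (ψ (r * y x) - 1) - G x - (ψ (r * y x) - 1 - (G x + c)) := by ring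
      rw [e]
      refine (PadicComplex.norm_sub_le_max _ _).trans (max_le ?_ ?_)
      · refine (PadicComplex.norm_sub_le_max _ _).trans (max_le ?_ ?_)
        · exact (hψ.norm_sub_one_mul_le r (hD x hx)).trans hrB
        · exact norm_le_of_mem_approxTrig hψ hB0.le hGmem hx
      · exact (hEle x hx).trans (min_le_right _ _)
    refine ⟨G + fun _ => c, add_mem hGmem (trigPoly_le_approxTrig (const_mem_trigPoly hcB)),
      fun x hx => ?_⟩
    exact (hEle x hx).trans (min_le_left _ _)

/-- The coefficient bounds of `sub_one_mem_approxTrig` tend to `‖ψ r - 1‖` as `s` grows, so a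
multiple of `ψ (r * y) - 1` with norm at most `1` is approximated with essentially optimal
coefficients. -/
theorem smul_sub_one_mem_approxRing (hψ : IsSmoothChar ψ)
    (hy : ∀ r, (fun x => ψ (r * y x)) ∈ trigPoly d ψ 1) (hD : ∀ x ∈ D, ‖y x‖ ≤ 1)
    (hne : D.Nonempty) {r : ℚ_[p]} (hr : ψ r ≠ 1) {c : ℂ_[p]} (hc : ‖c‖ = ‖ψ r - 1‖) :
    (c⁻¹ • fun x => ψ (r * y x) - 1) ∈ approxRing hψ D := by
  intro K hK
  have hr0 := norm_pos_iff.2 (sub_ne_zero.2 hr)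
  obtain ⟨n, hn⟩ := hψ.exists_lt_norm_sub_one hr (inv_lt_one_of_one_lt₀ hK)
  refine approxTrig_mono ?_ (smul_mem_approxTrig c⁻¹ (sub_one_mem_approxTrig hψ hy hD hne n r))
  have hK0 : 0 < K := by linarith
  rw [norm_inv, hc, ← mul_div_assoc, inv_mul_cancel₀ hr0.ne', one_div]
  exact inv_le_of_inv_le₀ hK0 hn.le

/-- The indicator function of `‖y‖ < 1` is a polynomial in `ψ (r * y)`, where `r` is the conductor
of the character. -/
theorem indicator_mem_approxRing_aux (hψ : IsSmoothChar ψ) (hψ1 : ψ ≠ 1)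
    (hy : ∀ r, (fun x => ψ (r * y x)) ∈ trigPoly d ψ 1) (hD : ∀ x ∈ D, ‖y x‖ ≤ 1)
    (hne : D.Nonempty) :
    Set.indicator {x ∈ D | ‖y x / p‖ ≤ 1} (fun _ => (1 : ℂ_[p])) ∈ approxRing hψ D := by
  have hp0 : (p : ℚ_[p]) ≠ 0 := by exact_mod_cast hp.out.ne_zero
  obtain ⟨r, hr0, hr1, hpr⟩ := hψ.exists_conductor hψ1
  -- Multiples of `r` by units of `ℤ_[p]` are at the same distance from `1` as `r`.
  have hunit : ∀ z : ℚ_[p], ‖z‖ = 1 → ‖ψ (r * z) - 1‖ = ‖ψ r - 1‖ := by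
    intro z hz
    apply le_antisymm <;> apply hψ.norm_sub_one_le_of_norm_le <;> rw [norm_mul, hz, mul_one]
  have hnat : ∀ n ∈ Finset.Ioo 0 p, ‖(n : ℚ_[p])‖ = 1 := by
    intro n hn
    rw [Finset.mem_Ioo] at hn
    rw [Padic.norm_natCast_eq_one_iff]
    exact Nat.coprime_of_lt_prime hn.1.ne' hn.2 hp.out
  have hmem : ∏ n ∈ Finset.Ioo 0 p,
      (1 - ((ψ (r * n) - 1)⁻¹ • fun x => ψ (r * y x) - 1)) ∈ approxRing hψ D := by
    refine prod_mem fun n hn => sub_mem (one_mem _) ?_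
    exact smul_sub_one_mem_approxRing hψ hy hD hne hr1 (hunit _ (hnat n hn))
  refine approxRing_congr hψ hmem fun x hx => ?_
  rw [Finset.prod_apply]
  have hper : ∀ z w : ℚ_[p], ‖(z - w) / p‖ ≤ 1 → ψ (r * z) = ψ (r * w) := by
    intro z w h
    have h1 : r * z = p * r * ((z - w) / p) + r * w := by
      field_simp
      ring
    rw [h1, AddChar.map_add_eq_mul, hψ.map_eq_one_of_norm_le (s := p * r) ?_ hpr, one_mul]
    rw [norm_mul]
    exact mul_le_of_le_one_right (norm_nonneg _) h
  by_cases hx' : ‖y x / p‖ ≤ 1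
  · rw [Set.indicator_of_mem (show x ∈ {x ∈ D | ‖y x / p‖ ≤ 1} from ⟨hx, hx'⟩)]
    symm
    refine Finset.prod_eq_one fun n _ => ?_
    have h := hper (y x) 0 (by rwa [sub_zero])
    rw [mul_zero, AddChar.map_zero_eq_one] at h
    simp [h]
  · rw [Set.indicator_of_notMem (fun h => hx' h.2)]
    symm
    obtain ⟨n, hn, hny⟩ := IsSmoothChar.exists_natCast_lt_norm_sub_lt_one (hD x hx)
    have hn0 : n ≠ 0 := by
      rintro rfl
      rw [Nat.cast_zero, sub_zero] at hny
      exact hx' hny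
    have hnI : n ∈ Finset.Ioo 0 p := Finset.mem_Ioo.2 ⟨Nat.pos_of_ne_zero hn0, hn⟩
    refine Finset.prod_eq_zero hnI ?_
    have h1 : ψ (r * n) - 1 ≠ 0 := by
      rw [← norm_pos_iff, hunit _ (hnat n hnI), norm_pos_iff]
      exact sub_ne_zero.2 hr1
    simp [hper _ _ hny, h1]

/-- The polydisc of centre `c` and radius `‖s‖`. -/
def polydisc (c : Fin d → ℚ_[p]) (s : ℚ_[p]) : Set (Fin d → ℚ_[p]) :=
  {x | ∀ i, ‖x i - c i‖ ≤ ‖s‖}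

theorem self_mem_polydisc (c : Fin d → ℚ_[p]) (s : ℚ_[p]) : c ∈ polydisc c s := by
  intro i
  simp

/-- On a polydisc, the indicator function of a concentric polydisc is a uniform limit of
trigonometric polynomials with coefficients essentially bounded by `1`. -/
theorem indicator_polydisc_mem_approxRing (hψ : IsSmoothChar ψ) (hψ1 : ψ ≠ 1)
    (c : Fin d → ℚ_[p]) {s : ℚ_[p]} (hs : s ≠ 0) (j : ℕ) :
    Set.indicator (polydisc c (s * p ^ j)) (fun _ => (1 : ℂ_[p]))
      ∈ approxRing hψ (polydisc c s) := by
  have hp0 : (p : ℚ_[p]) ≠ 0 := by exact_mod_cast hp.out.ne_zero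
  have hy : ∀ (i : Fin d) (s r : ℚ_[p]),
      (fun x : Fin d → ℚ_[p] => ψ (r * ((x i - c i) / s))) ∈ trigPoly d ψ 1 := by
    intro i s r
    have h : (fun x : Fin d → ℚ_[p] => ψ (r * ((x i - c i) / s)))
        = fun x => ψ (-(r * (c i / s))) * ψ (Pi.single i (r / s) ⬝ᵥ x) := by
      ext x
      rw [single_dotProduct, ← AddChar.map_add_eq_mul]
      congr 1
      ring
    rw [h]
    exact mem_trigPoly (hψ.norm_eq_one _).le _
  have key : ∀ (i : Fin d) (s : ℚ_[p]), s ≠ 0 → ∀ D : Set (Fin d → ℚ_[p]), c ∈ D →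
      (∀ x ∈ D, ‖x i - c i‖ ≤ ‖s‖) →
      Set.indicator {x ∈ D | ‖x i - c i‖ ≤ ‖s * p‖} (fun _ => (1 : ℂ_[p])) ∈ approxRing hψ D := by
    intro i s hs D hc hD
    have h := indicator_mem_approxRing_aux hψ hψ1 (D := D) (hy i s) (fun x hx => by
      rw [norm_div]
      exact div_le_one_of_le₀ (hD x hx) (norm_nonneg _)) ⟨c, hc⟩
    convert h using 4 with x
    rw [div_div, norm_div, div_le_one (norm_pos_iff.2 (mul_ne_zero hs hp0))]
  -- Shrink one coordinate at a time.
  have step : ∀ (s : ℚ_[p]), s ≠ 0 → Set.indicator (polydisc c (s * p)) (fun _ => (1 : ℂ_[p]))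
      ∈ approxRing hψ (polydisc c s) := by
    intro s hs
    have h : ∀ S : Finset (Fin d), Set.indicator
        {x ∈ polydisc c s | ∀ i ∈ S, ‖x i - c i‖ ≤ ‖s * p‖} (fun _ => (1 : ℂ_[p]))
          ∈ approxRing hψ (polydisc c s) := by
      intro S
      induction S using Finset.induction_on with
      | empty =>
        refine approxRing_congr hψ (one_mem _) fun x hx => ?_
        rw [Pi.one_apply, Set.indicator_of_mem]
        exact ⟨hx, by simp⟩
      | insert i S _ ih =>
        refine indicator_mem_approxRing_trans hψ ?_ ih ?_
        · exact fun x hx => ⟨hx.1, fun k hk => hx.2 k (Finset.mem_insert_of_mem hk)⟩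
        · have h' := key i s hs {x ∈ polydisc c s | ∀ i ∈ S, ‖x i - c i‖ ≤ ‖s * p‖}
            ⟨self_mem_polydisc c s, fun k _ => by rw [sub_self, norm_zero]; exact norm_nonneg _⟩
            (fun x hx => hx.1 i)
          convert h' using 2
          ext x
          simp only [Set.mem_ofPred_eq, Finset.mem_insert, forall_eq_or_imp]
          tauto
    have h' := h Finset.univ
    convert h' using 2
    ext x
    simp only [Finset.mem_univ, forall_const, Set.mem_ofPred_eq, polydisc]
    refine ⟨fun hx => ⟨fun i => (hx i).trans ?_, hx⟩, fun hx => hx.2⟩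
    rw [norm_mul]
    exact mul_le_of_le_one_right (norm_nonneg _) Padic.norm_p_lt_one.le
  induction j with
  | zero =>
    refine approxRing_congr hψ (one_mem _) fun x hx => ?_
    rw [pow_zero, mul_one, Set.indicator_of_mem hx, Pi.one_apply]
  | succ j ih =>
    refine indicator_mem_approxRing_trans hψ ?_ ih ?_
    · intro x hx i
      refine (hx i).trans ?_
      rw [pow_succ, ← mul_assoc, norm_mul _ (p : ℚ_[p])]
      exact mul_le_of_le_one_right (norm_nonneg _) Padic.norm_p_lt_one.le
    · have := step (s * p ^ j) (mul_ne_zero hs (pow_ne_zero _ hp0))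
      rwa [mul_assoc, ← pow_succ] at this

end FresnelDeMathan

/-! ### Polydiscs and Schwartz functions -/

section Schwartz

variable {p : ℕ} [hp : Fact p.Prime] {d : ℕ} {ψ : AddChar ℚ_[p] ℂ_[p]}

theorem Padic.prime_ne_zero : (p : ℚ_[p]) ≠ 0 := by exact_mod_cast hp.out.ne_zero

theorem Padic.exists_prime_pow_norm_le {δ : ℝ} (hδ : 0 < δ) :
    ∃ n : ℕ, ∀ m, n ≤ m → ‖(p : ℚ_[p]) ^ m‖ ≤ δ := by
  have h := tendsto_pow_atTop_nhds_zero_of_lt_one (norm_nonneg (p : ℚ_[p])) Padic.norm_p_lt_one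
  obtain ⟨n, hn⟩ := Filter.eventually_atTop.1 (h.eventually (ge_mem_nhds hδ))
  exact ⟨n, fun m hm => by rw [norm_pow]; exact hn m hm⟩

theorem Padic.norm_mul_prime_pow_le (s : ℚ_[p]) (j : ℕ) : ‖s * p ^ j‖ ≤ ‖s‖ := by
  rw [norm_mul, norm_pow]
  exact mul_le_of_le_one_right (norm_nonneg _)
    (pow_le_one₀ (norm_nonneg _) Padic.norm_p_lt_one.le)

theorem polydisc_eq_closedBall (c : Fin d → ℚ_[p]) (s : ℚ_[p]) :
    polydisc c s = Metric.closedBall c ‖s‖ := by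
  ext x
  rw [Metric.mem_closedBall, dist_pi_le_iff (norm_nonneg s)]
  simp [polydisc, dist_eq_norm]

theorem mem_polydisc_iff {c x : Fin d → ℚ_[p]} {s : ℚ_[p]} :
    x ∈ polydisc c s ↔ ‖x - c‖ ≤ ‖s‖ := by
  rw [polydisc_eq_closedBall, mem_closedBall_iff_norm]

theorem mem_polydisc_comm {c x : Fin d → ℚ_[p]} {s : ℚ_[p]} :
    x ∈ polydisc c s ↔ c ∈ polydisc x s := by
  rw [mem_polydisc_iff, mem_polydisc_iff, norm_sub_rev]

theorem mem_polydisc_trans {x y z : Fin d → ℚ_[p]} {s : ℚ_[p]} (h1 : x ∈ polydisc y s)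
    (h2 : y ∈ polydisc z s) : x ∈ polydisc z s := by
  rw [mem_polydisc_iff] at *
  rw [← sub_add_sub_cancel x y z]
  exact (IsUltrametricDist.norm_add_le_max _ _).trans (max_le h1 h2)

theorem polydisc_subset {c : Fin d → ℚ_[p]} {s s' : ℚ_[p]} (h : ‖s‖ ≤ ‖s'‖) :
    polydisc c s ⊆ polydisc c s' := fun _ hx i => (hx i).trans h

theorem polydisc_eq_of_mem {c c' : Fin d → ℚ_[p]} {s : ℚ_[p]} (h : c ∈ polydisc c' s) :
    polydisc c s = polydisc c' s := by
  ext x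
  exact ⟨fun hx => mem_polydisc_trans hx h, fun hx => mem_polydisc_trans hx (mem_polydisc_comm.1 h)⟩

theorem isCompact_polydisc (c : Fin d → ℚ_[p]) (s : ℚ_[p]) : IsCompact (polydisc c s) := by
  rw [polydisc_eq_closedBall]
  exact isCompact_closedBall _ _

theorem isClopen_polydisc (c : Fin d → ℚ_[p]) {s : ℚ_[p]} (hs : s ≠ 0) :
    IsClopen (polydisc c s) := by
  rw [polydisc_eq_closedBall]
  exact IsUltrametricDist.isClopen_closedBall c (norm_ne_zero_iff.2 hs)

/-- A compact set is covered by finitely many disjoint polydiscs of a given radius. -/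
theorem exists_finset_polydisc {D : Set (Fin d → ℚ_[p])} (hD : IsCompact D) {s : ℚ_[p]}
    (hs : s ≠ 0) : ∃ t : Finset (Fin d → ℚ_[p]), (∀ x ∈ D, ∃ a ∈ t, x ∈ polydisc a s) ∧
      ∀ a ∈ t, ∀ b ∈ t, ∀ x, x ∈ polydisc a s → x ∈ polydisc b s → a = b := by
  classical
  -- A choice of a centre for every polydisc, depending on the polydisc as a set only.
  let rep : (Fin d → ℚ_[p]) → (Fin d → ℚ_[p]) := fun x =>
    Classical.choose (⟨x, rfl⟩ : ∃ y, polydisc y s = polydisc x s)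
  have hrep : ∀ x, polydisc (rep x) s = polydisc x s := fun x =>
    Classical.choose_spec (⟨x, rfl⟩ : ∃ y, polydisc y s = polydisc x s)
  have hrep' : ∀ x y, polydisc x s = polydisc y s → rep x = rep y := by
    intro x y h
    simp only [rep, h]
  obtain ⟨t, -, ht⟩ := hD.elim_nhds_subcover (fun x => polydisc x s)
    (fun x _ => (isClopen_polydisc x hs).isOpen.mem_nhds (self_mem_polydisc x s))
  refine ⟨t.image rep, fun x hx => ?_, ?_⟩
  · obtain ⟨a, ha, hxa⟩ := Set.mem_iUnion₂.1 (ht hx)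
    refine ⟨rep a, Finset.mem_image_of_mem _ ha, ?_⟩
    rwa [hrep]
  · intro a ha b hb x hxa hxb
    obtain ⟨a', -, rfl⟩ := Finset.mem_image.1 ha
    obtain ⟨b', -, rfl⟩ := Finset.mem_image.1 hb
    apply hrep'
    rw [hrep] at hxa hxb
    rw [← polydisc_eq_of_mem hxa, polydisc_eq_of_mem hxb]

/-- A function that is constant on the polydiscs of radius `‖s‖` is a sum of multiples of
indicator functions of such polydiscs. -/
theorem sum_indicator_polydisc {t : Finset (Fin d → ℚ_[p])} {s : ℚ_[p]}
    (ht : ∀ a ∈ t, ∀ b ∈ t, ∀ x, x ∈ polydisc a s → x ∈ polydisc b s → a = b)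
    (g : (Fin d → ℚ_[p]) → ℂ_[p]) {a x : Fin d → ℚ_[p]} (ha : a ∈ t) (hx : x ∈ polydisc a s) :
    ∑ b ∈ t, g b * Set.indicator (polydisc b s) (fun _ => (1 : ℂ_[p])) x = g a := by
  rw [Finset.sum_eq_single_of_mem a ha]
  · rw [Set.indicator_of_mem hx, mul_one]
  · intro b hb hba
    rw [Set.indicator_of_notMem (fun h => hba (ht b hb a ha x h hx)), mul_zero]

/-- The indicator function of a polydisc. -/
noncomputable def indicatorPolydisc (c : Fin d → ℚ_[p]) {s : ℚ_[p]} (hs : s ≠ 0) :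
    SchwartzFun p d :=
  ⟨Set.indicator (polydisc c s) (fun _ => 1), by
    have hc := isClopen_polydisc c hs
    refine ⟨?_, HasCompactSupport.intro (isCompact_polydisc c s)
      fun x hx => Set.indicator_of_notMem hx _⟩
    rw [IsLocallyConstant.iff_exists_open]
    intro x
    by_cases hx : x ∈ polydisc c s
    · exact ⟨_, hc.isOpen, hx, fun y hy => by
        rw [Set.indicator_of_mem hx, Set.indicator_of_mem hy]⟩
    · exact ⟨_, hc.compl.isOpen, hx, fun y hy => by
        rw [Set.indicator_of_notMem hx, Set.indicator_of_notMem hy]⟩⟩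

theorem coe_indicatorPolydisc (c : Fin d → ℚ_[p]) {s : ℚ_[p]} (hs : s ≠ 0) :
    (indicatorPolydisc c hs : (Fin d → ℚ_[p]) → ℂ_[p])
      = Set.indicator (polydisc c s) (fun _ => 1) := rfl

theorem indicatorPolydisc_self (c : Fin d → ℚ_[p]) {s : ℚ_[p]} (hs : s ≠ 0) :
    (indicatorPolydisc c hs : (Fin d → ℚ_[p]) → ℂ_[p]) c = 1 := by
  rw [coe_indicatorPolydisc, Set.indicator_of_mem (self_mem_polydisc c s)]

theorem indicatorZp_eq : indicatorZp p d = indicatorPolydisc 0 one_ne_zero := by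
  ext x
  simp [indicatorZp, indicatorPolydisc, polydisc]

theorem SchwartzFun.exists_const (f : SchwartzFun p d) : ∃ n : ℕ, ∀ m, n ≤ m →
    ∀ x y : Fin d → ℚ_[p], y ∈ polydisc x ((p : ℚ_[p]) ^ m) →
      (f : (Fin d → ℚ_[p]) → ℂ_[p]) y = (f : (Fin d → ℚ_[p]) → ℂ_[p]) x := by
  obtain ⟨f, hf, hfc⟩ := f
  obtain ⟨δ, hδ, h⟩ := lebesgue_number_lemma_of_metric (c := fun v : ℂ_[p] => f ⁻¹' {v})
    hfc (fun v => hf.isOpen_fiber v) (fun x _ => Set.mem_iUnion.2 ⟨f x, rfl⟩)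
  have key : ∀ x y, x ∈ tsupport f → dist y x < δ → f y = f x := by
    intro x y hx hy
    obtain ⟨v, hv⟩ := h x hx
    have h1 : f y = v := hv (Metric.mem_ball.2 hy)
    have h2 : f x = v := hv (Metric.mem_ball_self hδ)
    rw [h1, h2]
  obtain ⟨n, hn⟩ := Padic.exists_prime_pow_norm_le (p := p) (half_pos hδ)
  refine ⟨n, fun m hm x y hxy => ?_⟩
  have hd : dist y x < δ := by
    rw [dist_eq_norm]
    have := mem_polydisc_iff.1 hxy
    have := hn m hm
    linarith
  by_cases hx : x ∈ tsupport f
  · exact key x y hx hd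
  · by_cases hy : y ∈ tsupport f
    · exact (key y x hy (by rwa [dist_comm])).symm
    · change f y = f x
      rw [image_eq_zero_of_notMem_tsupport hx, image_eq_zero_of_notMem_tsupport hy]

theorem SchwartzFun.exists_support (f : SchwartzFun p d) : ∃ n : ℕ, ∀ m, n ≤ m →
    ∀ x : Fin d → ℚ_[p], (f : (Fin d → ℚ_[p]) → ℂ_[p]) x ≠ 0 →
      x ∈ polydisc 0 ((p : ℚ_[p]) ^ m)⁻¹ := by
  obtain ⟨f, hf, hfc⟩ := f
  obtain ⟨R, hR⟩ := (Metric.isBounded_iff_subset_closedBall 0).1 hfc.isCompact.isBounded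
  obtain ⟨n, hn⟩ := Padic.exists_prime_pow_norm_le (p := p) (δ := (|R| + 1)⁻¹) (by positivity)
  refine ⟨n, fun m hm x hx => ?_⟩
  rw [mem_polydisc_iff, sub_zero]
  have h1 : ‖x‖ ≤ R := by
    have := hR (subset_tsupport f hx)
    rwa [mem_closedBall_zero_iff] at this
  have h2 : 0 < ‖(p : ℚ_[p]) ^ m‖ := norm_pos_iff.2 (pow_ne_zero _ Padic.prime_ne_zero)
  have h3 := inv_anti₀ h2 (hn m hm)
  rw [inv_inv] at h3
  rw [norm_inv]
  linarith [le_abs_self R]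

theorem SchwartzFun.exists_norm_le (f : SchwartzFun p d) :
    ∃ C, ∀ x, ‖(f : (Fin d → ℚ_[p]) → ℂ_[p]) x‖ ≤ C :=
  f.2.2.exists_bound_of_continuous f.2.1.continuous

end Schwartz

/-! ### The action of the Heisenberg group on functions -/

section Action

variable {p : ℕ} [hp : Fact p.Prime] {d : ℕ} {ψ : AddChar ℚ_[p] ℂ_[p]}

namespace Heisenberg

/-- The element `[(a, 0), 0]`. -/
noncomputable def translation (a : Fin d → ℚ_[p]) : Heisenberg p d := ⟨Sum.elim a 0, 0⟩

/-- The element `[(0, b), 0]`. -/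
noncomputable def modulation (b : Fin d → ℚ_[p]) : Heisenberg p d := ⟨Sum.elim 0 b, 0⟩

theorem mem_nhds_one_iff {U : Set (Heisenberg p d)} :
    U ∈ 𝓝 1 ↔ ∃ δ : ℝ, 0 < δ ∧ ∀ h : Heisenberg p d, ‖h.w‖ ≤ δ → ‖h.t‖ ≤ δ → h ∈ U := by
  rw [nhds_induced, ((Metric.nhds_basis_closedBall).comap _).mem_iff]
  have h1 : ((1 : Heisenberg p d).w, (1 : Heisenberg p d).t) = 0 := rfl
  simp only [h1]
  refine exists_congr fun δ => and_congr_right fun _ => ⟨fun h g hw ht => h ?_, fun h g hg => ?_⟩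
  · rw [Set.mem_preimage, mem_closedBall_zero_iff, Prod.norm_mk]
    exact max_le hw ht
  · rw [Set.mem_preimage, mem_closedBall_zero_iff, Prod.norm_mk, max_le_iff] at hg
    exact h g hg.1 hg.2

theorem continuous_w : Continuous fun h : Heisenberg p d => h.w :=
  continuous_fst.comp (f := fun h : Heisenberg p d => (h.w, h.t)) continuous_induced_dom

theorem continuous_t : Continuous fun h : Heisenberg p d => h.t :=
  continuous_snd.comp (f := fun h : Heisenberg p d => (h.w, h.t)) continuous_induced_dom

theorem continuous_mul_left (g : Heisenberg p d) : Continuous fun h : Heisenberg p d => g * h := by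
  rw [continuous_induced_rng]
  have h1 := continuous_w (p := p) (d := d)
  have h2 := continuous_t (p := p) (d := d)
  refine Continuous.prodMk (continuous_const.add h1) ?_
  change Continuous fun h : Heisenberg p d => g.t + h.t + 1 / 2 * omega g.w h.w
  unfold omega dotProduct
  fun_prop

theorem isOpen_stabilizer_iff {G : Type*} [AddCommGroup G] [Module ℂ_[p] G]
    (ρ : Representation ℂ_[p] (Heisenberg p d) G) (v : G) :
    IsOpen {h | ρ h v = v} ↔ {h | ρ h v = v} ∈ 𝓝 1 := by
  refine ⟨fun h => h.mem_nhds (by simp), fun h => isOpen_iff_mem_nhds.2 fun g hg => ?_⟩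
  have hc := (continuous_mul_left g⁻¹).continuousAt (x := g)
  rw [ContinuousAt, inv_mul_cancel] at hc
  filter_upwards [hc h] with k hk
  have hg' : ρ g v = v := hg
  have hk' : ρ (g⁻¹ * k) v = v := hk
  have e : k = g * (g⁻¹ * k) := by group
  change ρ k v = v
  rw [e, map_mul, Module.End.mul_apply, hk', hg']

theorem continuous_act (g : Matrix.symplecticGroup (Fin d) ℚ_[p]) :
    Continuous fun h : Heisenberg p d => h.act g := by
  rw [continuous_induced_rng]
  have h1 := continuous_w (p := p) (d := d)
  refine Continuous.prodMk ?_ continuous_t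
  exact h1.matrix_vecMul continuous_const

theorem act_one (h : Heisenberg p d) : h.act 1 = h := by
  ext1
  · change h.w ᵥ* ((1 : Matrix.symplecticGroup (Fin d) ℚ_[p]) : Matrix _ _ ℚ_[p]) = h.w
    rw [OneMemClass.coe_one, Matrix.vecMul_one]
  · rfl

theorem one_act (g : Matrix.symplecticGroup (Fin d) ℚ_[p]) : (1 : Heisenberg p d).act g = 1 := by
  ext1
  · change (0 : Fin d ⊕ Fin d → ℚ_[p]) ᵥ* (g : Matrix (Fin d ⊕ Fin d) (Fin d ⊕ Fin d) ℚ_[p]) = 0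
    exact Matrix.zero_vecMul _
  · rfl

theorem act_act (h : Heisenberg p d) (g g' : Matrix.symplecticGroup (Fin d) ℚ_[p]) :
    (h.act g).act g' = h.act (g * g') := by
  ext1
  · exact Matrix.vecMul_vecMul h.w (g : Matrix (Fin d ⊕ Fin d) (Fin d ⊕ Fin d) ℚ_[p])
      (g' : Matrix (Fin d ⊕ Fin d) (Fin d ⊕ Fin d) ℚ_[p])
  · rfl

end Heisenberg

open Heisenberg

theorem coe_schrodinger (hψ : IsSmoothChar ψ) (h : Heisenberg p d) (f : SchwartzFun p d) :
    (schrodinger d ψ hψ h f : (Fin d → ℚ_[p]) → ℂ_[p]) = schrodingerFun ψ h f := rfl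

theorem schrodingerFun_add (h : Heisenberg p d) (f g : (Fin d → ℚ_[p]) → ℂ_[p]) :
    schrodingerFun ψ h (f + g) = schrodingerFun ψ h f + schrodingerFun ψ h g := by
  ext x
  simp [schrodingerFun, mul_add]

theorem schrodingerFun_zero (h : Heisenberg p d) :
    schrodingerFun ψ h (0 : (Fin d → ℚ_[p]) → ℂ_[p]) = 0 := by
  ext x
  simp [schrodingerFun]

theorem schrodingerFun_neg (h : Heisenberg p d) (f : (Fin d → ℚ_[p]) → ℂ_[p]) :
    schrodingerFun ψ h (-f) = -schrodingerFun ψ h f := by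
  ext x
  simp [schrodingerFun]

theorem schrodingerFun_smul (h : Heisenberg p d) (c : ℂ_[p]) (f : (Fin d → ℚ_[p]) → ℂ_[p]) :
    schrodingerFun ψ h (c • f) = c • schrodingerFun ψ h f := by
  ext x
  simp [schrodingerFun, mul_left_comm]

theorem schrodingerFun_mul (g h : Heisenberg p d) (f : (Fin d → ℚ_[p]) → ℂ_[p]) :
    schrodingerFun ψ (g * h) f = schrodingerFun ψ g (schrodingerFun ψ h f) := by
  ext x
  have ha : (g * h).a = g.a + h.a := rfl
  have hb : (g * h).b = g.b + h.b := rfl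
  have ht : (g * h).t = g.t + h.t + 1 / 2 * (g.a ⬝ᵥ h.b - g.b ⬝ᵥ h.a) := rfl
  simp only [schrodingerFun]
  rw [← mul_assoc, ← AddChar.map_add_eq_mul, ha, hb, ht, add_assoc x]
  congr 2
  simp only [add_dotProduct, dotProduct_add]
  rw [dotProduct_comm h.a g.b, dotProduct_comm h.b g.a]
  ring

theorem schrodingerFun_translation (a : Fin d → ℚ_[p]) (f : (Fin d → ℚ_[p]) → ℂ_[p]) :
    schrodingerFun ψ (translation a) f = fun x => f (x + a) := by
  ext x
  have ha : (translation a).a = a := rfl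
  have hb : (translation a).b = 0 := rfl
  have ht : (translation a).t = 0 := rfl
  simp [schrodingerFun, ha, hb, ht]

theorem schrodingerFun_modulation (b : Fin d → ℚ_[p]) (f : (Fin d → ℚ_[p]) → ℂ_[p]) :
    schrodingerFun ψ (modulation b) f = fun x => ψ (b ⬝ᵥ x) * f x := by
  ext x
  have ha : (modulation b).a = 0 := rfl
  have hb : (modulation b).b = b := rfl
  have ht : (modulation b).t = 0 := rfl
  simp [schrodingerFun, ha, hb, ht]

theorem norm_dotProduct_le {x y : Fin d → ℚ_[p]} : ‖x ⬝ᵥ y‖ ≤ ‖x‖ * ‖y‖ := by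
  refine IsUltrametricDist.norm_sum_le_of_forall_le_of_nonneg (by positivity) fun i _ => ?_
  rw [norm_mul]
  exact mul_le_mul (norm_le_pi_norm x i) (norm_le_pi_norm y i) (norm_nonneg _) (norm_nonneg _)

/-- A function whose stabilizer in the Heisenberg group is a neighbourhood of `1` is locally
constant, because of the translations, and compactly supported, because of the modulations. -/
theorem mem_SchwartzFun_of_stabilizer (hψ : IsSmoothChar ψ) (hψ1 : ψ ≠ 1)
    {f : (Fin d → ℚ_[p]) → ℂ_[p]} (hf : {h | schrodingerFun ψ h f = f} ∈ 𝓝 1) :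
    f ∈ SchwartzFun p d := by
  obtain ⟨δ, hδ, h⟩ := mem_nhds_one_iff.1 hf
  have hnorm : ∀ u v : Fin d → ℚ_[p], ‖u‖ ≤ δ → ‖v‖ ≤ δ →
      ‖(Sum.elim u v : Fin d ⊕ Fin d → ℚ_[p])‖ ≤ δ := by
    intro u v hu hv
    rw [pi_norm_le_iff_of_nonneg hδ.le]
    rintro (i | i)
    · exact (norm_le_pi_norm u i).trans hu
    · exact (norm_le_pi_norm v i).trans hv
  have htrans : ∀ a : Fin d → ℚ_[p], ‖a‖ ≤ δ → ∀ x, f (x + a) = f x := by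
    intro a ha x
    have h1 : schrodingerFun ψ (translation a) f = f :=
      h (translation a) (hnorm a 0 ha (by simpa using hδ.le)) (by simpa [translation] using hδ.le)
    rw [schrodingerFun_translation] at h1
    exact congrFun h1 x
  have hmod : ∀ b : Fin d → ℚ_[p], ‖b‖ ≤ δ → ∀ x, ψ (b ⬝ᵥ x) * f x = f x := by
    intro b hb x
    have h1 : schrodingerFun ψ (modulation b) f = f :=
      h (modulation b) (hnorm 0 b (by simpa using hδ.le) hb) (by simpa [modulation] using hδ.le)
    rw [schrodingerFun_modulation] at h1
    exact congrFun h1 x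
  constructor
  · rw [IsLocallyConstant.iff_exists_open]
    intro x
    refine ⟨Metric.ball x δ, Metric.isOpen_ball, Metric.mem_ball_self hδ, fun y hy => ?_⟩
    rw [mem_ball_iff_norm] at hy
    have := htrans (y - x) hy.le x
    rwa [add_sub_cancel] at this
  · obtain ⟨r, hr0, hr1, -⟩ := hψ.exists_conductor hψ1
    obtain ⟨n, hn⟩ := Padic.exists_prime_pow_norm_le (p := p) hδ
    have hn := hn n le_rfl
    have hu : 0 < ‖(p : ℚ_[p]) ^ n‖ := norm_pos_iff.2 (pow_ne_zero _ Padic.prime_ne_zero)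
    refine HasCompactSupport.intro
      (isCompact_closedBall (0 : Fin d → ℚ_[p]) (‖r‖ / ‖(p : ℚ_[p]) ^ n‖)) fun x hx => ?_
    rw [mem_closedBall_zero_iff, pi_norm_le_iff_of_nonneg (by positivity)] at hx
    push Not at hx
    obtain ⟨i, hi⟩ := hx
    rw [div_lt_iff₀ hu, mul_comm] at hi
    have h1 := hmod (Pi.single i ((p : ℚ_[p]) ^ n)) (by rw [Pi.norm_single]; exact hn) x
    rw [single_dotProduct] at h1
    have h2 : ψ (p ^ n * x i) ≠ 1 := by
      intro h3
      exact hr1 (hψ.map_eq_one_of_norm_le (by rw [norm_mul]; exact hi.le) h3)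
    have h3 : (ψ (p ^ n * x i) - 1) * f x = 0 := by rw [sub_mul, h1, one_mul, sub_self]
    exact (mul_eq_zero.1 h3).resolve_left (sub_ne_zero.2 h2)

theorem stabilizer_mem_nhds (hψ : IsSmoothChar ψ) (f : SchwartzFun p d) :
    {h | schrodinger d ψ hψ h f = f} ∈ 𝓝 1 := by
  obtain ⟨δ, hδ, h1⟩ := hψ.exists_norm_le_imp_eq_one
  obtain ⟨n, hn⟩ := SchwartzFun.exists_const f
  obtain ⟨m, hm⟩ := SchwartzFun.exists_support f
  have hn := hn n le_rfl
  have hm := hm m le_rfl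
  have hpn : 0 < ‖(p : ℚ_[p]) ^ n‖ := norm_pos_iff.2 (pow_ne_zero _ Padic.prime_ne_zero)
  have hpm : 0 < ‖((p : ℚ_[p]) ^ m)⁻¹‖ :=
    norm_pos_iff.2 (inv_ne_zero (pow_ne_zero _ Padic.prime_ne_zero))
  have h20 : 0 < ‖(1 / 2 : ℚ_[p])‖ := norm_pos_iff.2 (by norm_num)
  set η := min (min (min 1 δ) ‖(p : ℚ_[p]) ^ n‖)
    (min (δ / ‖(1 / 2 : ℚ_[p])‖) (δ / ‖((p : ℚ_[p]) ^ m)⁻¹‖)) with hη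
  have hη0 : 0 < η := by positivity
  have hη1 : η ≤ 1 := (min_le_left _ _).trans ((min_le_left _ _).trans (min_le_left _ _))
  have hηδ : η ≤ δ := (min_le_left _ _).trans ((min_le_left _ _).trans (min_le_right _ _))
  have hηn : η ≤ ‖(p : ℚ_[p]) ^ n‖ := (min_le_left _ _).trans (min_le_right _ _)
  have hη2 : ‖(1 / 2 : ℚ_[p])‖ * η ≤ δ := by
    rw [mul_comm, ← le_div_iff₀ h20]
    exact (min_le_right _ _).trans (min_le_left _ _)
  have hηm : η * ‖((p : ℚ_[p]) ^ m)⁻¹‖ ≤ δ := by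
    rw [← le_div_iff₀ hpm]
    exact (min_le_right _ _).trans (min_le_right _ _)
  refine mem_nhds_one_iff.2 ⟨η, hη0, fun h hw ht => ?_⟩
  have ha : ‖h.a‖ ≤ η := (pi_norm_le_iff_of_nonneg hη0.le).2 fun i =>
    (norm_le_pi_norm h.w (Sum.inl i)).trans hw
  have hb : ‖h.b‖ ≤ η := (pi_norm_le_iff_of_nonneg hη0.le).2 fun i =>
    (norm_le_pi_norm h.w (Sum.inr i)).trans hw
  change schrodinger d ψ hψ h f = f
  apply Subtype.ext
  rw [coe_schrodinger]
  funext x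
  rw [schrodingerFun, hn x (x + h.a) (by
    rw [mem_polydisc_iff, add_sub_cancel_left]
    exact ha.trans hηn)]
  by_cases hx : (f : (Fin d → ℚ_[p]) → ℂ_[p]) x = 0
  · rw [hx, mul_zero]
  · have hx' := mem_polydisc_iff.1 (hm x hx)
    rw [sub_zero] at hx'
    rw [h1, one_mul]
    refine (IsUltrametricDist.norm_add_le_max _ _).trans (max_le
      ((IsUltrametricDist.norm_add_le_max _ _).trans (max_le (ht.trans hηδ) ?_)) ?_)
    · rw [norm_mul]
      refine le_trans ?_ hη2
      gcongr
      calc _ ≤ ‖h.a‖ * ‖h.b‖ := norm_dotProduct_le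
        _ ≤ 1 * η := by gcongr; exact ha.trans hη1
        _ = η := one_mul _
    · refine norm_dotProduct_le.trans (le_trans ?_ hηm)
      gcongr

/-- The dual, with respect to `ψ`, of the polydisc of radius `‖s‖` contains the polydisc of radius
`‖p * r / s‖`, where `r` is the conductor. -/
theorem map_dotProduct_eq_one (hψ : IsSmoothChar ψ) {r : ℚ_[p]} (hpr : ψ (p * r) = 1)
    {s : ℚ_[p]} (hs : s ≠ 0) {b y : Fin d → ℚ_[p]} (hb : b ∈ polydisc 0 ((p : ℚ_[p]) * r / s))
    (hy : y ∈ polydisc 0 s) : ψ (b ⬝ᵥ y) = 1 := by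
  refine hψ.map_eq_one_of_norm_le ?_ hpr
  rw [mem_polydisc_iff, sub_zero] at hb hy
  refine norm_dotProduct_le.trans ((mul_le_mul hb hy (norm_nonneg _) (norm_nonneg _)).trans ?_)
  rw [← norm_mul, div_mul_cancel₀ _ hs]

/-- The dual of the polydisc of radius `‖p * r / s‖`, where `r` is the conductor, is contained in
the polydisc of radius `‖s‖`. -/
theorem exists_map_dotProduct_ne_one (hψ : IsSmoothChar ψ) {r : ℚ_[p]} (hr : ψ r ≠ 1)
    {s : ℚ_[p]} (hs : s ≠ 0) {x : Fin d → ℚ_[p]} (hx : x ∉ polydisc 0 s) :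
    ∃ b ∈ polydisc (0 : Fin d → ℚ_[p]) (p * r / s), ψ (b ⬝ᵥ x) ≠ 1 := by
  have hx' : ¬ ∀ i, ‖x i - (0 : Fin d → ℚ_[p]) i‖ ≤ ‖s‖ := hx
  push Not at hx'
  obtain ⟨i, hi⟩ := hx'
  rw [Pi.zero_apply, sub_zero] at hi
  refine ⟨Pi.single i (p * r / s), by rw [mem_polydisc_iff, sub_zero, Pi.norm_single], ?_⟩
  rw [single_dotProduct]
  intro h3
  refine hr (hψ.map_eq_one_of_norm_le ?_ h3)
  -- The norm is discrete, so that `‖s‖ < ‖x i‖` gains a factor `p`.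
  have h4 : 1 ≤ ‖(p : ℚ_[p]) * (x i / s)‖ := by
    by_contra! hcon
    have h5 := (Padic.norm_le_pow_iff_norm_lt_pow_add_one (x i / s) 0).2 (by
      rw [norm_mul, Padic.norm_p, inv_mul_lt_iff₀ (by exact_mod_cast hp.out.pos),
        mul_one] at hcon
      simpa using hcon)
    rw [zpow_zero, norm_div, div_le_one (norm_pos_iff.2 hs)] at h5
    exact absurd hi (not_lt.2 h5)
  have h5 : p * r / s * x i = r * (p * (x i / s)) := by
    field_simp
  rw [h5, norm_mul]
  exact le_mul_of_one_le_right (norm_nonneg _) h4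

/-- The functions that are invariant under the translations by `polydisc 0 s` and under the
modulations, centred at `c`, that are trivial on this polydisc are the multiples of the indicator
function of `polydisc c s`. -/
theorem eq_indicator_of_invariant (hψ : IsSmoothChar ψ) (hψ1 : ψ ≠ 1)
    {f : (Fin d → ℚ_[p]) → ℂ_[p]} (c : Fin d → ℚ_[p]) {s : ℚ_[p]} (hs : s ≠ 0)
    (htrans : ∀ a ∈ polydisc 0 s, ∀ x, f (x + a) = f x)
    (hmod : ∀ b : Fin d → ℚ_[p], (∀ y ∈ polydisc 0 s, ψ (b ⬝ᵥ y) = 1) →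
      ∀ x, ψ (b ⬝ᵥ (x - c)) * f x = f x) (x : Fin d → ℚ_[p]) :
    f x = f c * Set.indicator (polydisc c s) (fun _ => 1) x := by
  by_cases hx : x ∈ polydisc c s
  · rw [Set.indicator_of_mem hx, mul_one]
    have := htrans (x - c) (by rwa [mem_polydisc_iff, sub_zero, ← mem_polydisc_iff]) c
    rwa [add_sub_cancel] at this
  · rw [Set.indicator_of_notMem hx, mul_zero]
    obtain ⟨r, -, hr1, hpr⟩ := hψ.exists_conductor hψ1
    have hx' : x - c ∉ polydisc 0 s := by rwa [mem_polydisc_iff, sub_zero, ← mem_polydisc_iff]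
    obtain ⟨b, hb, hbx⟩ := exists_map_dotProduct_ne_one hψ hr1 hs hx'
    have h1 := hmod b (fun y hy => map_dotProduct_eq_one hψ hpr hs hb hy) x
    have h3 : (ψ (b ⬝ᵥ (x - c)) - 1) * f x = 0 := by
      rw [sub_mul, h1, one_mul, sub_self]
    exact (mul_eq_zero.1 h3).resolve_left (sub_ne_zero.2 hbx)

end Action

/-! ### Schur's lemma for the Schrödinger representation -/

section Schur

variable {p : ℕ} [hp : Fact p.Prime] {d : ℕ} {ψ : AddChar ℚ_[p] ℂ_[p]}

open Heisenberg

/-- Every endomorphism of the Schrödinger representation is a scalar: it preserves the lines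
spanned by the indicator functions of polydiscs, as these are determined by their invariance, and
the scalars do not depend on the centres and the radii. -/
theorem exists_eq_smul_of_commute (hψ : IsSmoothChar ψ) (hψ1 : ψ ≠ 1)
    (L : SchwartzFun p d →ₗ[ℂ_[p]] SchwartzFun p d)
    (hL : ∀ h f, L (schrodinger d ψ hψ h f) = schrodinger d ψ hψ h (L f)) :
    ∃ c : ℂ_[p], ∀ f, L f = c • f := by
  have htr : ∀ (f : SchwartzFun p d) (a x), (L (schrodinger d ψ hψ (translation a) f) :
      (Fin d → ℚ_[p]) → ℂ_[p]) x = (L f : (Fin d → ℚ_[p]) → ℂ_[p]) (x + a) := by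
    intro f a x
    rw [hL, coe_schrodinger, schrodingerFun_translation]
  have hmd : ∀ (f : SchwartzFun p d) (b x), (L (schrodinger d ψ hψ (modulation b) f) :
      (Fin d → ℚ_[p]) → ℂ_[p]) x = ψ (b ⬝ᵥ x) * (L f : (Fin d → ℚ_[p]) → ℂ_[p]) x := by
    intro f b x
    rw [hL, coe_schrodinger, schrodingerFun_modulation]
  have key : ∀ (c : Fin d → ℚ_[p]) (s : ℚ_[p]) (hs : s ≠ 0),
      L (indicatorPolydisc c hs) = ((L (indicatorPolydisc c hs) :
        (Fin d → ℚ_[p]) → ℂ_[p]) c) • indicatorPolydisc c hs := by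
    intro c s hs
    apply Subtype.ext
    funext x
    refine eq_indicator_of_invariant hψ hψ1 c hs (fun a ha x => ?_) (fun b hb x => ?_) x
    · rw [← htr]
      suffices e : schrodinger d ψ hψ (translation a) (indicatorPolydisc c hs)
        = indicatorPolydisc c hs by rw [e]
      apply Subtype.ext
      rw [coe_schrodinger, schrodingerFun_translation, coe_indicatorPolydisc]
      funext y
      have h1 : y + a ∈ polydisc c s ↔ y ∈ polydisc c s := by
        have h2 : y + a ∈ polydisc y s := by
          rwa [mem_polydisc_iff, add_sub_cancel_left, ← sub_zero a, ← mem_polydisc_iff]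
        rw [mem_polydisc_comm, polydisc_eq_of_mem h2, mem_polydisc_comm]
      by_cases hy : y ∈ polydisc c s
      · rw [Set.indicator_of_mem hy, Set.indicator_of_mem (h1.2 hy)]
      · rw [Set.indicator_of_notMem hy, Set.indicator_of_notMem (fun h => hy (h1.1 h))]
    · have h1 : schrodinger d ψ hψ (modulation b) (indicatorPolydisc c hs)
          = ψ (b ⬝ᵥ c) • indicatorPolydisc c hs := by
        apply Subtype.ext
        rw [coe_schrodinger, schrodingerFun_modulation, SetLike.val_smul, coe_indicatorPolydisc]
        funext y
        rw [Pi.smul_apply, smul_eq_mul]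
        by_cases hy : y ∈ polydisc c s
        · rw [← add_sub_cancel c y, dotProduct_add, AddChar.map_add_eq_mul, hb (y - c) (by
            rwa [mem_polydisc_iff, sub_zero, ← mem_polydisc_iff]), mul_one]
        · rw [Set.indicator_of_notMem hy, mul_zero, mul_zero]
      have h2 := hmd (indicatorPolydisc c hs) b x
      rw [h1, map_smul, SetLike.val_smul, Pi.smul_apply, smul_eq_mul] at h2
      rw [dotProduct_sub, AddChar.map_sub_eq_div, div_mul_eq_mul_div, ← h2,
        mul_div_cancel_left₀ _ (hψ.map_ne_zero _)]
  have hcentre : ∀ (c : Fin d → ℚ_[p]) (s : ℚ_[p]) (hs : s ≠ 0),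
      (L (indicatorPolydisc c hs) : (Fin d → ℚ_[p]) → ℂ_[p]) c
        = (L (indicatorPolydisc 0 hs) : (Fin d → ℚ_[p]) → ℂ_[p]) 0 := by
    intro c s hs
    have h := htr (indicatorPolydisc c hs) c 0
    rw [zero_add] at h
    rw [← h]
    suffices e : schrodinger d ψ hψ (translation c) (indicatorPolydisc c hs)
      = indicatorPolydisc 0 hs by rw [e]
    apply Subtype.ext
    rw [coe_schrodinger, schrodingerFun_translation]
    funext y
    simp only [coe_indicatorPolydisc]
    have h1 : y + c ∈ polydisc c s ↔ y ∈ polydisc 0 s := by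
      rw [mem_polydisc_iff, mem_polydisc_iff, add_sub_cancel_right, sub_zero]
    by_cases hy : y ∈ polydisc 0 s
    · rw [Set.indicator_of_mem hy, Set.indicator_of_mem (h1.2 hy)]
    · rw [Set.indicator_of_notMem hy, Set.indicator_of_notMem (fun h => hy (h1.1 h))]
  have hconst : ∀ (f : SchwartzFun p d) (n : ℕ), (∀ x y : Fin d → ℚ_[p],
      y ∈ polydisc x ((p : ℚ_[p]) ^ n) →
        (f : (Fin d → ℚ_[p]) → ℂ_[p]) y = (f : (Fin d → ℚ_[p]) → ℂ_[p]) x) →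
      L f = ((L (indicatorPolydisc 0 (pow_ne_zero n Padic.prime_ne_zero)) :
        (Fin d → ℚ_[p]) → ℂ_[p]) 0) • f := by
    intro f n hf
    have hs : (p : ℚ_[p]) ^ n ≠ 0 := pow_ne_zero n Padic.prime_ne_zero
    obtain ⟨t, ht, ht'⟩ := exists_finset_polydisc f.2.2.isCompact hs
    have hsum : f = ∑ a ∈ t, (f : (Fin d → ℚ_[p]) → ℂ_[p]) a • indicatorPolydisc a hs := by
      apply Subtype.ext
      funext x
      rw [AddSubmonoidClass.coe_finsetSum, Finset.sum_apply]
      by_cases hx : ∃ a ∈ t, x ∈ polydisc a (p ^ n)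
      · obtain ⟨a, ha, hxa⟩ := hx
        rw [hf a x hxa]
        exact (sum_indicator_polydisc ht' (f : (Fin d → ℚ_[p]) → ℂ_[p]) ha hxa).symm
      · have h0 : (f : (Fin d → ℚ_[p]) → ℂ_[p]) x = 0 := by
          by_contra h
          exact hx (ht x (subset_tsupport _ h))
        rw [h0]
        symm
        refine Finset.sum_eq_zero fun a ha => ?_
        rw [SetLike.val_smul, Pi.smul_apply, coe_indicatorPolydisc,
          Set.indicator_of_notMem (fun h => hx ⟨a, ha, h⟩), smul_zero]
    conv_lhs => rw [hsum]
    conv_rhs => rw [hsum]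
    rw [map_sum, Finset.smul_sum]
    refine Finset.sum_congr rfl fun a _ => ?_
    rw [map_smul, key, hcentre, smul_comm]
  refine ⟨(L (indicatorPolydisc 0 one_ne_zero) : (Fin d → ℚ_[p]) → ℂ_[p]) 0, fun f => ?_⟩
  obtain ⟨n, hn⟩ := SchwartzFun.exists_const f
  obtain ⟨m, hm⟩ := SchwartzFun.exists_const (indicatorPolydisc (p := p) (d := d) 0 one_ne_zero)
  have h1 := hconst f (max n m) (hn _ (le_max_left _ _))
  have h2 := hconst _ (max n m) (hm _ (le_max_right _ _))
  rw [h1]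
  congr 1
  rw [h2, SetLike.val_smul, Pi.smul_apply, indicatorPolydisc_self, smul_eq_mul, mul_one]

end Schur

/-! ### Approximation of Schwartz functions on polydiscs -/

section Approximation

variable {p : ℕ} [hp : Fact p.Prime] {d : ℕ} {ψ : AddChar ℚ_[p] ℂ_[p]}

/-- On a polydisc, every Schwartz function is approximated by trigonometric polynomials whose
coefficients are essentially bounded by its sup norm. -/
theorem SchwartzFun.exists_trigPoly_close (hψ : IsSmoothChar ψ) (hψ1 : ψ ≠ 1)
    (f : SchwartzFun p d) {C : ℝ} (hC : ∀ x, ‖(f : (Fin d → ℚ_[p]) → ℂ_[p]) x‖ ≤ C)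
    (c : Fin d → ℚ_[p]) {s : ℚ_[p]} (hs : s ≠ 0) {K : ℝ} (hK : 1 < K) {ε : ℝ} (hε : 0 < ε) :
    ∃ g ∈ trigPoly d ψ (C * K), ∀ x ∈ polydisc c s,
      ‖(f : (Fin d → ℚ_[p]) → ℂ_[p]) x - g x‖ ≤ ε := by
  classical
  obtain ⟨n, hn⟩ := SchwartzFun.exists_const f
  have hn := hn n le_rfl
  have hs0 := norm_pos_iff.2 hs
  have hpn : 0 < ‖(p : ℚ_[p]) ^ n‖ := norm_pos_iff.2 (pow_ne_zero _ Padic.prime_ne_zero)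
  obtain ⟨j, hj⟩ := Padic.exists_prime_pow_norm_le (p := p) (div_pos hpn hs0)
  have hj : ‖s * p ^ j‖ ≤ ‖(p : ℚ_[p]) ^ n‖ := by
    have := hj j le_rfl
    rwa [le_div_iff₀ hs0, mul_comm, ← norm_mul] at this
  have hsj : s * p ^ j ≠ 0 := mul_ne_zero hs (pow_ne_zero _ Padic.prime_ne_zero)
  obtain ⟨t, ht, ht'⟩ := exists_finset_polydisc (isCompact_polydisc c s) hsj
  let t' := t.filter (· ∈ polydisc c s)
  have hmem : (∑ a ∈ t', (f : (Fin d → ℚ_[p]) → ℂ_[p]) a •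
      Set.indicator (polydisc a (s * p ^ j)) (fun _ => (1 : ℂ_[p])))
        ∈ approxTrig ψ (polydisc c s) (C * K) := by
    refine sum_mem fun a ha => ?_
    have hac := (Finset.mem_filter.1 ha).2
    have h := smul_mem_approxTrig ((f : (Fin d → ℚ_[p]) → ℂ_[p]) a)
      (indicator_polydisc_mem_approxRing hψ hψ1 a hs j K hK)
    rw [polydisc_eq_of_mem hac] at h
    exact approxTrig_mono (by gcongr; exact hC a) h
  obtain ⟨g, hg, hgf⟩ := hmem ε hε
  refine ⟨g, hg, fun x hx => ?_⟩
  obtain ⟨a, ha, hxa⟩ := ht x hx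
  have hac : a ∈ polydisc c s := mem_polydisc_trans
    (mem_polydisc_comm.1 (polydisc_subset (Padic.norm_mul_prime_pow_le s j) hxa)) hx
  have h1 := sum_indicator_polydisc (t := t')
    (fun a ha b hb => ht' a (Finset.mem_filter.1 ha).1 b (Finset.mem_filter.1 hb).1)
    (f : (Fin d → ℚ_[p]) → ℂ_[p]) (Finset.mem_filter.2 ⟨ha, hac⟩) hxa
  have h2 := hgf x hx
  rw [Finset.sum_apply] at h2
  simp only [Pi.smul_apply, smul_eq_mul] at h2
  rwa [h1, ← hn a x (polydisc_subset hj hxa)] at h2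

end Approximation

/-! ### The invariant functional on Schwartz functions -/

section Haar

variable {p : ℕ} [hp : Fact p.Prime] {d : ℕ} {ψ : AddChar ℚ_[p] ℂ_[p]}

/-- The sum of a function over representatives of the cosets of a subgroup. It is only used for
functions that are invariant under the subgroup and non-zero on finitely many cosets. -/
noncomputable def cosetSum {V : Type*} [AddCommGroup V] (Λ : AddSubgroup V) (f : V → ℂ_[p]) :
    ℂ_[p] :=
  ∑ᶠ q : V ⧸ Λ, f q.out

section CosetSum

variable {V : Type*} [AddCommGroup V] {Λ Λ' : AddSubgroup V} {f : V → ℂ_[p]}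

theorem apply_out_mk (hf : ∀ a ∈ Λ, ∀ x, f (x + a) = f x) (x : V) :
    f (Quotient.out (x : V ⧸ Λ)) = f x := by
  have h : ((Quotient.out (x : V ⧸ Λ) : V) : V ⧸ Λ) = (x : V ⧸ Λ) := Quotient.out_eq' _
  rw [QuotientAddGroup.eq] at h
  have := hf _ h (Quotient.out (x : V ⧸ Λ))
  rw [add_neg_cancel_left] at this
  exact this.symm

theorem cosetSum_of_le (hle : Λ' ≤ Λ) [Finite (Λ ⧸ Λ'.addSubgroupOf Λ)]
    (hf : ∀ a ∈ Λ, ∀ x, f (x + a) = f x) (hfin : {q : V ⧸ Λ | f q.out ≠ 0}.Finite) :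
    cosetSum Λ' f = (Λ'.relIndex Λ : ℂ_[p]) * cosetSum Λ f := by
  classical
  have := Fintype.ofFinite (Λ ⧸ Λ'.addSubgroupOf Λ)
  let e := AddSubgroup.quotientEquivProdOfLE hle
  have h1 : ∀ u, f (Quotient.out (e.symm u)) = f (Quotient.out u.1) := by
    intro u
    have h2 : (e ((Quotient.out (e.symm u) : V) : V ⧸ Λ')).1
        = ((Quotient.out (e.symm u) : V) : V ⧸ Λ) := rfl
    have h3 : ((Quotient.out (e.symm u) : V) : V ⧸ Λ') = e.symm u := Quotient.out_eq' _
    rw [h3, e.apply_symm_apply] at h2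
    rw [h2, apply_out_mk hf]
  rw [cosetSum, ← finsum_comp_equiv e.symm, cosetSum]
  simp only [h1]
  rw [finsum_eq_sum_of_support_subset (s := hfin.toFinset ×ˢ Finset.univ) _ (by
      intro u hu
      simpa using hu), Finset.sum_product,
    finsum_eq_sum_of_support_subset (s := hfin.toFinset) _ (by intro u hu; simpa using hu),
    Finset.mul_sum]
  refine Finset.sum_congr rfl fun q _ => ?_
  change ∑ _y, f (Quotient.out q) = _
  rw [Finset.sum_const, nsmul_eq_mul, Finset.card_univ, AddSubgroup.relIndex, AddSubgroup.index,
    Nat.card_eq_fintype_card]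

theorem cosetSum_translate (hf : ∀ a ∈ Λ, ∀ x, f (x + a) = f x) (b : V) :
    cosetSum Λ (fun x => f (x + b)) = cosetSum Λ f := by
  rw [cosetSum, cosetSum,
    ← finsum_comp_equiv (Equiv.addRight (b : V ⧸ Λ)) (f := fun q => f (Quotient.out q))]
  refine finsum_congr fun q => ?_
  have h : Equiv.addRight (b : V ⧸ Λ) q = ((q.out + b : V) : V ⧸ Λ) := by
    rw [Equiv.coe_addRight, QuotientAddGroup.mk_add]
    congr 1
    exact (Quotient.out_eq' q).symm
  rw [h, apply_out_mk hf]

end CosetSum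

/-- The lattice `p ^ n • ℤ_[p]^d`. -/
def lattice (p d : ℕ) [Fact p.Prime] (n : ℕ) : AddSubgroup (Fin d → ℚ_[p]) where
  carrier := polydisc 0 ((p : ℚ_[p]) ^ n)
  zero_mem' := self_mem_polydisc _ _
  add_mem' := by
    intro x y hx hy
    rw [mem_polydisc_iff, sub_zero] at *
    exact (IsUltrametricDist.norm_add_le_max _ _).trans (max_le hx hy)
  neg_mem' := by
    intro x hx
    rw [mem_polydisc_iff, sub_zero] at *
    rwa [norm_neg]

theorem mem_lattice {n : ℕ} {x : Fin d → ℚ_[p]} :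
    x ∈ lattice p d n ↔ x ∈ polydisc 0 ((p : ℚ_[p]) ^ n) := Iff.rfl

theorem lattice_antitone : Antitone (lattice p d) := by
  intro m n h x hx
  obtain ⟨k, rfl⟩ := Nat.exists_eq_add_of_le h
  refine polydisc_subset ?_ hx
  rw [pow_add]
  exact Padic.norm_mul_prime_pow_le _ _

theorem mk_lattice_eq_iff {n : ℕ} {x y : Fin d → ℚ_[p]} :
    (x : (Fin d → ℚ_[p]) ⧸ lattice p d n) = y ↔ x ∈ polydisc y ((p : ℚ_[p]) ^ n) := by
  rw [eq_comm, QuotientAddGroup.eq, mem_lattice, mem_polydisc_iff, mem_polydisc_iff, sub_zero,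
    neg_add_eq_sub]

instance finite_lattice_quotient (m n : ℕ) :
    Finite (lattice p d m ⧸ (lattice p d n).addSubgroupOf (lattice p d m)) := by
  obtain ⟨t, ht, -⟩ := exists_finset_polydisc (isCompact_polydisc (0 : Fin d → ℚ_[p]) (p ^ m))
    (s := (p : ℚ_[p]) ^ n) (pow_ne_zero _ Padic.prime_ne_zero)
  choose! g hg hg' using ht
  refine Finite.of_injective (β := t)
    (fun q => ⟨g (q.out : lattice p d m), hg _ (q.out : lattice p d m).2⟩) fun q q' h => ?_
  have h1 := hg' _ (q.out : lattice p d m).2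
  have h2 := hg' _ (q'.out : lattice p d m).2
  rw [Subtype.mk.injEq] at h
  rw [h] at h1
  have h3 := mk_lattice_eq_iff.2 (mem_polydisc_trans h1 (mem_polydisc_comm.1 h2))
  rw [QuotientAddGroup.eq] at h3
  rw [← Quotient.out_eq' q, ← Quotient.out_eq' q']
  exact QuotientAddGroup.eq.2 h3

theorem relIndex_lattice_ne_zero (m n : ℕ) :
    ((lattice p d n).relIndex (lattice p d m) : ℂ_[p]) ≠ 0 := by
  rw [Nat.cast_ne_zero, AddSubgroup.relIndex]
  exact AddSubgroup.index_ne_zero_of_finite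

theorem finite_support_lattice (f : SchwartzFun p d) (n : ℕ) :
    {q : (Fin d → ℚ_[p]) ⧸ lattice p d n | (f : (Fin d → ℚ_[p]) → ℂ_[p]) q.out ≠ 0}.Finite := by
  obtain ⟨t, ht, -⟩ := exists_finset_polydisc f.2.2.isCompact
    (s := (p : ℚ_[p]) ^ n) (pow_ne_zero _ Padic.prime_ne_zero)
  refine (t.finite_toSet.image
    fun a : Fin d → ℚ_[p] => (a : (Fin d → ℚ_[p]) ⧸ lattice p d n)).subset ?_
  intro q hq
  obtain ⟨a, ha, hqa⟩ := ht q.out (subset_tsupport _ hq)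
  refine ⟨a, ha, ?_⟩
  change (a : (Fin d → ℚ_[p]) ⧸ lattice p d n) = q
  rw [← mk_lattice_eq_iff.2 hqa]
  exact Quotient.out_eq' q

/-- The sum over the cosets of `p ^ n • ℤ_[p]^d`, normalized to be independent of `n`. -/
noncomputable def haarSum (n : ℕ) (f : SchwartzFun p d) : ℂ_[p] :=
  ((lattice p d n).relIndex (lattice p d 0) : ℂ_[p])⁻¹ * cosetSum (lattice p d n) f

theorem haarSum_eq (f : SchwartzFun p d) {m n : ℕ} (hmn : m ≤ n)
    (hf : ∀ a ∈ lattice p d m, ∀ x,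
      (f : (Fin d → ℚ_[p]) → ℂ_[p]) (x + a) = (f : (Fin d → ℚ_[p]) → ℂ_[p]) x) :
    haarSum n f = haarSum m f := by
  rw [haarSum, haarSum, cosetSum_of_le (lattice_antitone hmn) hf (finite_support_lattice f m),
    ← AddSubgroup.relIndex_mul_relIndex _ _ _ (lattice_antitone hmn)
      (lattice_antitone (Nat.zero_le m))]
  have h1 := relIndex_lattice_ne_zero (p := p) (d := d) m n
  have h2 := relIndex_lattice_ne_zero (p := p) (d := d) 0 m
  push_cast
  field_simp

theorem SchwartzFun.exists_lattice_invariant (f : SchwartzFun p d) : ∃ n : ℕ, ∀ m, n ≤ m →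
    ∀ a ∈ lattice p d m, ∀ x,
      (f : (Fin d → ℚ_[p]) → ℂ_[p]) (x + a) = (f : (Fin d → ℚ_[p]) → ℂ_[p]) x := by
  obtain ⟨n, hn⟩ := SchwartzFun.exists_const f
  refine ⟨n, fun m hm a ha x => hn m hm x _ ?_⟩
  rw [mem_lattice, mem_polydisc_iff, sub_zero] at ha
  rwa [mem_polydisc_iff, add_sub_cancel_left]

theorem haarSum_choose (f : SchwartzFun p d) {n : ℕ} (hf : ∀ a ∈ lattice p d n, ∀ x,
      (f : (Fin d → ℚ_[p]) → ℂ_[p]) (x + a) = (f : (Fin d → ℚ_[p]) → ℂ_[p]) x) :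
    haarSum (Classical.choose (SchwartzFun.exists_lattice_invariant f)) f = haarSum n f := by
  have h := Classical.choose_spec (SchwartzFun.exists_lattice_invariant f)
  set m := Classical.choose (SchwartzFun.exists_lattice_invariant f)
  rw [← haarSum_eq f (le_max_left m n) (h m le_rfl), haarSum_eq f (le_max_right m n) hf]

/-- The translation invariant functional on the space of Schwartz functions for which `ℤ_[p]^d` has
measure `1`. A function is summed over the cosets of any lattice under which it is invariant. -/
noncomputable def haarFunctional (p d : ℕ) [Fact p.Prime] : SchwartzFun p d →ₗ[ℂ_[p]] ℂ_[p] where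
  toFun f := haarSum (Classical.choose (SchwartzFun.exists_lattice_invariant f)) f
  map_add' f g := by
    obtain ⟨m, hm⟩ := SchwartzFun.exists_lattice_invariant f
    obtain ⟨n, hn⟩ := SchwartzFun.exists_lattice_invariant g
    obtain ⟨k, hk⟩ := SchwartzFun.exists_lattice_invariant (f + g)
    set N := max k (max m n)
    rw [haarSum_choose (f + g) (hk N (le_max_left _ _)),
      haarSum_choose f (hm N ((le_max_left _ _).trans (le_max_right _ _))),
      haarSum_choose g (hn N ((le_max_right _ _).trans (le_max_right _ _))),
      haarSum, haarSum, haarSum, ← mul_add, cosetSum, cosetSum, cosetSum,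
      ← finsum_add_distrib (finite_support_lattice f N) (finite_support_lattice g N)]
    rfl
  map_smul' c f := by
    obtain ⟨m, hm⟩ := SchwartzFun.exists_lattice_invariant f
    obtain ⟨k, hk⟩ := SchwartzFun.exists_lattice_invariant (c • f)
    set N := max k m
    rw [haarSum_choose (c • f) (hk N (le_max_left _ _)), haarSum_choose f (hm N (le_max_right _ _)),
      haarSum, haarSum, RingHom.id_apply, smul_eq_mul, mul_left_comm, ← smul_eq_mul c, cosetSum,
      cosetSum, smul_finsum]
    rfl

theorem haarFunctional_eq (f : SchwartzFun p d) {n : ℕ} (hf : ∀ a ∈ lattice p d n, ∀ x,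
      (f : (Fin d → ℚ_[p]) → ℂ_[p]) (x + a) = (f : (Fin d → ℚ_[p]) → ℂ_[p]) x) :
    haarFunctional p d f = haarSum n f := haarSum_choose f hf

theorem haarFunctional_translation (hψ : IsSmoothChar ψ) (b : Fin d → ℚ_[p])
    (f : SchwartzFun p d) :
    haarFunctional p d (schrodinger d ψ hψ (Heisenberg.translation b) f)
      = haarFunctional p d f := by
  obtain ⟨n, hn⟩ := SchwartzFun.exists_lattice_invariant f
  have hn := hn n le_rfl
  have e : (schrodinger d ψ hψ (Heisenberg.translation b) f : (Fin d → ℚ_[p]) → ℂ_[p])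
      = fun x => (f : (Fin d → ℚ_[p]) → ℂ_[p]) (x + b) := by
    rw [coe_schrodinger, schrodingerFun_translation]
  rw [haarFunctional_eq f hn, haarFunctional_eq _ (n := n) (by
    intro a ha x
    rw [e]
    beta_reduce
    rw [add_right_comm, hn a ha]), haarSum, haarSum, e, cosetSum_translate hn]

theorem haarFunctional_indicatorPolydisc_ne_zero {s : ℚ_[p]} (hs : s ≠ 0) :
    haarFunctional p d (indicatorPolydisc 0 hs) ≠ 0 := by
  classical
  obtain ⟨n, hn⟩ := SchwartzFun.exists_lattice_invariant (indicatorPolydisc (d := d) 0 hs)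
  have hn := hn n le_rfl
  have hfin := finite_support_lattice (indicatorPolydisc (d := d) 0 hs) n
  rw [haarFunctional_eq _ hn, haarSum, cosetSum,
    finsum_eq_sum_of_support_subset (s := hfin.toFinset) _ (by intro q hq; simpa using hq)]
  refine mul_ne_zero (inv_ne_zero (relIndex_lattice_ne_zero _ _)) ?_
  -- All summands are `1`, and there is at least one of them.
  rw [Finset.sum_congr rfl (g := fun _ => (1 : ℂ_[p])) (by
    intro q hq
    rw [Set.Finite.mem_toFinset] at hq
    have hq' : (indicatorPolydisc (0 : Fin d → ℚ_[p]) hs : (Fin d → ℚ_[p]) → ℂ_[p]) q.out ≠ 0 := hq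
    rw [coe_indicatorPolydisc] at hq' ⊢
    exact Set.indicator_of_mem (Set.mem_of_indicator_ne_zero hq') _), Finset.sum_const,
    nsmul_eq_mul, mul_one, Nat.cast_ne_zero, ← Nat.pos_iff_ne_zero, Finset.card_pos]
  refine ⟨((0 : Fin d → ℚ_[p]) : (Fin d → ℚ_[p]) ⧸ lattice p d n), ?_⟩
  rw [Set.Finite.mem_toFinset]
  change (indicatorPolydisc (0 : Fin d → ℚ_[p]) hs : (Fin d → ℚ_[p]) → ℂ_[p]) _ ≠ 0
  rw [apply_out_mk hn, indicatorPolydisc_self]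
  exact one_ne_zero

end Haar

/-! ### The symplectic group -/

section Symplectic

variable {K : Type*} [Field K] {d : ℕ}

theorem symplectic_blocks (g : Matrix.symplecticGroup (Fin d) K) :
    g.1.toBlocks₁₁ * g.1.toBlocks₁₂ᵀ = g.1.toBlocks₁₂ * g.1.toBlocks₁₁ᵀ ∧
    g.1.toBlocks₂₁ * g.1.toBlocks₂₂ᵀ = g.1.toBlocks₂₂ * g.1.toBlocks₂₁ᵀ ∧
    g.1.toBlocks₁₁ * g.1.toBlocks₂₂ᵀ - g.1.toBlocks₁₂ * g.1.toBlocks₂₁ᵀ = 1 := by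
  have h := SymplecticGroup.transpose_mem g.2
  rw [← Matrix.fromBlocks_toBlocks g.1, Matrix.fromBlocks_transpose,
    SymplecticGroup.fromBlocks_mem_iff] at h
  simpa only [Matrix.transpose_transpose] using h

/-- The unipotent matrix `(1, S; 0, 1)` of a symmetric matrix `S`. -/
def symplecticUnipotent {S : Matrix (Fin d) (Fin d) K} (hS : Sᵀ = S) :
    Matrix.symplecticGroup (Fin d) K :=
  ⟨Matrix.fromBlocks 1 S 0 1, SymplecticGroup.fromBlocks_mem_iff.2 (by simp [hS])⟩

/-- If `(C, D)` is the lower half of a symplectic matrix, then `C * S + D` is invertible for some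
symmetric matrix `S`. As long as `u ᵥ* (C * S + D) = 0` for some `u ≠ 0`, adding `1` to the
`i`-th diagonal entry of `S`, where `(u ᵥ* C) i ≠ 0`, makes the left kernel smaller. -/
theorem exists_symmetric_isUnit_det {C D A B : Matrix (Fin d) (Fin d) K} (h1 : C * Dᵀ = D * Cᵀ)
    (h2 : A * Dᵀ - B * Cᵀ = 1) : ∃ S : Matrix (Fin d) (Fin d) K, Sᵀ = S ∧
      IsUnit (C * S + D).det := by
  have h2' : D * Aᵀ - C * Bᵀ = 1 := by
    have := congrArg Matrix.transpose h2
    simpa using this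
  have hnd : ∀ S (u : Fin d → K), u ᵥ* (C * S + D) = 0 → u ᵥ* C = 0 → u = 0 := by
    intro S u hu hC
    have hD : u ᵥ* D = 0 := by
      rw [Matrix.vecMul_add, ← Matrix.vecMul_vecMul, hC, Matrix.zero_vecMul, zero_add] at hu
      exact hu
    rw [← Matrix.vecMul_one u, ← h2', Matrix.vecMul_sub, ← Matrix.vecMul_vecMul,
      ← Matrix.vecMul_vecMul, hC, hD, Matrix.zero_vecMul, Matrix.zero_vecMul, sub_zero]
  suffices key : ∀ (n : ℕ) (S : Matrix (Fin d) (Fin d) K), Sᵀ = S →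
      Module.finrank K (LinearMap.ker (C * S + D).vecMulLinear) = n →
      ∃ S' : Matrix (Fin d) (Fin d) K, S'ᵀ = S' ∧ IsUnit (C * S' + D).det from
    key _ 0 Matrix.transpose_zero rfl
  intro n
  induction n using Nat.strong_induction_on with
  | _ n ih =>
    intro S hS hn
    by_cases hdet : (C * S + D).det = 0
    · obtain ⟨u, hu0, hu⟩ := Matrix.exists_vecMul_eq_zero_iff.2 hdet
      have huC : u ᵥ* C ≠ 0 := fun h => hu0 (hnd S u hu h)
      obtain ⟨i, hi⟩ := Function.ne_iff.1 huC
      rw [Pi.zero_apply] at hi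
      set M := C * S + D with hM
      have hMC : M * Cᵀ = C * Mᵀ := by
        rw [hM, Matrix.transpose_add, Matrix.transpose_mul, hS, add_mul, mul_add, h1,
          Matrix.mul_assoc]
      have hM' : C * (S + Matrix.single i i 1) + D = M + C * Matrix.single i i 1 := by
        rw [hM, mul_add]
        abel
      have hvec : ∀ u' : Fin d → K, u' ᵥ* (M + C * Matrix.single i i 1)
          = u' ᵥ* M + Pi.single i ((u' ᵥ* C) i) := by
        intro u'
        rw [Matrix.vecMul_add, ← Matrix.vecMul_vecMul]
        congr 1
        funext j
        rcases eq_or_ne i j with rfl | hj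
        · simp [Matrix.vecMul, dotProduct, Matrix.single_apply]
        · simp [Matrix.vecMul, dotProduct, hj, hj.symm]
      have hlt : LinearMap.ker (C * (S + Matrix.single i i 1) + D).vecMulLinear
          < LinearMap.ker M.vecMulLinear := by
        rw [hM']
        refine lt_of_le_of_ne (fun u' hu' => ?_) fun heq => ?_
        · rw [LinearMap.mem_ker, Matrix.vecMulLinear_apply, hvec] at hu'
          rw [LinearMap.mem_ker, Matrix.vecMulLinear_apply]
          have h3 : (u' ᵥ* M) ⬝ᵥ (u ᵥ* C) = 0 := by
            have e : u ᵥ* C = Cᵀ *ᵥ u := (Matrix.mulVec_transpose C u).symm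
            rw [e, Matrix.dotProduct_mulVec, Matrix.vecMul_vecMul, hMC, ← Matrix.vecMul_vecMul,
              ← Matrix.dotProduct_mulVec, Matrix.mulVec_transpose, hu, dotProduct_zero]
          have h4 := congrArg (· ⬝ᵥ (u ᵥ* C)) hu'
          simp only [add_dotProduct, h3, single_dotProduct, zero_dotProduct, zero_add] at h4
          have h5 := (mul_eq_zero.1 h4).resolve_right hi
          rwa [h5, Pi.single_zero, add_zero] at hu'
        · have hmem : u ∈ LinearMap.ker M.vecMulLinear := by
            rw [LinearMap.mem_ker, Matrix.vecMulLinear_apply, hu]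
          rw [← heq, LinearMap.mem_ker, Matrix.vecMulLinear_apply, hvec, hu, zero_add] at hmem
          have := congrFun hmem i
          rw [Pi.single_eq_same, Pi.zero_apply] at this
          exact hi this
      refine ih _ ?_ (S + Matrix.single i i 1) ?_ rfl
      · rw [← hn]
        exact Submodule.finrank_lt_finrank_of_lt hlt
      · rw [Matrix.transpose_add, hS, Matrix.transpose_single]
    · exact ⟨S, hS, isUnit_iff_ne_zero.2 hdet⟩

/-- Up to right multiplication by products of unipotent matrices and `J`, every symplectic matrix
has lower left block zero. -/
theorem exists_symplectic_factor (g : Matrix.symplecticGroup (Fin d) K) :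
    ∃ (S S' : Matrix (Fin d) (Fin d) K) (hS : Sᵀ = S) (hS' : S'ᵀ = S'),
      (g * symplecticUnipotent hS * SymplecticGroup.symJ (Fin d) K * symplecticUnipotent hS'
        * SymplecticGroup.symJ (Fin d) K).1.toBlocks₂₁ = 0 := by
  obtain ⟨-, h1, h2⟩ := symplectic_blocks g
  obtain ⟨S, hS, hdet⟩ := exists_symmetric_isUnit_det h1 h2
  set A := g.1.toBlocks₁₁
  set B := g.1.toBlocks₁₂
  set C := g.1.toBlocks₂₁
  set D := g.1.toBlocks₂₂
  set E := C * S + D with hE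
  have hEC : E * Cᵀ = C * Eᵀ := by
    rw [hE, Matrix.transpose_add, Matrix.transpose_mul, hS, add_mul, mul_add, h1, Matrix.mul_assoc]
  have hEdet : IsUnit Eᵀ.det := by rwa [Matrix.det_transpose]
  have hS' : (E⁻¹ * C)ᵀ = E⁻¹ * C := by
    rw [Matrix.transpose_mul, Matrix.transpose_nonsing_inv]
    calc Cᵀ * Eᵀ⁻¹ = E⁻¹ * (E * Cᵀ) * Eᵀ⁻¹ := by
          rw [← Matrix.mul_assoc, Matrix.nonsing_inv_mul _ hdet, Matrix.one_mul]
      _ = E⁻¹ * C := by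
          rw [hEC, Matrix.mul_assoc, Matrix.mul_assoc, Matrix.mul_nonsing_inv _ hEdet,
            Matrix.mul_one]
  refine ⟨S, E⁻¹ * C, hS, hS', ?_⟩
  change (g.1 * Matrix.fromBlocks 1 S 0 1 * Matrix.fromBlocks 0 (-1) 1 0
    * Matrix.fromBlocks 1 (E⁻¹ * C) 0 1 * Matrix.fromBlocks 0 (-1) 1 0).toBlocks₂₁ = 0
  rw [← Matrix.fromBlocks_toBlocks g.1]
  simp only [Matrix.fromBlocks_multiply, Matrix.toBlocks_fromBlocks₂₁]
  have h3 : E * (E⁻¹ * C) = C := by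
    rw [← Matrix.mul_assoc, Matrix.mul_nonsing_inv _ hdet, Matrix.one_mul]
  simp only [mul_zero, mul_one, zero_add, add_zero, mul_neg]
  change (C * S + D) * (E⁻¹ * C) + -C = 0
  rw [← hE, h3, add_neg_cancel]

end Symplectic

/-! ### Intertwining operators -/

section Intertwining

variable {p : ℕ} [hp : Fact p.Prime] {d : ℕ} {ψ : AddChar ℚ_[p] ℂ_[p]}

open Heisenberg

theorem Heisenberg.act_a (h : Heisenberg p d) (g : Matrix.symplecticGroup (Fin d) ℚ_[p]) :
    (h.act g).a = h.a ᵥ* g.1.toBlocks₁₁ + h.b ᵥ* g.1.toBlocks₂₁ := by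
  have e : (h.act g).w = h.w ᵥ* g.1 := rfl
  rw [← Matrix.fromBlocks_toBlocks g.1, Matrix.vecMul_fromBlocks] at e
  funext i
  exact congrFun e (Sum.inl i)

theorem Heisenberg.act_b (h : Heisenberg p d) (g : Matrix.symplecticGroup (Fin d) ℚ_[p]) :
    (h.act g).b = h.a ᵥ* g.1.toBlocks₁₂ + h.b ᵥ* g.1.toBlocks₂₂ := by
  have e : (h.act g).w = h.w ᵥ* g.1 := rfl
  rw [← Matrix.fromBlocks_toBlocks g.1, Matrix.vecMul_fromBlocks] at e
  funext i
  exact congrFun e (Sum.inr i)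

/-- An equivariant map from Schwartz functions to functions has Schwartz functions as values. -/
theorem mem_SchwartzFun_of_equivariant (hψ : IsSmoothChar ψ) (hψ1 : ψ ≠ 1)
    (g : Matrix.symplecticGroup (Fin d) ℚ_[p]) (L : SchwartzFun p d → (Fin d → ℚ_[p]) → ℂ_[p])
    (hL : ∀ h f, schrodingerFun ψ h (L f) = L (schrodinger d ψ hψ (h.act g) f))
    (f : SchwartzFun p d) : L f ∈ SchwartzFun p d := by
  refine mem_SchwartzFun_of_stabilizer hψ hψ1 ?_
  have h1 : Filter.Tendsto (fun h : Heisenberg p d => h.act g) (𝓝 1) (𝓝 1) := by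
    have := (continuous_act (p := p) (d := d) g).tendsto 1
    rwa [one_act] at this
  filter_upwards [h1 (stabilizer_mem_nhds hψ f)] with h hh
  have hh' : schrodinger d ψ hψ (h.act g) f = f := hh
  change schrodingerFun ψ h (L f) = L f
  rw [hL, hh']

/-- The elements of the symplectic group for which there is an intertwining operator. -/
noncomputable def intertwinable (d : ℕ) (hψ : IsSmoothChar ψ) :
    Subgroup (Matrix.symplecticGroup (Fin d) ℚ_[p]) where
  carrier := {g | ∃ T, IsIntertwining ψ hψ g T}
  one_mem' := ⟨LinearEquiv.refl _ _, fun h f => by rw [act_one]; rfl⟩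
  mul_mem' := by
    rintro g g' ⟨T, hT⟩ ⟨T', hT'⟩
    refine ⟨T'.trans T, fun h f => ?_⟩
    rw [LinearEquiv.trans_apply, LinearEquiv.trans_apply, hT, hT', act_act]
  inv_mem' := by
    rintro g ⟨T, hT⟩
    refine ⟨T.symm, fun h f => ?_⟩
    have h1 := hT (h.act g⁻¹) (T.symm f)
    rw [act_act, inv_mul_cancel, act_one, T.apply_symm_apply] at h1
    rw [h1, T.symm_apply_apply]

/-- The intertwining operator of an element `(A, B; 0, D)` of the Siegel parabolic, on functions. -/
noncomputable def siegelFun (ψ : AddChar ℚ_[p] ℂ_[p]) (g : Matrix.symplecticGroup (Fin d) ℚ_[p])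
    (f : (Fin d → ℚ_[p]) → ℂ_[p]) : (Fin d → ℚ_[p]) → ℂ_[p] :=
  fun x => ψ (1 / 2 * ((x ᵥ* g.1.toBlocks₁₁) ⬝ᵥ (x ᵥ* g.1.toBlocks₁₂)))
    * f (x ᵥ* g.1.toBlocks₁₁)

theorem siegel_mul_transpose {g : Matrix.symplecticGroup (Fin d) ℚ_[p]}
    (hg : g ∈ siegelParabolic p d) : g.1.toBlocks₁₁ * g.1.toBlocks₂₂ᵀ = 1 := by
  have hg' : g.1.toBlocks₂₁ = 0 := hg
  have h := (symplectic_blocks g).2.2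
  rwa [hg', Matrix.transpose_zero, mul_zero, sub_zero] at h

theorem siegelFun_equivariant {g : Matrix.symplecticGroup (Fin d) ℚ_[p]}
    (hg : g ∈ siegelParabolic p d) (h : Heisenberg p d) (f : (Fin d → ℚ_[p]) → ℂ_[p]) :
    schrodingerFun ψ h (siegelFun ψ g f) = siegelFun ψ g (schrodingerFun ψ (h.act g) f) := by
  have hg' : g.1.toBlocks₂₁ = 0 := hg
  have h1 := siegel_mul_transpose hg
  have h2 := (symplectic_blocks g).1
  have ha := act_a h g
  have hb := act_b h g
  have ht : (h.act g).t = h.t := rfl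
  rw [hg', Matrix.vecMul_zero, add_zero] at ha
  set A := g.1.toBlocks₁₁
  set B := g.1.toBlocks₁₂
  set D := g.1.toBlocks₂₂
  have hAD : ∀ x y : Fin d → ℚ_[p], (x ᵥ* A) ⬝ᵥ (y ᵥ* D) = x ⬝ᵥ y := by
    intro x y
    rw [← Matrix.mulVec_transpose D, Matrix.dotProduct_mulVec, Matrix.vecMul_vecMul, h1,
      Matrix.vecMul_one]
  have hAB : ∀ x y : Fin d → ℚ_[p], (x ᵥ* A) ⬝ᵥ (y ᵥ* B) = (y ᵥ* A) ⬝ᵥ (x ᵥ* B) := by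
    intro x y
    rw [← Matrix.mulVec_transpose B, Matrix.dotProduct_mulVec, Matrix.vecMul_vecMul, h2,
      ← Matrix.vecMul_vecMul, ← Matrix.dotProduct_mulVec, Matrix.mulVec_transpose, dotProduct_comm]
  funext x
  simp only [schrodingerFun, siegelFun]
  rw [ha, hb, ht, ← mul_assoc, ← mul_assoc, ← AddChar.map_add_eq_mul, ← AddChar.map_add_eq_mul,
    ← Matrix.add_vecMul]
  congr 2
  simp only [Matrix.add_vecMul, dotProduct_add, add_dotProduct]
  rw [hAD, dotProduct_comm (h.b ᵥ* D), hAD, dotProduct_comm (h.a ᵥ* B), hAB x h.a,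
    dotProduct_comm x h.b]
  ring

theorem siegelFun_injective {g : Matrix.symplecticGroup (Fin d) ℚ_[p]}
    (hψ : IsSmoothChar ψ) (hg : g ∈ siegelParabolic p d) {f : (Fin d → ℚ_[p]) → ℂ_[p]}
    (hf : siegelFun ψ g f = 0) : f = 0 := by
  have h1 := mul_eq_one_comm.1 (siegel_mul_transpose hg)
  funext y
  have h2 := congrFun hf (y ᵥ* g.1.toBlocks₂₂ᵀ)
  rw [siegelFun, Matrix.vecMul_vecMul, h1, Matrix.vecMul_one] at h2
  exact (mul_eq_zero.1 h2).resolve_left (hψ.map_ne_zero _)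

/-- The intertwining operator of an element of the Siegel parabolic, as a linear map. -/
noncomputable def siegelLinear (hψ : IsSmoothChar ψ) (hψ1 : ψ ≠ 1)
    {g : Matrix.symplecticGroup (Fin d) ℚ_[p]} (hg : g ∈ siegelParabolic p d) :
    SchwartzFun p d →ₗ[ℂ_[p]] SchwartzFun p d where
  toFun f := ⟨siegelFun ψ g f, mem_SchwartzFun_of_equivariant hψ hψ1 g
    (fun f => siegelFun ψ g f) (fun h f => siegelFun_equivariant hg h f) f⟩
  map_add' f f' := by
    ext x
    simp [siegelFun, mul_add]
  map_smul' c f := by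
    ext x
    simp [siegelFun, mul_left_comm]

theorem siegelLinear_equivariant (hψ : IsSmoothChar ψ) (hψ1 : ψ ≠ 1)
    {g : Matrix.symplecticGroup (Fin d) ℚ_[p]} (hg : g ∈ siegelParabolic p d)
    (h : Heisenberg p d) (f : SchwartzFun p d) :
    schrodinger d ψ hψ h (siegelLinear hψ hψ1 hg f)
      = siegelLinear hψ hψ1 hg (schrodinger d ψ hψ (h.act g) f) :=
  Subtype.ext (siegelFun_equivariant hg h f)

theorem siegelLinear_injective (hψ : IsSmoothChar ψ) (hψ1 : ψ ≠ 1)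
    {g : Matrix.symplecticGroup (Fin d) ℚ_[p]} (hg : g ∈ siegelParabolic p d) :
    Function.Injective (siegelLinear hψ hψ1 hg) := by
  rw [injective_iff_map_eq_zero]
  intro f hf
  exact Subtype.ext (siegelFun_injective hψ hg (congrArg Subtype.val hf))

theorem supNorm_siegelLinear (hψ : IsSmoothChar ψ) (hψ1 : ψ ≠ 1)
    {g : Matrix.symplecticGroup (Fin d) ℚ_[p]} (hg : g ∈ siegelParabolic p d)
    (f : SchwartzFun p d) : supNorm (siegelLinear hψ hψ1 hg f) = supNorm f := by
  have h1 := mul_eq_one_comm.1 (siegel_mul_transpose hg)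
  have hs : Function.Surjective fun x : Fin d → ℚ_[p] => x ᵥ* g.1.toBlocks₁₁ := by
    intro y
    refine ⟨y ᵥ* g.1.toBlocks₂₂ᵀ, ?_⟩
    beta_reduce
    rw [Matrix.vecMul_vecMul, h1, Matrix.vecMul_one]
  rw [supNorm, supNorm, ← hs.iSup_comp fun x => ‖(f : (Fin d → ℚ_[p]) → ℂ_[p]) x‖]
  refine iSup_congr fun x => ?_
  change ‖siegelFun ψ g f x‖ = _
  rw [siegelFun, norm_mul, hψ.norm_eq_one, one_mul]

theorem exists_smul_of_equivariant_one (hψ : IsSmoothChar ψ) (hψ1 : ψ ≠ 1)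
    {L : SchwartzFun p d →ₗ[ℂ_[p]] SchwartzFun p d} (hL : ∀ h f,
      schrodinger d ψ hψ h (L f) = L (schrodinger d ψ hψ (h.act 1) f)) :
    ∃ c : ℂ_[p], ∀ f, L f = c • f :=
  exists_eq_smul_of_commute hψ hψ1 L fun h f => by rw [hL, act_one]

theorem exists_schwartz_ne_zero : ∃ f : SchwartzFun p d, f ≠ 0 := by
  refine ⟨indicatorPolydisc 0 one_ne_zero, fun h => ?_⟩
  have h1 := indicatorPolydisc_self (0 : Fin d → ℚ_[p]) (one_ne_zero (α := ℚ_[p]))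
  rw [h] at h1
  exact zero_ne_one h1

theorem siegelLinear_bijective (hψ : IsSmoothChar ψ) (hψ1 : ψ ≠ 1)
    {g : Matrix.symplecticGroup (Fin d) ℚ_[p]} (hg : g ∈ siegelParabolic p d) :
    Function.Bijective (siegelLinear hψ hψ1 hg) := by
  refine ⟨siegelLinear_injective hψ hψ1 hg, fun f => ?_⟩
  have hg' := inv_mem hg
  obtain ⟨c, hc⟩ := exists_smul_of_equivariant_one hψ hψ1
    (L := siegelLinear hψ hψ1 hg ∘ₗ siegelLinear hψ hψ1 hg') (fun h f => by
      rw [LinearMap.comp_apply, LinearMap.comp_apply, siegelLinear_equivariant,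
        siegelLinear_equivariant, act_act, mul_inv_cancel])
  have hc0 : c ≠ 0 := by
    rintro rfl
    obtain ⟨f0, hf0⟩ := exists_schwartz_ne_zero (p := p) (d := d)
    have h1 := hc f0
    rw [zero_smul] at h1
    apply hf0
    apply siegelLinear_injective hψ hψ1 hg'
    apply siegelLinear_injective hψ hψ1 hg
    rw [map_zero, map_zero]
    exact h1
  refine ⟨c⁻¹ • siegelLinear hψ hψ1 hg' f, ?_⟩
  have h1 := hc f
  rw [LinearMap.comp_apply] at h1
  rw [map_smul, h1, smul_smul, inv_mul_cancel₀ hc0, one_smul]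

theorem siegelParabolic_le_intertwinable (hψ : IsSmoothChar ψ) (hψ1 : ψ ≠ 1) :
    siegelParabolic p d ≤ intertwinable d hψ := fun _ hg =>
  ⟨LinearEquiv.ofBijective _ (siegelLinear_bijective hψ hψ1 hg),
    fun h f => siegelLinear_equivariant hψ hψ1 hg h f⟩

/-! ### The Fourier transform -/

/-- The Fourier transform `f ↦ ∫ ψ (-(x ⬝ y)) * f y dy`, where the integral is
`haarFunctional`. -/
noncomputable def fourierFun (hψ : IsSmoothChar ψ) (f : SchwartzFun p d) :
    (Fin d → ℚ_[p]) → ℂ_[p] :=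
  fun x => haarFunctional p d (schrodinger d ψ hψ (modulation (-x)) f)

/-- The central element `[0, z]`. -/
noncomputable def Heisenberg.central (z : ℚ_[p]) : Heisenberg p d := ⟨0, z⟩

theorem schrodinger_central (hψ : IsSmoothChar ψ) (z : ℚ_[p]) (f : SchwartzFun p d) :
    schrodinger d ψ hψ (central z) f = ψ z • f := by
  apply Subtype.ext
  funext x
  have ha : (central z : Heisenberg p d).a = 0 := rfl
  have hb : (central z : Heisenberg p d).b = 0 := rfl
  have ht : (central z : Heisenberg p d).t = z := rfl
  rw [coe_schrodinger, schrodingerFun, ha, hb, ht]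
  simp

theorem modulation_mul_act_J (h : Heisenberg p d) (x : Fin d → ℚ_[p]) :
    modulation (-x) * h.act (SymplecticGroup.symJ (Fin d) ℚ_[p])
      = central (h.t + 1 / 2 * (h.a ⬝ᵥ h.b) + h.b ⬝ᵥ x)
        * (translation h.b * modulation (-(x + h.a))) := by
  have ha : (h.act (SymplecticGroup.symJ (Fin d) ℚ_[p])).a = h.b := by
    rw [act_a, SymplecticGroup.coe_J, Matrix.J, Matrix.toBlocks_fromBlocks₁₁,
      Matrix.toBlocks_fromBlocks₂₁, Matrix.vecMul_zero, Matrix.vecMul_one, zero_add]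
  have hb : (h.act (SymplecticGroup.symJ (Fin d) ℚ_[p])).b = -h.a := by
    rw [act_b, SymplecticGroup.coe_J, Matrix.J, Matrix.toBlocks_fromBlocks₁₂,
      Matrix.toBlocks_fromBlocks₂₂, Matrix.vecMul_zero, Matrix.vecMul_neg, Matrix.vecMul_one,
      add_zero]
  set h' := h.act (SymplecticGroup.symJ (Fin d) ℚ_[p]) with hh'
  have ht : h'.t = h.t := rfl
  ext i
  · rcases i with i | i
    · change 0 + h'.a i = 0 + (h.b i + 0)
      rw [ha]
      ring
    · change (-x) i + h'.b i = 0 + (0 + (-(x + h.a)) i)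
      rw [hb]
      simp only [Pi.neg_apply, Pi.add_apply]
      ring
  · change 0 + h'.t + 1 / 2 * ((0 : Fin d → ℚ_[p]) ⬝ᵥ h'.b - (-x) ⬝ᵥ h'.a)
      = h.t + 1 / 2 * (h.a ⬝ᵥ h.b) + h.b ⬝ᵥ x
        + (0 + 0 + 1 / 2 * (h.b ⬝ᵥ (-(x + h.a)) - (0 : Fin d → ℚ_[p]) ⬝ᵥ (0 : Fin d → ℚ_[p])))
        + 1 / 2 * omega 0 _
    rw [ha, ht, omega_zero_left]
    simp only [zero_dotProduct, neg_dotProduct, dotProduct_neg, dotProduct_add]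
    rw [dotProduct_comm x h.b, dotProduct_comm h.a h.b]
    ring

theorem fourierFun_equivariant (hψ : IsSmoothChar ψ) (h : Heisenberg p d) (f : SchwartzFun p d) :
    schrodingerFun ψ h (fourierFun hψ f)
      = fourierFun hψ (schrodinger d ψ hψ (h.act (SymplecticGroup.symJ (Fin d) ℚ_[p])) f) := by
  funext x
  rw [schrodingerFun, fourierFun, fourierFun, ← Module.End.mul_apply, ← map_mul,
    modulation_mul_act_J, map_mul, map_mul, Module.End.mul_apply, Module.End.mul_apply,
    schrodinger_central, map_smul, haarFunctional_translation, smul_eq_mul]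

/-- The Fourier transform of Schwartz functions. -/
noncomputable def fourierLinear (hψ : IsSmoothChar ψ) (hψ1 : ψ ≠ 1) :
    SchwartzFun p d →ₗ[ℂ_[p]] SchwartzFun p d where
  toFun f := ⟨fourierFun hψ f, mem_SchwartzFun_of_equivariant hψ hψ1 _ (fourierFun hψ)
    (fourierFun_equivariant hψ) f⟩
  map_add' f f' := by
    ext x
    simp [fourierFun]
  map_smul' c f := by
    ext x
    simp [fourierFun]

theorem fourierLinear_equivariant (hψ : IsSmoothChar ψ) (hψ1 : ψ ≠ 1) (h : Heisenberg p d)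
    (f : SchwartzFun p d) : schrodinger d ψ hψ h (fourierLinear hψ hψ1 f)
      = fourierLinear hψ hψ1 (schrodinger d ψ hψ (h.act (SymplecticGroup.symJ (Fin d) ℚ_[p])) f) :=
  Subtype.ext (fourierFun_equivariant hψ h f)

/-- The Fourier transform of the indicator function of a polydisc is a multiple of the indicator
function of the dual polydisc. -/
theorem fourierLinear_indicatorPolydisc (hψ : IsSmoothChar ψ) (hψ1 : ψ ≠ 1) {r s : ℚ_[p]}
    (hr : ψ r ≠ 1) (hpr : ψ (p * r) = 1) (hs : s ≠ 0) (hrs : p * r / s ≠ 0) :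
    fourierLinear hψ hψ1 (indicatorPolydisc (0 : Fin d → ℚ_[p]) hs)
      = haarFunctional p d (indicatorPolydisc 0 hs) • indicatorPolydisc 0 hrs := by
  apply Subtype.ext
  funext x
  change haarFunctional p d (schrodinger d ψ hψ (modulation (-x)) (indicatorPolydisc 0 hs))
    = haarFunctional p d (indicatorPolydisc 0 hs)
      * Set.indicator (polydisc 0 ((p : ℚ_[p]) * r / s)) (fun _ => 1) x
  by_cases hx : x ∈ polydisc 0 ((p : ℚ_[p]) * r / s)
  · rw [Set.indicator_of_mem hx, mul_one]
    congr 1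
    apply Subtype.ext
    rw [coe_schrodinger, schrodingerFun_modulation, coe_indicatorPolydisc]
    funext y
    by_cases hy : y ∈ polydisc 0 s
    · rw [Set.indicator_of_mem hy, mul_one, neg_dotProduct, AddChar.map_neg_eq_inv,
        map_dotProduct_eq_one hψ hpr hs hx hy, inv_one]
    · rw [Set.indicator_of_notMem hy, mul_zero]
  · rw [Set.indicator_of_notMem hx, mul_zero]
    obtain ⟨b, hb, hbx⟩ := exists_map_dotProduct_ne_one hψ hr hrs hx
    have hpr0 : p * r ≠ 0 := fun h => hrs (by rw [h, zero_div])
    rw [div_div_cancel₀ hpr0] at hb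
    -- Translation by `b` multiplies the integral by a value of the character other than `1`.
    have e : schrodinger d ψ hψ (translation b)
        (schrodinger d ψ hψ (modulation (-x)) (indicatorPolydisc 0 hs))
        = ψ (-(b ⬝ᵥ x)) • schrodinger d ψ hψ (modulation (-x)) (indicatorPolydisc 0 hs) := by
      apply Subtype.ext
      rw [coe_schrodinger, schrodingerFun_translation, coe_schrodinger, schrodingerFun_modulation,
        SetLike.val_smul, coe_schrodinger, schrodingerFun_modulation, coe_indicatorPolydisc]
      funext y
      have hyb : y + b ∈ polydisc 0 s ↔ y ∈ polydisc 0 s := by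
        have h2 : y + b ∈ polydisc y s := by
          rwa [mem_polydisc_iff, add_sub_cancel_left, ← sub_zero b, ← mem_polydisc_iff]
        rw [mem_polydisc_comm, polydisc_eq_of_mem h2, mem_polydisc_comm]
      beta_reduce
      rw [Pi.smul_apply, smul_eq_mul, ← mul_assoc, ← AddChar.map_add_eq_mul, dotProduct_add,
        neg_dotProduct x b, dotProduct_comm x b, add_comm (-x ⬝ᵥ y)]
      congr 1
      by_cases hy : y ∈ polydisc 0 s
      · rw [Set.indicator_of_mem hy, Set.indicator_of_mem (hyb.2 hy)]
      · rw [Set.indicator_of_notMem hy, Set.indicator_of_notMem (fun h => hy (hyb.1 h))]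
    have h1 := haarFunctional_translation hψ b
      (schrodinger d ψ hψ (modulation (-x)) (indicatorPolydisc 0 hs))
    rw [e, map_smul, smul_eq_mul, AddChar.map_neg_eq_inv] at h1
    by_contra h0
    apply hbx
    have h2 := mul_right_cancel₀ h0 (h1.trans (one_mul _).symm)
    rwa [inv_eq_one] at h2

/-- The Fourier transform is bijective: its square is an intertwining operator of `J ^ 2`, an
element of the Siegel parabolic. -/
theorem fourierLinear_bijective (hψ : IsSmoothChar ψ) (hψ1 : ψ ≠ 1) :
    Function.Bijective (fourierLinear (d := d) hψ hψ1) := by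
  set F := fourierLinear (d := d) hψ hψ1
  set J := SymplecticGroup.symJ (Fin d) ℚ_[p]
  have hJ : (J * J)⁻¹ ∈ siegelParabolic p d := by
    refine inv_mem ?_
    change (Matrix.J (Fin d) ℚ_[p] * Matrix.J (Fin d) ℚ_[p]).toBlocks₂₁ = 0
    rw [Matrix.J_squared, ← Matrix.fromBlocks_one, Matrix.fromBlocks_neg,
      Matrix.toBlocks_fromBlocks₂₁, neg_zero]
  obtain ⟨c, hc⟩ := exists_smul_of_equivariant_one hψ hψ1
    (L := siegelLinear hψ hψ1 hJ ∘ₗ F ∘ₗ F) (fun h f => by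
      rw [LinearMap.comp_apply, LinearMap.comp_apply, siegelLinear_equivariant,
        LinearMap.comp_apply, fourierLinear_equivariant, fourierLinear_equivariant, act_act,
        act_act, inv_mul_cancel, LinearMap.comp_apply])
  have hinj := siegelLinear_injective hψ hψ1 hJ
  have hc0 : c ≠ 0 := by
    rintro rfl
    obtain ⟨r, hr0, hr1, hpr⟩ := hψ.exists_conductor hψ1
    have hpr0 : (p : ℚ_[p]) * r ≠ 0 := mul_ne_zero Padic.prime_ne_zero hr0
    have hpr1 : (p : ℚ_[p]) * r / 1 ≠ 0 := by rwa [div_one]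
    have hpr2 : (p : ℚ_[p]) * r / (p * r / 1) ≠ 0 := div_ne_zero hpr0 hpr1
    have h1 := hc (indicatorPolydisc 0 one_ne_zero)
    rw [zero_smul, LinearMap.comp_apply, ← map_zero (siegelLinear hψ hψ1 hJ)] at h1
    have h2 := hinj h1
    rw [LinearMap.comp_apply, fourierLinear_indicatorPolydisc hψ hψ1 hr1 hpr one_ne_zero hpr1,
      map_smul, fourierLinear_indicatorPolydisc hψ hψ1 hr1 hpr hpr1 hpr2, smul_smul] at h2
    have h3 := congrArg (fun f : SchwartzFun p d => (f : (Fin d → ℚ_[p]) → ℂ_[p]) 0) h2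
    simp only [SetLike.val_smul, Pi.smul_apply, indicatorPolydisc_self, smul_eq_mul, mul_one] at h3
    exact mul_ne_zero (haarFunctional_indicatorPolydisc_ne_zero _)
      (haarFunctional_indicatorPolydisc_ne_zero _) h3
  constructor
  · rw [injective_iff_map_eq_zero]
    intro f hf
    have h1 := hc f
    rw [LinearMap.comp_apply, LinearMap.comp_apply, hf, map_zero, map_zero] at h1
    exact (smul_eq_zero.1 h1.symm).resolve_left hc0
  · intro f
    refine ⟨F (c⁻¹ • siegelLinear hψ hψ1 hJ f), ?_⟩
    apply hinj
    have h1 := hc (c⁻¹ • siegelLinear hψ hψ1 hJ f)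
    rw [LinearMap.comp_apply, LinearMap.comp_apply, smul_smul, mul_inv_cancel₀ hc0, one_smul] at h1
    exact h1

theorem symJ_mem_intertwinable (hψ : IsSmoothChar ψ) (hψ1 : ψ ≠ 1) :
    SymplecticGroup.symJ (Fin d) ℚ_[p] ∈ intertwinable d hψ :=
  ⟨LinearEquiv.ofBijective _ (fourierLinear_bijective hψ hψ1),
    fun h f => fourierLinear_equivariant hψ hψ1 h f⟩

/-- The symplectic group is generated by the Siegel parabolic and `J`. -/
theorem exists_isIntertwining (hψ : IsSmoothChar ψ) (hψ1 : ψ ≠ 1)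
    (g : Matrix.symplecticGroup (Fin d) ℚ_[p]) : ∃ T, IsIntertwining ψ hψ g T := by
  obtain ⟨S, S', hS, hS', h⟩ := exists_symplectic_factor g
  have hJ := symJ_mem_intertwinable (d := d) hψ hψ1
  have hP := siegelParabolic_le_intertwinable (d := d) hψ hψ1
  have hu : ∀ (S : Matrix (Fin d) (Fin d) ℚ_[p]) (hS : Sᵀ = S),
      symplecticUnipotent hS ∈ intertwinable d hψ := by
    intro S hS
    refine hP ?_
    change (Matrix.fromBlocks 1 S 0 1).toBlocks₂₁ = 0
    rw [Matrix.toBlocks_fromBlocks₂₁]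
  have h1 := hP h
  rw [Subgroup.mul_mem_cancel_right _ hJ, Subgroup.mul_mem_cancel_right _ (hu S' hS'),
    Subgroup.mul_mem_cancel_right _ hJ, Subgroup.mul_mem_cancel_right _ (hu S hS)] at h1
  exact h1

/-- For an element of the Siegel parabolic, every intertwining operator is a multiple of an isometry
for the sup norm. -/
theorem exists_supNorm_eq (hψ : IsSmoothChar ψ) (hψ1 : ψ ≠ 1)
    {g : Matrix.symplecticGroup (Fin d) ℚ_[p]} (hg : g ∈ siegelParabolic p d)
    {T : SchwartzFun p d ≃ₗ[ℂ_[p]] SchwartzFun p d} (hT : IsIntertwining ψ hψ g T) :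
    ∃ c : ℝ, 0 < c ∧ ∀ f, supNorm (T f) = c * supNorm f := by
  have hg' := inv_mem hg
  obtain ⟨c, hc⟩ := exists_smul_of_equivariant_one hψ hψ1
    (L := siegelLinear hψ hψ1 hg' ∘ₗ T.toLinearMap) (fun h f => by
      rw [LinearMap.comp_apply, LinearMap.comp_apply, siegelLinear_equivariant,
        LinearEquiv.coe_coe, hT, act_act, inv_mul_cancel])
  have hc0 : c ≠ 0 := by
    rintro rfl
    obtain ⟨f0, hf0⟩ := exists_schwartz_ne_zero (p := p) (d := d)
    have h1 := hc f0
    rw [zero_smul] at h1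
    apply hf0
    apply T.injective
    apply siegelLinear_injective hψ hψ1 hg'
    rw [map_zero, map_zero]
    exact h1
  refine ⟨‖c‖, norm_pos_iff.2 hc0, fun f => ?_⟩
  rw [← supNorm_siegelLinear hψ hψ1 hg']
  have h1 : siegelLinear hψ hψ1 hg' (T f) = c • f := hc f
  rw [h1, supNorm, supNorm, Real.mul_iSup_of_nonneg (norm_nonneg c)]
  refine iSup_congr fun x => ?_
  rw [SetLike.val_smul, Pi.smul_apply, norm_smul]

end Intertwining

/-! ### The norms parametrized by the Grassmannian -/

section Norms

open BoundedContinuousFunction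

variable {p : ℕ} [hp : Fact p.Prime] {d : ℕ} {ψ : AddChar ℚ_[p] ℂ_[p]}

/-- A Schwartz function as a bounded continuous function. -/
noncomputable def SchwartzFun.toBounded (p d : ℕ) [Fact p.Prime] :
    SchwartzFun p d →ₗ[ℂ_[p]] ((Fin d → ℚ_[p]) →ᵇ ℂ_[p]) where
  toFun f := ofNormedAddCommGroup f f.2.1.continuous (SchwartzFun.exists_norm_le f).choose
    (SchwartzFun.exists_norm_le f).choose_spec
  map_add' _ _ := rfl
  map_smul' _ _ := rfl

theorem SchwartzFun.norm_toBounded (f : SchwartzFun p d) :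
    ‖SchwartzFun.toBounded p d f‖ = supNorm f :=
  norm_eq_iSup_norm _

theorem norm_le_supNorm (f : SchwartzFun p d) (x : Fin d → ℚ_[p]) :
    ‖(f : (Fin d → ℚ_[p]) → ℂ_[p]) x‖ ≤ supNorm f := by
  rw [← SchwartzFun.norm_toBounded]
  exact norm_coe_le_norm (SchwartzFun.toBounded p d f) x

theorem supNorm_nonneg (f : SchwartzFun p d) : 0 ≤ supNorm f := by
  rw [← SchwartzFun.norm_toBounded]
  exact norm_nonneg _

theorem supNorm_le {f : SchwartzFun p d} {C : ℝ}
    (h : ∀ x, ‖(f : (Fin d → ℚ_[p]) → ℂ_[p]) x‖ ≤ C) : supNorm f ≤ C := ciSup_le h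

theorem supNorm_eq_zero {f : SchwartzFun p d} : supNorm f = 0 ↔ f = 0 := by
  constructor
  · intro h
    apply Subtype.ext
    funext x
    exact norm_le_zero_iff.1 ((norm_le_supNorm f x).trans h.le)
  · rintro rfl
    rw [← SchwartzFun.norm_toBounded, map_zero, norm_zero]

theorem supNorm_schrodinger (hψ : IsSmoothChar ψ) (h : Heisenberg p d) (f : SchwartzFun p d) :
    supNorm (schrodinger d ψ hψ h f) = supNorm f := by
  rw [supNorm, supNorm, ← (Equiv.addRight h.a).surjective.iSup_comp
    fun x => ‖(f : (Fin d → ℚ_[p]) → ℂ_[p]) x‖]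
  refine iSup_congr fun x => ?_
  rw [coe_schrodinger, schrodingerFun, norm_mul, hψ.norm_eq_one, one_mul]
  rfl

theorem IsIntertwining.apply_schrodinger {hψ : IsSmoothChar ψ}
    {g : Matrix.symplecticGroup (Fin d) ℚ_[p]} {T : SchwartzFun p d ≃ₗ[ℂ_[p]] SchwartzFun p d}
    (hT : IsIntertwining ψ hψ g T) (h : Heisenberg p d) (f : SchwartzFun p d) :
    T (schrodinger d ψ hψ h f) = schrodinger d ψ hψ (h.act g⁻¹) (T f) := by
  rw [hT, Heisenberg.act_act, inv_mul_cancel, Heisenberg.act_one]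

theorem IsIntertwining.trans_symm {hψ : IsSmoothChar ψ}
    {g g' : Matrix.symplecticGroup (Fin d) ℚ_[p]}
    {T T' : SchwartzFun p d ≃ₗ[ℂ_[p]] SchwartzFun p d}
    (hT : IsIntertwining ψ hψ g T) (hT' : IsIntertwining ψ hψ g' T') :
    IsIntertwining ψ hψ (g' * g⁻¹) (T.symm.trans T') := by
  intro h f
  rw [LinearEquiv.trans_apply, LinearEquiv.trans_apply, hT']
  congr 1
  apply T.injective
  rw [hT.apply_schrodinger, T.apply_symm_apply, T.apply_symm_apply, Heisenberg.act_act]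

/-- The invariant norm obtained by pulling back the sup norm along an intertwining operator and
scaling. -/
noncomputable def IsIntertwining.invariantNorm {hψ : IsSmoothChar ψ}
    {g : Matrix.symplecticGroup (Fin d) ℚ_[p]} {T : SchwartzFun p d ≃ₗ[ℂ_[p]] SchwartzFun p d}
    (hT : IsIntertwining ψ hψ g T) {r : ℝ} (hr : 0 < r) :
    InvariantNorm (schrodinger d ψ hψ) where
  toFun f := r * supNorm (T f)
  nonneg f := mul_nonneg hr.le (supNorm_nonneg _)
  eq_zero_iff f := by
    rw [mul_eq_zero, or_iff_right hr.ne', supNorm_eq_zero, LinearEquiv.map_eq_zero_iff]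
  smul_eq c f := by
    rw [map_smul, ← SchwartzFun.norm_toBounded, ← SchwartzFun.norm_toBounded, map_smul, norm_smul,
      mul_left_comm]
  add_le_max f f' := by
    rw [← mul_max_of_nonneg _ _ hr.le]
    refine mul_le_mul_of_nonneg_left (supNorm_le fun x => ?_) hr.le
    rw [map_add]
    exact (IsUltrametricDist.norm_add_le_max _ _).trans
      (max_le_max (norm_le_supNorm _ x) (norm_le_supNorm _ x))
  invariant h f := by
    rw [hT.apply_schrodinger, supNorm_schrodinger]

theorem exists_isNormAt (hψ : IsSmoothChar ψ) (hψ1 : ψ ≠ 1) (α : Grassmannian p d) :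
    ∃ N, IsNormAt ψ hψ α N := by
  obtain ⟨g, rfl⟩ := Quotient.exists_rep α
  obtain ⟨T, hT⟩ := exists_isIntertwining hψ hψ1 g
  have h1 : indicatorZp p d ≠ 0 := by
    intro h
    have h1 := indicatorPolydisc_self (0 : Fin d → ℚ_[p]) (one_ne_zero (α := ℚ_[p]))
    rw [← indicatorZp_eq, h] at h1
    exact zero_ne_one h1
  have h2 : supNorm (T (indicatorZp p d)) ≠ 0 := by
    rwa [Ne, supNorm_eq_zero, LinearEquiv.map_eq_zero_iff]
  have h3 : 0 < (supNorm (T (indicatorZp p d)))⁻¹ :=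
    inv_pos.2 ((supNorm_nonneg _).lt_of_ne' h2)
  exact ⟨hT.invariantNorm h3, ⟨g, rfl, T, hT, _, h3, fun f => rfl⟩, inv_mul_cancel₀ h2⟩

theorem IsNormAt.unique {hψ : IsSmoothChar ψ} (hψ1 : ψ ≠ 1) {α : Grassmannian p d}
    {N N' : InvariantNorm (schrodinger d ψ hψ)} (hN : IsNormAt ψ hψ α N)
    (hN' : IsNormAt ψ hψ α N') : N' = N := by
  obtain ⟨⟨g, hg, T, hT, r, hr, hNT⟩, hN1⟩ := hN
  obtain ⟨⟨g', hg', T', hT', r', hr', hNT'⟩, hN1'⟩ := hN'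
  have hgg : g' * g⁻¹ ∈ siegelParabolic p d :=
    QuotientGroup.rightRel_apply.1 (Quotient.exact (hg.trans hg'.symm))
  obtain ⟨c, hc, h⟩ := exists_supNorm_eq hψ hψ1 hgg (hT.trans_symm hT')
  have h1 : ∀ f, N'.toFun f = r' * c / r * N.toFun f := by
    intro f
    have h2 := h (T f)
    rw [LinearEquiv.trans_apply, T.symm_apply_apply] at h2
    rw [hNT', hNT, h2]
    field_simp
  have h2 := h1 (indicatorZp p d)
  rw [hN1, hN1', mul_one] at h2
  ext f
  rw [h1, ← h2, one_mul]

/-- The completion of the space of Schwartz functions for a norm at a point of the Grassmannian is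
a space of bounded continuous functions, on which the Heisenberg group acts through the same
formula as in the Schrödinger representation, up to the automorphism of the group given by `g`. -/
theorem IsIntertwining.exists_realization {hψ : IsSmoothChar ψ}
    {g : Matrix.symplecticGroup (Fin d) ℚ_[p]} {T : SchwartzFun p d ≃ₗ[ℂ_[p]] SchwartzFun p d}
    (hT : IsIntertwining ψ hψ g T) {N : InvariantNorm (schrodinger d ψ hψ)} {r : ℝ} (hr : 0 < r)
    (hN : ∀ f, N.toFun f = r * supNorm (T f)) :
    ∃ Φ : N.Completion →ₗ[ℂ_[p]] ((Fin d → ℚ_[p]) →ᵇ ℂ_[p]),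
      (∀ v, ‖v‖ = r * ‖Φ v‖) ∧
      (∀ f, (Φ (N.toCompletion f) : (Fin d → ℚ_[p]) → ℂ_[p]) = T f) ∧
      ∀ h v, (Φ (N.completionRep (h.act g) v) : (Fin d → ℚ_[p]) → ℂ_[p])
        = schrodingerFun ψ h (Φ v) := by
  have hN' : ∀ f : SchwartzFun p d, r⁻¹ * N.toFun f = ‖SchwartzFun.toBounded p d (T f)‖ := by
    intro f
    rw [hN, inv_mul_cancel_left₀ hr.ne', SchwartzFun.norm_toBounded]
  let ι : N.Space →L[ℂ_[p]] ((Fin d → ℚ_[p]) →ᵇ ℂ_[p]) :=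
    LinearMap.mkContinuous (E := N.Space) (SchwartzFun.toBounded p d ∘ₗ T.toLinearMap) r⁻¹
      fun f => (hN' f).ge
  have hι : ∀ f : SchwartzFun p d,
      ι.fromCompletion (N.toCompletion f) = SchwartzFun.toBounded p d (T f) :=
    ι.fromCompletion_apply_coe
  have hcont : Continuous ι.fromCompletion := ι.fromCompletion.continuous
  refine ⟨ι.fromCompletion, fun v => ?_, fun f => ?_, fun h v => ?_⟩
  · induction v using UniformSpace.Completion.induction_on with
    | hp => exact isClosed_eq continuous_norm (continuous_const.mul hcont.norm)
    | ih f =>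
      have h1 : N.toFun f = r * ‖ι.fromCompletion (N.toCompletion f)‖ := by
        rw [hι f]
        exact (inv_mul_eq_iff_eq_mul₀ hr.ne').1 (hN' f)
      exact (UniformSpace.Completion.norm_coe f).trans h1
  · exact congrArg _ (hι f)
  · funext x
    induction v using UniformSpace.Completion.induction_on with
    | hp =>
      have h1 : Continuous (N.completionRep (h.act g)) := (N.action _).completion.continuous
      refine isClosed_eq ?_ ?_
      · exact (continuous_eval_const x).comp (hcont.comp h1)
      · exact continuous_const.mul
          ((continuous_eval_const (x + h.a)).comp hcont)
    | ih f =>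
      let f' : SchwartzFun p d := f
      have h1 := N.completionRep_toCompletion (h.act g) f'
      have h2 : (ι.fromCompletion (N.completionRep (h.act g) (N.toCompletion f')) :
          (Fin d → ℚ_[p]) → ℂ_[p]) x
          = schrodingerFun ψ h (ι.fromCompletion (N.toCompletion f')) x := by
        rw [h1, hι, hι]
        exact congrFun (congrArg Subtype.val (hT h f').symm) x
      exact h2

end Norms

/-! ### Strongly cyclic vectors -/

section StronglyCyclic

open Filter

variable {p : ℕ} [hp : Fact p.Prime] {ι E : Type*} [AddCommGroup E] [Module ℂ_[p] E]


/-- The finite linear combinations of the vectors `v i` with coefficients of norm at most `K`. -/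
def boundedSpan (p : ℕ) [Fact p.Prime] {ι E : Type*} [AddCommGroup E] [Module ℂ_[p] E]
    (v : ι → E) (K : ℝ) : AddSubgroup E :=
  AddSubgroup.closure {x | ∃ (c : ℂ_[p]) (i : ι), ‖c‖ ≤ K ∧ x = c • v i}

theorem smul_mem_boundedSpan {v : ι → E} {K : ℝ} {c : ℂ_[p]} (hc : ‖c‖ ≤ K) (i : ι) :
    c • v i ∈ boundedSpan p v K :=
  AddSubgroup.subset_closure ⟨c, i, hc, rfl⟩

theorem boundedSpan_mono {v : ι → E} {K L : ℝ} (h : K ≤ L) :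
    boundedSpan p v K ≤ boundedSpan p v L :=
  AddSubgroup.closure_mono fun _ ⟨c, i, hc, hx⟩ => ⟨c, i, hc.trans h, hx⟩

/-- As the norm of `ℂ_[p]` is non-archimedean, terms with the same vector can be collected. -/
theorem exists_finsupp_of_mem_boundedSpan {v : ι → E} {K : ℝ} (hK : 0 ≤ K) {x : E}
    (hx : x ∈ boundedSpan p v K) :
    ∃ c : ι →₀ ℂ_[p], (∀ i, ‖c i‖ ≤ K) ∧ x = Finsupp.linearCombination ℂ_[p] v c := by
  classical
  induction hx using AddSubgroup.closure_induction with
  | mem x hx =>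
    obtain ⟨c, i, hc, rfl⟩ := hx
    refine ⟨Finsupp.single i c, fun j => ?_, ?_⟩
    · rw [Finsupp.single_apply]
      split_ifs
      · exact hc
      · rwa [norm_zero]
    · rw [Finsupp.linearCombination_single]
  | zero => exact ⟨0, fun i => by rwa [Finsupp.zero_apply, norm_zero], by simp⟩
  | add x y _ _ hx hy =>
    obtain ⟨c, hc, rfl⟩ := hx
    obtain ⟨c', hc', rfl⟩ := hy
    refine ⟨c + c', fun i => ?_, ?_⟩
    · exact (IsUltrametricDist.norm_add_le_max _ _).trans (max_le (hc i) (hc' i))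
    · rw [map_add]
  | neg x _ hx =>
    obtain ⟨c, hc, rfl⟩ := hx
    refine ⟨-c, fun i => by rw [Finsupp.neg_apply, norm_neg]; exact hc i, ?_⟩
    rw [map_neg]

/-- A vector is strongly cyclic as soon as every vector can be approximated, up to a half of its
norm, by a combination of the translates with proportionally bounded coefficients: iterating the
approximation on the error gives a convergent expansion. -/
theorem isStronglyCyclic_of_approx {G B : Type*} [Group G] [NormedAddCommGroup B]
    [NormedSpace ℂ_[p] B] {ρ : Representation ℂ_[p] G B} (hρ : IsBanachRep ρ) {v : B} {K : ℝ}
    (hK : 0 ≤ K)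
    (h : ∀ w : B, ∃ x ∈ boundedSpan p (fun g => ρ g v) (K * ‖w‖), ‖w - x‖ ≤ ‖w‖ / 2) :
    IsStronglyCyclic ρ v := by
  have := hρ.complete
  have : IsUltrametricDist B := IsUltrametricDist.isUltrametricDist_of_forall_norm_add_le_max_norm
    hρ.ultrametric
  choose x hx hxw using h
  intro w
  let u : ℕ → B := fun n => (fun y => y - x y)^[n] w
  have hu : ∀ n, u (n + 1) = u n - x (u n) := fun n => Function.iterate_succ_apply' _ _ _
  have hun : ∀ n, ‖u n‖ ≤ ‖w‖ * (1 / 2) ^ n := by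
    intro n
    induction n with
    | zero => simp [u]
    | succ n ih =>
      rw [hu, pow_succ]
      linarith [hxw (u n)]
  have hlim : Tendsto (fun n : ℕ => K * (‖w‖ * (1 / 2) ^ n)) atTop (𝓝 0) := by
    have h1 := (tendsto_pow_atTop_nhds_zero_of_lt_one (r := (1 / 2 : ℝ)) (by norm_num)
      (by norm_num)).const_mul (K * ‖w‖)
    simpa [mul_assoc] using h1
  have hulim : Tendsto u atTop (𝓝 0) := by
    have h1 := (tendsto_pow_atTop_nhds_zero_of_lt_one (r := (1 / 2 : ℝ)) (by norm_num)
      (by norm_num)).const_mul ‖w‖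
    rw [mul_zero] at h1
    exact squeeze_zero_norm hun h1
  have hc := fun n => exists_finsupp_of_mem_boundedSpan (by positivity) (hx (u n))
  choose c hc hcx using hc
  have hcn : ∀ n g, ‖c n g‖ ≤ K * (‖w‖ * (1 / 2) ^ n) := fun n g =>
    (hc n g).trans (mul_le_mul_of_nonneg_left (hun n) hK)
  have hfin : ∀ ε : ℝ, 0 < ε → ∃ s : Set (ℕ × G), s.Finite ∧ ∀ q ∉ s, ‖c q.1 q.2‖ ≤ ε / 2 := by
    intro ε hε
    obtain ⟨n0, hn0⟩ := eventually_atTop.1 (hlim.eventually (ge_mem_nhds (half_pos hε)))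
    refine ⟨⋃ n ∈ Set.Iio n0, (fun g => (n, g)) '' (c n).support, ?_, fun q hq => ?_⟩
    · exact (Set.finite_Iio n0).biUnion fun n _ => ((c n).support.finite_toSet.image _)
    · by_cases hq' : n0 ≤ q.1
      · exact (hcn _ _).trans (hn0 _ hq')
      · have h0 : c q.1 q.2 = 0 := by
          by_contra h0
          exact hq (Set.mem_biUnion (x := q.1) (not_le.1 hq')
            ⟨q.2, Finsupp.mem_support_iff.2 h0, rfl⟩)
        rw [h0, norm_zero]
        exact (half_pos hε).le
  have hsc : ∀ g, Summable fun n => c n g := by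
    intro g
    apply NonarchimedeanAddGroup.summable_of_tendsto_cofinite_zero
    rw [Nat.cofinite_eq_atTop]
    exact squeeze_zero_norm (fun n => hcn n g) hlim
  have hsum : Summable fun q : ℕ × G => c q.1 q.2 • ρ q.2 v := by
    apply NonarchimedeanAddGroup.summable_of_tendsto_cofinite_zero
    rw [Metric.tendsto_nhds]
    intro ε hε
    obtain ⟨s, hs, h1⟩ := hfin (ε / (‖v‖ + 1)) (by positivity)
    filter_upwards [hs.compl_mem_cofinite] with q hq
    rw [dist_zero_right, norm_smul, hρ.invariant]
    calc ‖c q.1 q.2‖ * ‖v‖ ≤ ε / (‖v‖ + 1) / 2 * (‖v‖ + 1) := by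
          gcongr
          · exact h1 q hq
          · linarith
      _ = ε / 2 := by field_simp
      _ < ε := half_lt_self hε
  have hrow : ∀ n, HasSum (fun g => c n g • ρ g v) (u n - u (n + 1)) := by
    intro n
    rw [hu, sub_sub_cancel, hcx n, Finsupp.linearCombination_apply]
    exact hasSum_sum_of_ne_finset_zero fun g hg => by
      rw [Finsupp.notMem_support_iff.1 hg, zero_smul]
  have htotal : ∑' q : ℕ × G, c q.1 q.2 • ρ q.2 v = w := by
    have h1 := (hsum.hasSum.prod_fiberwise hrow).tendsto_sum_nat
    have h2 : Tendsto (fun n => ∑ i ∈ Finset.range n, (u i - u (i + 1))) atTop (𝓝 w) := by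
      simp_rw [Finset.sum_range_sub']
      simpa [u] using tendsto_const_nhds.sub hulim
    exact tendsto_nhds_unique h1 h2
  -- The family over `ℕ × G` sums to `w` along the rows; summing it along the columns gives the
  -- expansion.
  refine ⟨fun g => ∑' n, c n g, fun ε hε => ?_, ?_⟩
  · obtain ⟨s, hs, h1⟩ := hfin ε hε
    refine (hs.image Prod.snd).subset fun g hg => ?_
    by_contra hgs
    have h2 : ‖∑' n, c n g‖ ≤ ε / 2 :=
      IsUltrametricDist.norm_tsum_le_of_forall_le_of_nonneg (half_pos hε).le fun n =>
        h1 (n, g) fun hq => hgs ⟨_, hq, rfl⟩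
    have h3 : ε ≤ ‖∑' n, c n g‖ := hg
    linarith
  · have h1 : HasSum (fun q : G × ℕ => c q.2 q.1 • ρ q.1 v) w := by
      have h2 := ((Equiv.prodComm G ℕ).hasSum_iff
        (f := fun q : ℕ × G => c q.1 q.2 • ρ q.2 v)).2 hsum.hasSum
      rw [htotal] at h2
      exact h2
    exact h1.prod_fiberwise fun g => (hsc g).hasSum.smul_const (ρ g v)

end StronglyCyclic

/-! ### Strong irreducibility of the function model -/

section FunctionModel

variable {p : ℕ} [hp : Fact p.Prime] {d : ℕ} {ψ : AddChar ℚ_[p] ℂ_[p]}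

open Heisenberg

theorem schrodingerFun_mem_boundedSpan {F G : (Fin d → ℚ_[p]) → ℂ_[p]} {K : ℝ}
    (hG : G ∈ boundedSpan p (fun h => schrodingerFun ψ h F) K) (h : Heisenberg p d) :
    schrodingerFun ψ h G ∈ boundedSpan p (fun h => schrodingerFun ψ h F) K := by
  induction hG using AddSubgroup.closure_induction with
  | mem G hG =>
    obtain ⟨c, h', hc, rfl⟩ := hG
    rw [schrodingerFun_smul]
    beta_reduce
    rw [← schrodingerFun_mul]
    exact smul_mem_boundedSpan hc _
  | zero => rw [schrodingerFun_zero]; exact zero_mem _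
  | add G G' _ _ hG hG' => rw [schrodingerFun_add]; exact add_mem hG hG'
  | neg G _ hG => rw [schrodingerFun_neg]; exact neg_mem hG

theorem mul_mem_boundedSpan {F G g : (Fin d → ℚ_[p]) → ℂ_[p]} {K L : ℝ}
    (hg : g ∈ trigPoly d ψ L) (hG : G ∈ boundedSpan p (fun h => schrodingerFun ψ h F) K) :
    g * G ∈ boundedSpan p (fun h => schrodingerFun ψ h F) (L * K) := by
  induction hg using AddSubgroup.closure_induction with
  | mem g hg =>
    obtain ⟨c, b, hc, rfl⟩ := hg
    induction hG using AddSubgroup.closure_induction with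
    | mem G hG =>
      obtain ⟨c', h, hc', rfl⟩ := hG
      have e : (fun x => c * ψ (b ⬝ᵥ x)) * c' • schrodingerFun ψ h F
          = (c * c') • schrodingerFun ψ (modulation b * h) F := by
        rw [schrodingerFun_mul, schrodingerFun_modulation]
        funext x
        simp only [Pi.mul_apply, Pi.smul_apply, smul_eq_mul]
        ring
      rw [e]
      refine smul_mem_boundedSpan (v := fun h => schrodingerFun ψ h F) ?_ _
      rw [norm_mul]
      exact mul_le_mul hc hc' (norm_nonneg _) ((norm_nonneg _).trans hc)
    | zero => rw [mul_zero]; exact zero_mem _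
    | add G G' _ _ hG hG' => rw [mul_add]; exact add_mem hG hG'
    | neg G _ hG => rw [mul_neg]; exact neg_mem hG
  | zero => rw [zero_mul]; exact zero_mem _
  | add g g' _ _ hg hg' => rw [add_mul]; exact add_mem hg hg'
  | neg g _ hg => rw [neg_mul]; exact neg_mem hg

/-- Let `F` be a uniform limit of Schwartz functions that does not vanish at `x₀`. Multiplying `F`
with a trigonometric polynomial that approximates the characteristic function of a small polydisc
around `x₀` on a large polydisc, one obtains an approximation of that characteristic function on
the whole space. -/
theorem exists_approx_indicator (hψ : IsSmoothChar ψ) (hψ1 : ψ ≠ 1)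
    {F : (Fin d → ℚ_[p]) → ℂ_[p]}
    (hF : ∀ ε : ℝ, 0 < ε → ∃ W : SchwartzFun p d, ∀ x,
      ‖F x - (W : (Fin d → ℚ_[p]) → ℂ_[p]) x‖ ≤ ε)
    {x₀ : Fin d → ℚ_[p]} (hx₀ : F x₀ ≠ 0) :
    ∃ s : ℚ_[p], s ≠ 0 ∧ ∃ K : ℝ, 0 ≤ K ∧
      ∃ G ∈ boundedSpan p (fun h => schrodingerFun ψ h F) K,
        ∀ x, ‖Set.indicator (polydisc x₀ s) (fun _ => 1) x - G x‖ ≤ 1 / 4 := by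
  have hη : 0 < ‖F x₀‖ := norm_pos_iff.2 hx₀
  obtain ⟨W, hW⟩ := hF (‖F x₀‖ / 8) (by positivity)
  obtain ⟨m, hm⟩ := SchwartzFun.exists_const W
  obtain ⟨n, hn⟩ := SchwartzFun.exists_support W
  obtain ⟨C, hC⟩ := SchwartzFun.exists_norm_le W
  have hs : (p : ℚ_[p]) ^ m ≠ 0 := pow_ne_zero _ Padic.prime_ne_zero
  have hn' : ((p : ℚ_[p]) ^ n)⁻¹ ≠ 0 := inv_ne_zero (pow_ne_zero _ Padic.prime_ne_zero)
  set M := max C ‖F x₀‖ with hM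
  have hMpos : 0 < M := lt_max_of_lt_right hη
  have hFM : ∀ x, ‖F x‖ ≤ M := by
    intro x
    rw [← sub_add_cancel (F x) ((W : (Fin d → ℚ_[p]) → ℂ_[p]) x)]
    refine (IsUltrametricDist.norm_add_le_max _ _).trans (max_le ((hW x).trans ?_)
      ((hC x).trans (le_max_left _ _)))
    have := le_max_right C ‖F x₀‖
    linarith
  obtain ⟨g, hg, hgε⟩ := SchwartzFun.exists_trigPoly_close hψ hψ1 (indicatorPolydisc x₀ hs)
    (C := 1) (fun x => by
      rw [coe_indicatorPolydisc]
      by_cases hx : x ∈ polydisc x₀ ((p : ℚ_[p]) ^ m)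
      · rw [Set.indicator_of_mem hx, norm_one]
      · rw [Set.indicator_of_notMem hx, norm_zero]
        exact zero_le_one)
    0 hn' (K := 2) (by norm_num) (ε := ‖F x₀‖ / (4 * M)) (by positivity)
  rw [one_mul] at hg
  rw [coe_indicatorPolydisc] at hgε
  have hg2 : ∀ x, ‖g x‖ ≤ 2 := norm_le_of_mem_trigPoly hψ (by norm_num) hg
  have hq : ‖F x₀‖ / (4 * M) * M = ‖F x₀‖ / 4 := by field_simp
  have hFmem : F ∈ boundedSpan p (fun h => schrodingerFun ψ h F) 1 := by
    have h1 : F = (1 : ℂ_[p]) • schrodingerFun ψ 1 F := by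
      funext x
      have h2 := congrFun (schrodingerFun_modulation (ψ := ψ) 0 F) x
      rw [zero_dotProduct, AddChar.map_zero_eq_one, one_mul] at h2
      rw [one_smul, ← h2]
      congr 1
      ext1
      · funext i
        cases i <;> rfl
      · rfl
    have h2 : (1 : ℂ_[p]) • schrodingerFun ψ 1 F
        ∈ boundedSpan p (fun h => schrodingerFun ψ h F) 1 :=
      smul_mem_boundedSpan (v := fun h => schrodingerFun ψ h F) norm_one.le 1
    rwa [← h1] at h2
  refine ⟨_, hs, ‖(F x₀)⁻¹‖ * 2 * 1, by positivity, ((F x₀)⁻¹ • g) * F,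
    mul_mem_boundedSpan (smul_mem_trigPoly _ hg) hFmem, fun x => ?_⟩
  have e : ∀ z : ℂ_[p], z - (((F x₀)⁻¹ • g) * F) x = (F x₀)⁻¹ * (F x₀ * z - g x * F x) := by
    intro z
    simp only [Pi.mul_apply, Pi.smul_apply, smul_eq_mul]
    field_simp
  rw [e, norm_mul, norm_inv, inv_mul_le_iff₀ hη]
  by_cases hx : x ∈ polydisc 0 ((p : ℚ_[p]) ^ n)⁻¹
  · have h1 := hgε x hx
    by_cases hxs : x ∈ polydisc x₀ ((p : ℚ_[p]) ^ m)
    · rw [Set.indicator_of_mem hxs] at h1 ⊢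
      have e2 : F x₀ * 1 - g x * F x
          = F x₀ * (1 - g x) + g x * ((F x₀ - (W : (Fin d → ℚ_[p]) → ℂ_[p]) x₀)
            + -(F x - (W : (Fin d → ℚ_[p]) → ℂ_[p]) x)) := by
        rw [hm m le_rfl x₀ x hxs]
        ring
      rw [e2]
      refine (IsUltrametricDist.norm_add_le_max _ _).trans (max_le ?_ ?_)
      · rw [norm_mul]
        calc ‖F x₀‖ * ‖1 - g x‖ ≤ M * (‖F x₀‖ / (4 * M)) :=
              mul_le_mul (le_max_right _ _) h1 (norm_nonneg _) hMpos.le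
          _ = ‖F x₀‖ * (1 / 4) := by rw [mul_comm, hq]; ring
      · rw [norm_mul]
        calc _ ≤ 2 * (‖F x₀‖ / 8) := by
              refine mul_le_mul (hg2 x) ?_ (norm_nonneg _) (by norm_num)
              refine (IsUltrametricDist.norm_add_le_max _ _).trans (max_le (hW x₀) ?_)
              rw [norm_neg]
              exact hW x
          _ = ‖F x₀‖ * (1 / 4) := by ring
    · rw [Set.indicator_of_notMem hxs, zero_sub, norm_neg] at h1
      rw [Set.indicator_of_notMem hxs, mul_zero, zero_sub, norm_neg, norm_mul]
      calc ‖g x‖ * ‖F x‖ ≤ ‖F x₀‖ / (4 * M) * M := by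
            gcongr
            exact hFM x
        _ = ‖F x₀‖ * (1 / 4) := by rw [hq]; ring
  · have hWx : (W : (Fin d → ℚ_[p]) → ℂ_[p]) x = 0 := by
      by_contra h0
      exact hx (hn n le_rfl x h0)
    have hxs : x ∉ polydisc x₀ ((p : ℚ_[p]) ^ m) := by
      intro hxs
      have h1 := hW x₀
      rw [← hm m le_rfl x₀ x hxs, hWx, sub_zero] at h1
      linarith
    have h1 := hW x
    rw [hWx, sub_zero] at h1
    rw [Set.indicator_of_notMem hxs, mul_zero, zero_sub, norm_neg, norm_mul]
    calc ‖g x‖ * ‖F x‖ ≤ 2 * (‖F x₀‖ / 8) := mul_le_mul (hg2 x) h1 (norm_nonneg _) (by norm_num)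
      _ = ‖F x₀‖ * (1 / 4) := by ring

/-- Every Schwartz function is a sum of pieces supported in the polydiscs of a fixed radius. Each
piece is approximated by the product of a trigonometric polynomial and a translate of the
approximate characteristic function, with coefficients bounded by a constant multiple of the sup
norm. -/
theorem exists_approx_of_ne_zero (hψ : IsSmoothChar ψ) (hψ1 : ψ ≠ 1)
    {F : (Fin d → ℚ_[p]) → ℂ_[p]}
    (hF : ∀ ε : ℝ, 0 < ε → ∃ W : SchwartzFun p d, ∀ x,
      ‖F x - (W : (Fin d → ℚ_[p]) → ℂ_[p]) x‖ ≤ ε) (hF0 : F ≠ 0) :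
    ∃ K : ℝ, 0 ≤ K ∧ ∀ W : SchwartzFun p d,
      ∃ G ∈ boundedSpan p (fun h => schrodingerFun ψ h F) (K * supNorm W),
        ∀ x, ‖(W : (Fin d → ℚ_[p]) → ℂ_[p]) x - G x‖ ≤ supNorm W / 2 := by
  obtain ⟨x₀, hx₀⟩ := Function.ne_iff.1 hF0
  obtain ⟨s, hs, K, hK, G, hG, hGε⟩ := exists_approx_indicator hψ hψ1 hF hx₀
  refine ⟨2 * K, by positivity, fun W => ?_⟩
  rcases eq_or_ne W 0 with rfl | hW0
  · refine ⟨0, zero_mem _, fun x => ?_⟩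
    rw [supNorm_eq_zero.2 rfl]
    simp
  set C := supNorm W with hC
  have hCpos : 0 < C := (supNorm_nonneg W).lt_of_ne' (mt supNorm_eq_zero.1 hW0)
  obtain ⟨n, hn⟩ := SchwartzFun.exists_support W
  obtain ⟨t, ht, ht'⟩ := exists_finset_polydisc (isCompact_polydisc 0 ((p : ℚ_[p]) ^ n)⁻¹) hs
  have hg := fun a : Fin d → ℚ_[p] => SchwartzFun.exists_trigPoly_close hψ hψ1 W
    (norm_le_supNorm W) a hs (K := 2) (by norm_num) (ε := C / 2) (by positivity)
  choose g hg hgε using hg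
  let H : (Fin d → ℚ_[p]) → (Fin d → ℚ_[p]) → ℂ_[p] := fun a =>
    schrodingerFun ψ (translation (x₀ - a)) G
  have hH : ∀ a x, ‖Set.indicator (polydisc a s) (fun _ => 1) x - H a x‖ ≤ 1 / 4 := by
    intro a x
    have h1 := hGε (x + (x₀ - a))
    have h2 : H a x = G (x + (x₀ - a)) := congrFun (schrodingerFun_translation _ _) x
    have h3 : x + (x₀ - a) ∈ polydisc x₀ s ↔ x ∈ polydisc a s := by
      rw [mem_polydisc_iff, mem_polydisc_iff]
      rw [show x + (x₀ - a) - x₀ = x - a by abel]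
    rw [h2]
    convert h1 using 3
    by_cases hx : x ∈ polydisc a s
    · rw [Set.indicator_of_mem hx, Set.indicator_of_mem (h3.2 hx)]
    · rw [Set.indicator_of_notMem hx, Set.indicator_of_notMem (mt h3.1 hx)]
  refine ⟨∑ a ∈ t, g a * H a, sum_mem fun a _ => ?_, fun x => ?_⟩
  · have h1 := mul_mem_boundedSpan (hg a) (schrodingerFun_mem_boundedSpan hG
      (translation (x₀ - a)))
    rwa [show C * 2 * K = 2 * K * C by ring] at h1
  · have hWx : (W : (Fin d → ℚ_[p]) → ℂ_[p]) x = ∑ a ∈ t, (W : (Fin d → ℚ_[p]) → ℂ_[p]) x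
        * Set.indicator (polydisc a s) (fun _ => (1 : ℂ_[p])) x := by
      by_cases hx : (W : (Fin d → ℚ_[p]) → ℂ_[p]) x = 0
      · simp [hx]
      · obtain ⟨a, ha, hxa⟩ := ht x (hn n le_rfl x hx)
        exact (sum_indicator_polydisc ht' (fun _ => (W : (Fin d → ℚ_[p]) → ℂ_[p]) x) ha hxa).symm
    rw [hWx, Finset.sum_apply, ← Finset.sum_sub_distrib]
    refine IsUltrametricDist.norm_sum_le_of_forall_le_of_nonneg (by positivity) fun a _ => ?_
    have e : (W : (Fin d → ℚ_[p]) → ℂ_[p]) x * Set.indicator (polydisc a s) (fun _ => 1) x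
          - (g a * H a) x
        = ((W : (Fin d → ℚ_[p]) → ℂ_[p]) x - g a x) * Set.indicator (polydisc a s) (fun _ => 1) x
          + g a x * (Set.indicator (polydisc a s) (fun _ => 1) x - H a x) := by
      rw [Pi.mul_apply]
      ring
    rw [e]
    refine (IsUltrametricDist.norm_add_le_max _ _).trans (max_le ?_ ?_)
    · by_cases hx : x ∈ polydisc a s
      · rw [Set.indicator_of_mem hx, mul_one]
        exact hgε a x hx
      · rw [Set.indicator_of_notMem hx, mul_zero, norm_zero]
        positivity
    · rw [norm_mul]
      calc _ ≤ C * 2 * (1 / 4) := mul_le_mul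
            (norm_le_of_mem_trigPoly hψ (by positivity) (hg a) x) (hH a x) (norm_nonneg _)
            (by positivity)
        _ = C / 2 := by ring

end FunctionModel

/-! ### Separation of the points of the Grassmannian -/

section Separation

open Heisenberg Filter

variable {p : ℕ} [hp : Fact p.Prime] {d : ℕ} {ψ : AddChar ℚ_[p] ℂ_[p]}

theorem exists_map_ne_one_lt_norm (hψ1 : ψ ≠ 1) (B : ℝ) : ∃ r : ℚ_[p], ψ r ≠ 1 ∧ B < ‖r‖ := by
  obtain ⟨r, hr⟩ := DFunLike.ne_iff.1 hψ1
  rw [AddChar.one_apply] at hr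
  have hr0 : 0 < ‖r‖ := by
    rw [norm_pos_iff]
    rintro rfl
    exact hr (AddChar.map_zero_eq_one ψ)
  obtain ⟨j, hj⟩ := Padic.exists_prime_pow_norm_le (p := p) (δ := ‖r‖ / (|B| + 1)) (by positivity)
  have hp0 : (p : ℚ_[p]) ^ j ≠ 0 := pow_ne_zero _ Padic.prime_ne_zero
  refine ⟨r / p ^ j, fun h => hr ?_, ?_⟩
  · have h1 := IsSmoothChar.map_natCast_mul (ψ := ψ) (p ^ j) (r / p ^ j)
    rwa [h, one_pow, Nat.cast_pow, mul_div_cancel₀ _ hp0] at h1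
  · have h1 := hj j le_rfl
    rw [le_div_iff₀ (by positivity)] at h1
    rw [norm_div, lt_div_iff₀ (norm_pos_iff.2 hp0)]
    have h2 := le_abs_self B
    have h3 := norm_pos_iff.2 hp0
    nlinarith

theorem norm_prime_pow_le_norm_natCast {k m : ℕ} (h0 : 0 < m) (hm : m ≤ p ^ k) :
    ‖(p : ℚ_[p]) ^ k‖ ≤ ‖(m : ℚ_[p])‖ := by
  by_contra! h
  have h1 : ‖((m : ℤ) : ℚ_[p])‖ ≤ (p : ℝ) ^ (-((k + 1 : ℕ) : ℤ)) := by
    rw [Padic.norm_le_pow_iff_norm_lt_pow_add_one, Int.cast_natCast]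
    rw [Padic.norm_p_pow] at h
    rwa [show -((k + 1 : ℕ) : ℤ) + 1 = -(k : ℤ) by push_cast; ring]
  rw [Padic.norm_int_le_pow_iff_dvd] at h1
  have h2 : p ^ (k + 1) ∣ m := by exact_mod_cast h1
  have h3 := Nat.le_of_dvd h0 h2
  have h4 := Nat.pow_lt_pow_right hp.out.one_lt (Nat.lt_succ_self k)
  exact absurd (h4.trans_le h3) (not_lt.2 hm)

/-- An intertwining operator of a symplectic matrix outside the Siegel parabolic is unbounded for
the sup norm. The combination of modulations whose coefficients are those of the polynomial with
roots `1, q, …, q ^ (n - 1)` is small on the functions with a given support, while the operator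
turns the modulations into translations that move the image to disjoint sets. -/
theorem IsIntertwining.exists_lt_supNorm {hψ : IsSmoothChar ψ} (hψ1 : ψ ≠ 1)
    {g : Matrix.symplecticGroup (Fin d) ℚ_[p]} {T : SchwartzFun p d ≃ₗ[ℂ_[p]] SchwartzFun p d}
    (hT : IsIntertwining ψ hψ g T) (hg : g ∉ siegelParabolic p d) {C : ℝ} (hC : 0 ≤ C) :
    ∃ f, C * supNorm f < supNorm (T f) := by
  have hg' : (g⁻¹).1.toBlocks₂₁ ≠ 0 := fun h =>
    hg (inv_mem_iff.1 (show g⁻¹ ∈ siegelParabolic p d from h))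
  obtain ⟨i, hi⟩ : ∃ i, (g⁻¹).1.toBlocks₂₁ i ≠ 0 := Function.ne_iff.1 hg'
  set a₀ : Fin d → ℚ_[p] := (g⁻¹).1.toBlocks₂₁ i with ha₀
  -- Modulations by multiples of `b₀` correspond to translations by multiples of `a₀`.
  let b₀ : Fin d → ℚ_[p] := Pi.single i 1
  let u : SchwartzFun p d := indicatorPolydisc 0 one_ne_zero
  let φ := T.symm u
  obtain ⟨M, hM⟩ := SchwartzFun.exists_support φ
  have hp0 : (p : ℚ_[p]) ≠ 0 := Padic.prime_ne_zero
  have hpM : 0 < ‖(p : ℚ_[p]) ^ M‖ := norm_pos_iff.2 (pow_ne_zero _ hp0)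
  have ha₀pos : 0 < ‖a₀‖ := norm_pos_iff.2 hi
  -- The support of `φ` is fixed before `r` is chosen so large that the translates of the unit
  -- polydisc by different `s j • a₀` are disjoint.
  obtain ⟨r, hr, hrn⟩ := exists_map_ne_one_lt_norm hψ1 (‖(p : ℚ_[p]) ^ M‖ * ‖a₀‖)⁻¹
  rw [inv_lt_iff_one_lt_mul₀ (by positivity)] at hrn
  set q := ‖ψ (r / p) - 1‖ ^ (p - 1) with hq
  have hq1 : q < 1 := hψ.norm_sub_one_pow_pred_lt_one _
  have hq0 : 0 ≤ q := by positivity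
  obtain ⟨k, hk⟩ : ∃ k : ℕ, C * (q ^ k * supNorm φ) < 1 := by
    have h1 := ((tendsto_pow_atTop_nhds_zero_of_lt_one hq0 hq1).mul_const (supNorm φ)).const_mul C
    rw [zero_mul, mul_zero] at h1
    exact (h1.eventually (gt_mem_nhds one_pos)).exists
  have hpk : (p : ℚ_[p]) ^ k ≠ 0 := pow_ne_zero _ hp0
  set P := gaussPoly (ψ (r / p ^ k)) (p ^ k) with hP
  let s : ℕ → ℚ_[p] := fun j => j * (r * p ^ M / p ^ k)
  let f : SchwartzFun p d := ∑ j ∈ Finset.range (p ^ k + 1),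
    P.coeff j • schrodinger d ψ hψ (modulation (s j • b₀)) φ
  refine ⟨f, ?_⟩
  have h1 : supNorm f ≤ q ^ k * supNorm φ := by
    refine supNorm_le fun x => ?_
    have e : (f : (Fin d → ℚ_[p]) → ℂ_[p]) x
        = P.eval (ψ (r / p ^ k * (p ^ M * x i))) * (φ : (Fin d → ℚ_[p]) → ℂ_[p]) x := by
      rw [Polynomial.eval_eq_sum_range, gaussPoly_natDegree, Finset.sum_mul,
        AddSubmonoidClass.coe_finsetSum, Finset.sum_apply]
      refine Finset.sum_congr rfl fun j _ => ?_
      rw [SetLike.val_smul, Pi.smul_apply, coe_schrodinger, schrodingerFun_modulation, smul_eq_mul,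
        ← IsSmoothChar.map_natCast_mul]
      beta_reduce
      rw [smul_dotProduct, single_one_dotProduct, smul_eq_mul,
        ← mul_assoc (P.coeff j)]
      congr 3
      simp only [s]
      ring
    rw [e, norm_mul]
    by_cases hx : (φ : (Fin d → ℚ_[p]) → ℂ_[p]) x = 0
    · rw [hx, norm_zero, mul_zero]
      exact mul_nonneg (pow_nonneg hq0 _) (supNorm_nonneg _)
    · have hxi := hM M le_rfl x hx i
      rw [Pi.zero_apply, sub_zero, norm_inv, ← one_div, le_div_iff₀ hpM] at hxi
      refine mul_le_mul ?_ (norm_le_supNorm φ x) (norm_nonneg _) (pow_nonneg hq0 _)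
      refine hψ.norm_gaussPoly_eval_le hr k ?_
      rwa [norm_mul, mul_comm]
  have h2 : 1 ≤ supNorm (T f) := by
    have hTφ : T φ = u := T.apply_symm_apply u
    have ha : ∀ j, ((modulation (s j • b₀)).act g⁻¹).a = s j • a₀ := by
      intro j
      have h0 : (modulation (s j • b₀)).a = 0 := rfl
      have hb : (modulation (s j • b₀)).b = s j • b₀ := rfl
      rw [act_a, h0, hb, Matrix.zero_vecMul, zero_add, Matrix.smul_vecMul, Matrix.single_one_vecMul]
      rfl
    -- At this point only the leading term is non-zero.
    have e : (T f : (Fin d → ℚ_[p]) → ℂ_[p]) (-(s (p ^ k) • a₀))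
        = ψ (((modulation (s (p ^ k) • b₀)).act g⁻¹).t
          + 1 / 2 * (((modulation (s (p ^ k) • b₀)).act g⁻¹).a
            ⬝ᵥ ((modulation (s (p ^ k) • b₀)).act g⁻¹).b)
          + ((modulation (s (p ^ k) • b₀)).act g⁻¹).b ⬝ᵥ -(s (p ^ k) • a₀)) := by
      rw [map_sum, AddSubmonoidClass.coe_finsetSum, Finset.sum_apply,
        Finset.sum_eq_single_of_mem (p ^ k) (Finset.self_mem_range_succ _)]
      · have hc : P.coeff (p ^ k) = 1 := by
          have := (gaussPoly_monic (ψ (r / p ^ k)) (p ^ k)).coeff_natDegree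
          rwa [gaussPoly_natDegree] at this
        rw [hc, one_smul, hT.apply_schrodinger, hTφ, coe_schrodinger, schrodingerFun, ha,
          neg_add_cancel, indicatorPolydisc_self, mul_one]
      · intro j hj hjk
        have hjk' : j < p ^ k := by
          have := Finset.mem_range.1 hj
          omega
        rw [map_smul, hT.apply_schrodinger, hTφ, SetLike.val_smul, Pi.smul_apply, coe_schrodinger,
          schrodingerFun, ha, coe_indicatorPolydisc, Set.indicator_of_notMem, mul_zero, smul_zero]
        rw [mem_polydisc_iff, sub_zero, norm_one, not_le]
        have e2 : -(s (p ^ k) • a₀) + s j • a₀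
            = -(((p ^ k - j : ℕ) : ℚ_[p]) / p ^ k * (r * p ^ M)) • a₀ := by
          rw [← neg_smul, ← add_smul, Nat.cast_sub hjk'.le]
          congr 1
          simp only [s, Nat.cast_pow]
          field_simp
          ring
        rw [e2, norm_smul, norm_neg, norm_mul, norm_mul]
        have h3 : 1 ≤ ‖((p ^ k - j : ℕ) : ℚ_[p]) / p ^ k‖ := by
          rw [norm_div, le_div_iff₀ (norm_pos_iff.2 hpk), one_mul]
          exact norm_prime_pow_le_norm_natCast (by omega) (by omega)
        calc 1 < ‖r‖ * (‖(p : ℚ_[p]) ^ M‖ * ‖a₀‖) := hrn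
          _ = 1 * (‖r‖ * ‖(p : ℚ_[p]) ^ M‖) * ‖a₀‖ := by ring
          _ ≤ _ := by gcongr
    have h3 := norm_le_supNorm (T f) (-(s (p ^ k) • a₀))
    rwa [e, hψ.norm_eq_one] at h3
  calc C * supNorm f ≤ C * (q ^ k * supNorm φ) := mul_le_mul_of_nonneg_left h1 hC
    _ < 1 := hk
    _ ≤ supNorm (T f) := h2

end Separation

/-! ### The completions -/

namespace InvariantNorm

variable {p : ℕ} [hp : Fact p.Prime] {G : Type*} [Group G] {V : Type*} [AddCommGroup V]
  [Module ℂ_[p] V] {ρ : Representation ℂ_[p] G V}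

theorem toCompletion_add (N : InvariantNorm ρ) (v w : V) :
    N.toCompletion (v + w) = N.toCompletion v + N.toCompletion w :=
  UniformSpace.Completion.coe_add (α := N.Space) v w

theorem toCompletion_smul (N : InvariantNorm ρ) (c : ℂ_[p]) (v : V) :
    N.toCompletion (c • v) = c • N.toCompletion v :=
  UniformSpace.Completion.coe_smul (X := N.Space) c v

theorem toCompletion_injective (N : InvariantNorm ρ) : Function.Injective N.toCompletion :=
  UniformSpace.Completion.coe_injective N.Space

theorem norm_toCompletion (N : InvariantNorm ρ) (v : V) : ‖N.toCompletion v‖ = N.toFun v :=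
  UniformSpace.Completion.norm_coe (E := N.Space) v

theorem denseRange_toCompletion (N : InvariantNorm ρ) : DenseRange N.toCompletion :=
  UniformSpace.Completion.denseRange_coe (α := N.Space)

theorem isBanachRep (N : InvariantNorm ρ) : IsBanachRep N.completionRep where
  complete := inferInstance
  ultrametric v w := by
    induction v, w using UniformSpace.Completion.induction_on₂ with
    | hp =>
      exact isClosed_le (continuous_fst.add continuous_snd).norm
        (continuous_fst.norm.max continuous_snd.norm)
    | ih v w =>
      have h1 : ∀ v w : V, ‖N.toCompletion v + N.toCompletion w‖
          ≤ max ‖N.toCompletion v‖ ‖N.toCompletion w‖ := fun v w => by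
        rw [← toCompletion_add, norm_toCompletion, norm_toCompletion, norm_toCompletion]
        exact N.add_le_max v w
      exact h1 v w
  invariant g v := by
    induction v using UniformSpace.Completion.induction_on with
    | hp => exact isClosed_eq (N.action g).completion.continuous.norm continuous_norm
    | ih v =>
      have h1 : ∀ v : V, ‖N.completionRep g (N.toCompletion v)‖ = ‖N.toCompletion v‖ := fun v => by
        rw [completionRep_toCompletion, norm_toCompletion, norm_toCompletion, N.invariant]
      exact h1 v

end InvariantNorm

section Completions

open BoundedContinuousFunction

variable {p : ℕ} [hp : Fact p.Prime] {d : ℕ} {ψ : AddChar ℚ_[p] ℂ_[p]} {hψ : IsSmoothChar ψ}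

theorem IsNormAt.isStronglyIrreducible (hψ1 : ψ ≠ 1) {α : Grassmannian p d}
    {N : InvariantNorm (schrodinger d ψ hψ)} (hN : IsNormAt ψ hψ α N) :
    IsStronglyIrreducible N.completionRep := by
  obtain ⟨⟨g, -, T, hT, r, hr, hNT⟩, -⟩ := hN
  obtain ⟨Φ, hΦ1, hΦ2, hΦ3⟩ := hT.exists_realization hr hNT
  refine ⟨N.isBanachRep, fun v hv => ?_⟩
  have hult := N.isBanachRep.ultrametric
  -- The function attached to `v` is a uniform limit of Schwartz functions.
  have happ : ∀ ε : ℝ, 0 < ε → ∃ W : SchwartzFun p d, ∀ x,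
      ‖Φ v x - (W : (Fin d → ℚ_[p]) → ℂ_[p]) x‖ ≤ ε := by
    intro ε hε
    obtain ⟨f, hf⟩ := N.denseRange_toCompletion.exists_dist_lt v (mul_pos hr hε)
    refine ⟨T f, fun x => ?_⟩
    rw [dist_eq_norm, hΦ1, mul_lt_mul_iff_right₀ hr, map_sub] at hf
    have h1 := norm_coe_le_norm (Φ v - Φ (N.toCompletion f)) x
    rw [BoundedContinuousFunction.sub_apply, hΦ2] at h1
    exact h1.trans hf.le
  have hv0 : (Φ v : (Fin d → ℚ_[p]) → ℂ_[p]) ≠ 0 := by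
    intro h
    have h1 : Φ v = 0 := DFunLike.coe_injective h
    have h2 := hΦ1 v
    rw [h1, norm_zero, mul_zero] at h2
    exact hv (norm_eq_zero.1 h2)
  obtain ⟨K, hK, hKW⟩ := exists_approx_of_ne_zero hψ hψ1 happ hv0
  -- Combinations of translates of functions lift to combinations of translates of vectors.
  have hlift : ∀ (L : ℝ), ∀ F ∈ boundedSpan p (fun h => schrodingerFun ψ h (Φ v)) L,
      ∃ x ∈ boundedSpan p (fun h => N.completionRep h v) L,
        (Φ x : (Fin d → ℚ_[p]) → ℂ_[p]) = F := by
    intro L F hF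
    induction hF using AddSubgroup.closure_induction with
    | mem F hF =>
      obtain ⟨c, h, hc, rfl⟩ := hF
      refine ⟨c • N.completionRep (h.act g) v,
        smul_mem_boundedSpan (v := fun h => N.completionRep h v) hc _, ?_⟩
      beta_reduce
      rw [map_smul, ← hΦ3]
      rfl
    | zero => exact ⟨0, zero_mem _, by rw [map_zero]; rfl⟩
    | add F F' _ _ hF hF' =>
      obtain ⟨x, hx, rfl⟩ := hF
      obtain ⟨x', hx', rfl⟩ := hF'
      exact ⟨x + x', add_mem hx hx', by rw [map_add]; rfl⟩
    | neg F _ hF =>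
      obtain ⟨x, hx, rfl⟩ := hF
      exact ⟨-x, neg_mem hx, by rw [map_neg]; rfl⟩
  refine isStronglyCyclic_of_approx N.isBanachRep (K := K / r) (by positivity) fun w => ?_
  rcases eq_or_ne w 0 with rfl | hw
  · exact ⟨0, zero_mem _, by simp⟩
  have hw' : 0 < ‖w‖ := norm_pos_iff.2 hw
  obtain ⟨f, hf⟩ := N.denseRange_toCompletion.exists_dist_lt w (half_pos hw')
  rw [dist_eq_norm] at hf
  have hfw : ‖N.toCompletion f‖ ≤ ‖w‖ := by
    have h1 := hult (-(w - N.toCompletion f)) w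
    rw [norm_neg, show -(w - N.toCompletion f) + w = N.toCompletion f by abel] at h1
    exact h1.trans (max_le (by linarith) le_rfl)
  have hTf : r * supNorm (T f) = ‖N.toCompletion f‖ := by rw [N.norm_toCompletion, hNT]
  obtain ⟨F, hF, hFf⟩ := hKW (T f)
  obtain ⟨x, hx, rfl⟩ := hlift _ F hF
  refine ⟨x, boundedSpan_mono ?_ hx, ?_⟩
  · calc K * supNorm (T f) = K / r * (r * supNorm (T f)) := by field_simp
      _ ≤ K / r * ‖w‖ := by
        rw [hTf]
        gcongr
  · rw [← sub_add_sub_cancel w (N.toCompletion f) x]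
    refine (hult _ _).trans (max_le hf.le ?_)
    rw [hΦ1, map_sub]
    have h1 : ‖Φ (N.toCompletion f) - Φ x‖ ≤ supNorm (T f) / 2 := by
      refine (norm_le (by have := supNorm_nonneg (T f); positivity)).2 fun y => ?_
      rw [BoundedContinuousFunction.sub_apply, hΦ2]
      exact hFf y
    calc r * ‖Φ (N.toCompletion f) - Φ x‖ ≤ r * (supNorm (T f) / 2) := by gcongr
      _ = ‖N.toCompletion f‖ / 2 := by rw [← hTf]; ring
      _ ≤ ‖w‖ / 2 := by gcongr

theorem range_toCompletion_subset_smoothVectors (N : InvariantNorm (schrodinger d ψ hψ)) :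
    Set.range N.toCompletion ⊆ smoothVectors N.completionRep := by
  rintro _ ⟨f, rfl⟩
  refine (Heisenberg.isOpen_stabilizer_iff N.completionRep _).2
    (Filter.mem_of_superset (stabilizer_mem_nhds hψ f) fun h hh => ?_)
  change N.completionRep h (N.toCompletion f) = N.toCompletion f
  rw [N.completionRep_toCompletion, show schrodinger d ψ hψ h f = f from hh]

theorem IsNormAt.smoothVectors_eq (hψ1 : ψ ≠ 1) {α : Grassmannian p d}
    {N : InvariantNorm (schrodinger d ψ hψ)} (hN : IsNormAt ψ hψ α N) :
    smoothVectors N.completionRep = Set.range N.toCompletion := by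
  refine subset_antisymm (fun v hv => ?_) (range_toCompletion_subset_smoothVectors N)
  obtain ⟨⟨g, -, T, hT, r, hr, hNT⟩, -⟩ := hN
  obtain ⟨Φ, hΦ1, hΦ2, hΦ3⟩ := hT.exists_realization hr hNT
  have h1 := (Heisenberg.isOpen_stabilizer_iff N.completionRep v).1 hv
  have h2 : {h | schrodingerFun ψ h (Φ v) = Φ v} ∈ 𝓝 1 := by
    have hc := (Heisenberg.continuous_act g).continuousAt (x := 1)
    rw [ContinuousAt, Heisenberg.one_act] at hc
    have h2 : ∀ᶠ h in 𝓝 (1 : Heisenberg p d), N.completionRep h v = v := h1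
    exact (hc.eventually h2).mono fun h hh => by rw [← hΦ3, hh]
  let f : SchwartzFun p d := ⟨Φ v, mem_SchwartzFun_of_stabilizer hψ hψ1 h2⟩
  refine ⟨T.symm f, ?_⟩
  have h3 : Φ (N.toCompletion (T.symm f)) = Φ v := by
    apply DFunLike.coe_injective
    rw [hΦ2, T.apply_symm_apply]
  have h4 := hΦ1 (N.toCompletion (T.symm f) - v)
  rw [map_sub, h3, sub_self, norm_zero, mul_zero] at h4
  exact sub_eq_zero.1 (norm_eq_zero.1 h4)

/-- An equivariant map preserves smooth vectors, so it is a scalar on the Schwartz functions by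
Schur's lemma. -/
theorem exists_smul_of_mem_equivariantMaps (hψ1 : ψ ≠ 1)
    {N N' : InvariantNorm (schrodinger d ψ hψ)}
    (hN' : smoothVectors N'.completionRep = Set.range N'.toCompletion)
    {F : N.Completion →L[ℂ_[p]] N'.Completion}
    (hF : F ∈ equivariantMaps N.completionRep N'.completionRep) :
    ∃ c : ℂ_[p], ∀ f, F (N.toCompletion f) = c • N'.toCompletion f := by
  have hF' : ∀ h v, F (N.completionRep h v) = N'.completionRep h (F v) := hF
  have h1 : ∀ f, ∃ f', N'.toCompletion f' = F (N.toCompletion f) := by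
    intro f
    have h2 : F (N.toCompletion f) ∈ smoothVectors N'.completionRep := by
      refine (Heisenberg.isOpen_stabilizer_iff N'.completionRep _).2
        (Filter.mem_of_superset (stabilizer_mem_nhds hψ f) fun h hh => ?_)
      change N'.completionRep h (F (N.toCompletion f)) = F (N.toCompletion f)
      rw [← hF', N.completionRep_toCompletion, show schrodinger d ψ hψ h f = f from hh]
    rwa [hN'] at h2
  choose L hL using h1
  obtain ⟨c, hc⟩ := exists_eq_smul_of_commute hψ hψ1
    { toFun := L
      map_add' := fun f f' => N'.toCompletion_injective (by
        rw [hL, N.toCompletion_add, map_add, N'.toCompletion_add, hL, hL])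
      map_smul' := fun a f => N'.toCompletion_injective (by
        rw [hL, N.toCompletion_smul, map_smul, RingHom.id_apply, N'.toCompletion_smul, hL]) }
    (fun h f => N'.toCompletion_injective (by
      change N'.toCompletion (L _) = N'.toCompletion (schrodinger d ψ hψ h (L f))
      rw [hL, ← N.completionRep_toCompletion, hF', ← N'.completionRep_toCompletion, hL]))
  refine ⟨c, fun f => ?_⟩
  rw [← hL, show L f = c • f from hc f, N'.toCompletion_smul]

theorem IsNormAt.nonempty_equivariantMaps_equiv (hψ1 : ψ ≠ 1) {α : Grassmannian p d}
    {N : InvariantNorm (schrodinger d ψ hψ)} (hN : IsNormAt ψ hψ α N) :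
    Nonempty (equivariantMaps N.completionRep N.completionRep ≃ₗ[ℂ_[p]] ℂ_[p]) := by
  let I : equivariantMaps N.completionRep N.completionRep :=
    ⟨ContinuousLinearMap.id ℂ_[p] N.Completion, fun _ _ => rfl⟩
  refine ⟨(LinearEquiv.ofBijective (LinearMap.toSpanSingleton ℂ_[p] _ I) ⟨?_, ?_⟩).symm⟩
  · rw [injective_iff_map_eq_zero]
    intro c hc
    obtain ⟨f, hf⟩ := exists_schwartz_ne_zero (p := p) (d := d)
    have h1 : c • N.toCompletion f = 0 :=
      congrArg (fun F : equivariantMaps N.completionRep N.completionRep =>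
        F.1 (N.toCompletion f)) hc
    refine (smul_eq_zero.1 h1).resolve_right fun h2 => hf ?_
    rw [← N.eq_zero_iff, ← N.norm_toCompletion, h2, norm_zero]
  · rintro ⟨F, hF⟩
    obtain ⟨c, hc⟩ := exists_smul_of_mem_equivariantMaps hψ1 (hN.smoothVectors_eq hψ1) hF
    refine ⟨c, Subtype.ext (ContinuousLinearMap.coeFn_injective ?_)⟩
    refine N.denseRange_toCompletion.equalizer ?_ F.continuous ?_
    · exact continuous_const_smul c
    · funext f
      exact (hc f).symm

theorem IsNormAt.equivariantMaps_eq_bot (hψ1 : ψ ≠ 1) {α β : Grassmannian p d} (hαβ : α ≠ β)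
    {N N' : InvariantNorm (schrodinger d ψ hψ)} (hN : IsNormAt ψ hψ α N)
    (hN' : IsNormAt ψ hψ β N') :
    equivariantMaps N.completionRep N'.completionRep = ⊥ := by
  rw [eq_bot_iff]
  intro F hF
  obtain ⟨c, hc⟩ := exists_smul_of_mem_equivariantMaps hψ1 (hN'.smoothVectors_eq hψ1) hF
  obtain ⟨⟨g, hg, T, hT, r, hr, hNT⟩, -⟩ := hN
  obtain ⟨⟨g', hg', T', hT', r', hr', hNT'⟩, -⟩ := hN'
  have hgg : g' * g⁻¹ ∉ siegelParabolic p d := fun h => hαβ (by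
    rw [← hg, ← hg']
    exact Quotient.sound (QuotientGroup.rightRel_apply.2 h))
  -- A non-zero scalar would bound the second norm by a multiple of the first one.
  have hc0 : c = 0 := by
    by_contra hc0
    have hcpos : 0 < ‖c‖ := norm_pos_iff.2 hc0
    obtain ⟨f, hf⟩ := (hT.trans_symm hT').exists_lt_supNorm hψ1 hgg
      (C := ‖F‖ * r / (‖c‖ * r')) (by positivity)
    have h1 := F.le_opNorm (N.toCompletion (T.symm f))
    rw [hc, norm_smul, N.norm_toCompletion, N'.norm_toCompletion, hNT, hNT',
      T.apply_symm_apply] at h1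
    rw [LinearEquiv.trans_apply, div_mul_eq_mul_div, div_lt_iff₀ (by positivity)] at hf
    linarith
  rw [Submodule.mem_bot]
  refine ContinuousLinearMap.coeFn_injective
    (N.denseRange_toCompletion.equalizer F.continuous continuous_zero ?_)
  funext f
  rw [Function.comp_apply, hc, hc0, zero_smul]
  rfl

end Completions

theorem mainTheorem3 (p : ℕ) [Fact p.Prime] (d : ℕ) (hd : 1 ≤ d)
    (ψ : AddChar ℚ_[p] ℂ_[p]) (hψ : IsSmoothChar ψ) (hψ_nontrivial : ψ ≠ 1) :
    ∃ ν : Grassmannian p d → InvariantNorm (schrodinger d ψ hψ),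
      (∀ (α : Grassmannian p d) (N : InvariantNorm (schrodinger d ψ hψ)),
        IsNormAt ψ hψ α N ↔ N = ν α) ∧
      ∀ α : Grassmannian p d,
        IsStronglyIrreducible (ν α).completionRep ∧
        smoothVectors (ν α).completionRep = Set.range (ν α).toCompletion ∧
        ∀ β : Grassmannian p d,
          (α = β → Nonempty
            (equivariantMaps (ν α).completionRep (ν β).completionRep ≃ₗ[ℂ_[p]] ℂ_[p])) ∧
          (α ≠ β → equivariantMaps (ν α).completionRep (ν β).completionRep = ⊥) := by
  choose ν hν using exists_isNormAt (d := d) hψ hψ_nontrivial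
  refine ⟨ν, fun α N => ⟨fun hN => (hν α).unique hψ_nontrivial hN, fun h => h ▸ hν α⟩,
    fun α => ⟨(hν α).isStronglyIrreducible hψ_nontrivial, (hν α).smoothVectors_eq hψ_nontrivial,
      fun β => ⟨?_, fun hαβ => (hν α).equivariantMaps_eq_bot hψ_nontrivial hαβ (hν β)⟩⟩⟩
  rintro rfl
  exact (hν α).nonempty_equivariantMaps_equiv hψ_nontrivial
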